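/- Let $d\ge 1$ be an integer, $0<\beta<1$ and $q=\frac{d}{d-\beta}$. For a scalar (real- or complex-valued) function $f\in L^1(\mathbb{R}^d)$ let $$M_\beta f(x)=\sup_{r>0}\ r^{\beta}\,\frac{1}{|B(x,r)|}\int_{B(x,r)}|f|$$ be the centered fractional Hardy--Littlewood maximal function, where $|B|$ denotes Lebesgue measure, and let $\mathbf{B}_x^\beta(f)$ be the set of closed balls $\overline{B(x,r)}$, $r>0$, for which the supremum is attained at $r$. Let $W^{1,1}_{\mathrm{rad}}(\mathbb{R}^d)$ be the space of radial functions in $W^{1,1}(\mathbb{R}^d)$, with norm $\|f\|_1+\|\nabla f\|_1$. Assume that there is a constant $C=C(d,\beta)$ such that for every $f\in W^{1,1}_{\mathrm{rad}}(\mathbb{R}^d)$, every $\rho>0$ and every measurable $H\subset\mathbb{R}^d$ the following two local bounds hold, where $\nabla M_\beta f$ is the weak gradient of $M_\beta f$ on $\mathbb{R}^d\setminus\{0\}$: 1. if for every $x\in H$ there is $B_x\in\mathbf{B}_x^\beta(f)$ with $B_x\subset B(0,\rho)$, then $$\int_H|\nabla M_\beta f|^q\le C\Big(\int_{B(0,2\rho)}|\nabla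 f|\Big)^q;$$ 2. if for every $x\in H$ there is $B_x\in\mathbf{B}_x^\beta(f)$ with $B_x\subset B(0,\rho)^c$, then $$\int_H|\nabla M_\beta f|^q\le C\Big(\int_{B(0,\rho/2)^c}|\nabla f|\Big)^q.$$ Then, for every $f\in W^{1,1}_{\mathrm{rad}}(\mathbb{R}^d)$, $M_\beta f$ is weakly differentiable on $\mathbb{R}^d$ with $|\nabla M_\beta f|\in L^q(\mathbb{R}^d)$, and the map $$f\mapsto|\nabla M_\beta f|$$ is continuous from $W^{1,1}_{\mathrm{rad}}(\mathbb{R}^d)$ to $L^q(\mathbb{R}^d)$. -/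

import Mathlib

open MeasureTheory Metric
open scoped ENNReal NNReal ContDiff

noncomputable section

/-- `G` is the weak gradient of `u` on the open set `Ω ⊆ ℝᵈ`: both are locally integrable on `Ω`
and `∫ u ∂ᵢφ = - ∫ Gᵢ φ` for every test function `φ ∈ C_c^∞(Ω)` and every coordinate `i`. -/
structure HasWeakGradOn {𝕜 : Type*} [RCLike 𝕜] {d : ℕ} (Ω : Set (EuclideanSpace ℝ (Fin d)))
    (u : EuclideanSpace ℝ (Fin d) → 𝕜)
    (G : EuclideanSpace ℝ (Fin d) → EuclideanSpace 𝕜 (Fin d)) : Prop where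
  locallyIntegrableOn_fun : LocallyIntegrableOn u Ω
  locallyIntegrableOn_grad : LocallyIntegrableOn G Ω
  integral_eq : ∀ φ : EuclideanSpace ℝ (Fin d) → ℝ, ContDiff ℝ ∞ φ → HasCompactSupport φ →
    tsupport φ ⊆ Ω → ∀ i : Fin d,
      ∫ x, fderiv ℝ φ x (EuclideanSpace.single i (1 : ℝ)) • u x = - ∫ x, φ x • G x i

/-- `f` belongs to `W^{1,1}_rad(ℝᵈ)` and `g` is its weak gradient: `f` and `g` are integrable, `g` is
the weak gradient of `f` on `ℝᵈ`, and `f` agrees almost everywhere with a radial function. -/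
structure IsRadialW11 {𝕜 : Type*} [RCLike 𝕜] {d : ℕ} (f : EuclideanSpace ℝ (Fin d) → 𝕜)
    (g : EuclideanSpace ℝ (Fin d) → EuclideanSpace 𝕜 (Fin d)) : Prop where
  integrable_fun : Integrable f
  integrable_grad : Integrable g
  hasWeakGradOn : HasWeakGradOn Set.univ f g
  radial : ∃ φ : ℝ → 𝕜, f =ᵐ[volume] fun x => φ ‖x‖

/-- The fractional average `r^β ⨍_{B(x,r)} |f|`. -/
def fracAverage {𝕜 : Type*} [RCLike 𝕜] {d : ℕ} (β : ℝ) (f : EuclideanSpace ℝ (Fin d) → 𝕜)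
    (x : EuclideanSpace ℝ (Fin d)) (r : ℝ) : ℝ≥0∞ :=
  ENNReal.ofReal (r ^ β) * ⨍⁻ y in ball x r, ‖f y‖ₑ ∂volume

/-- The centered fractional Hardy-Littlewood maximal function
`M_β f(x) = sup_{r > 0} r^β ⨍_{B(x,r)} |f|`, with values in `[0, ∞]`. -/
def fracMaximal {𝕜 : Type*} [RCLike 𝕜] {d : ℕ} (β : ℝ) (f : EuclideanSpace ℝ (Fin d) → 𝕜)
    (x : EuclideanSpace ℝ (Fin d)) : ℝ≥0∞ :=
  ⨆ (r : ℝ) (_ : 0 < r), fracAverage β f x r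

/-- `G` is the weak gradient of `M_β f` on `Ω`. For integrable `f` and `0 < β < d` the function
`M_β f` is finite almost everywhere, so that passing to real values is harmless. -/
def HasWeakGradFracMaximalOn {𝕜 : Type*} [RCLike 𝕜] {d : ℕ}
    (Ω : Set (EuclideanSpace ℝ (Fin d))) (β : ℝ) (f : EuclideanSpace ℝ (Fin d) → 𝕜)
    (G : EuclideanSpace ℝ (Fin d) → EuclideanSpace ℝ (Fin d)) : Prop :=
  HasWeakGradOn Ω (fun x => (fracMaximal β f x).toReal) G

/-- The closed balls centered at `x` that realize the supremum defining `M_β f(x)`. -/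
def bestBalls {𝕜 : Type*} [RCLike 𝕜] {d : ℕ} (β : ℝ) (f : EuclideanSpace ℝ (Fin d) → 𝕜)
    (x : EuclideanSpace ℝ (Fin d)) : Set (Set (EuclideanSpace ℝ (Fin d))) :=
  {B | ∃ r : ℝ, 0 < r ∧ B = closedBall x r ∧ fracMaximal β f x = fracAverage β f x r}

/-- Local boundedness near the origin for the centered operator `M_β`: with a constant `C`
depending on `d` and `β` only, `∫_H |∇M_β f|^q ≤ C (∫_{B(0,2ρ)} |∇f|)^q`, `q = d/(d-β)`, for all
`f ∈ W^{1,1}_rad`, all `ρ > 0` and all measurable `H` each of whose points has a best ball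
contained in `B(0,ρ)`. The gradient of `M_β f` is taken on `ℝᵈ ∖ {0}`, which determines it almost
everywhere, so that weak differentiability across the origin is not presupposed. -/
def LocalBoundNearZero (𝕜 : Type*) [RCLike 𝕜] (d : ℕ) (β : ℝ) : Prop :=
  ∃ C : ℝ≥0, ∀ (f : EuclideanSpace ℝ (Fin d) → 𝕜)
    (g : EuclideanSpace ℝ (Fin d) → EuclideanSpace 𝕜 (Fin d))
    (G : EuclideanSpace ℝ (Fin d) → EuclideanSpace ℝ (Fin d)),
    IsRadialW11 f g → HasWeakGradFracMaximalOn {0}ᶜ β f G →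
    ∀ (ρ : ℝ) (H : Set (EuclideanSpace ℝ (Fin d))), 0 < ρ → MeasurableSet H →
      (∀ x ∈ H, ∃ B ∈ bestBalls β f x, B ⊆ ball 0 ρ) →
      ∫⁻ x in H, ‖G x‖ₑ ^ ((d : ℝ) / (d - β)) ≤
        C * (∫⁻ x in ball 0 (2 * ρ), ‖g x‖ₑ) ^ ((d : ℝ) / (d - β))

/-- Local boundedness near infinity for the centered operator `M_β`: with a constant `C`
depending on `d` and `β` only, `∫_H |∇M_β f|^q ≤ C (∫_{B(0,ρ/2)ᶜ} |∇f|)^q`, `q = d/(d-β)`, for all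
`f ∈ W^{1,1}_rad`, all `ρ > 0` and all measurable `H` each of whose points has a best ball
contained in `B(0,ρ)ᶜ`. -/
def LocalBoundNearInfinity (𝕜 : Type*) [RCLike 𝕜] (d : ℕ) (β : ℝ) : Prop :=
  ∃ C : ℝ≥0, ∀ (f : EuclideanSpace ℝ (Fin d) → 𝕜)
    (g : EuclideanSpace ℝ (Fin d) → EuclideanSpace 𝕜 (Fin d))
    (G : EuclideanSpace ℝ (Fin d) → EuclideanSpace ℝ (Fin d)),
    IsRadialW11 f g → HasWeakGradFracMaximalOn {0}ᶜ β f G →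
    ∀ (ρ : ℝ) (H : Set (EuclideanSpace ℝ (Fin d))), 0 < ρ → MeasurableSet H →
      (∀ x ∈ H, ∃ B ∈ bestBalls β f x, B ⊆ (ball 0 ρ)ᶜ) →
      ∫⁻ x in H, ‖G x‖ₑ ^ ((d : ℝ) / (d - β)) ≤
        C * (∫⁻ x in (ball 0 (ρ / 2))ᶜ, ‖g x‖ₑ) ^ ((d : ℝ) / (d - β))

end

/-! ### Mollification of functions with integrable weak gradient. -/

section Mollification

open ContinuousLinearMap

variable {𝕜 : Type*} [RCLike 𝕜] {d : ℕ}

/-! Everything rests on control of the best radii. For radial `f` with weak gradient `g`, the mass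
of `f` in `B(x,r)` is at most a constant times `r^d ‖x‖^(1-d) ‖g‖₁` (`IsRadialW11.ballMass_le`).
Hence the fractional averages are `O(r^β)` for small `r`, locally uniformly off the origin, while
they are always `O(r^(β-d))`. So if `f ≠ 0` the supremum is attained off the origin, and on every
annulus the best radii lie in some `[r₀, R]` that depends only on the norms and on a lower bound for
the mass near the origin; the same `r₀, R` serve all functions close to `f`.

If `r` is a best radius at `x`, comparing `B(x,r)` with `B(y, r + ‖y - x‖)` gives `M f x - M f y ≤
(d-β)/r * M f x * ‖y - x‖`. Thus `M f` is locally Lipschitz off the origin, differentiable almost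
everywhere, and its gradient at `x` is `O(r^(β-d-1) ‖f‖₁)`. The origin is removable because `M f` is
even and locally integrable, and because the first local bound, exhausted over annuli, puts the
gradient in `L^q`.

For continuity let `f_n → f`. The gradients converge almost everywhere
(`RadialW11Tendsto.ae_tendsto_gradient`): the derivative of `M f_n` at `x` along a small vector `v`
exceeds the increment `M f_n (x + v) - M f_n x` by at most `‖v‖`-many multiples of the integral of
the gradient of `f_n` over a thin shell around a best sphere (`IsRadialW11.fderiv_maxFun_le`). Such
shells are small uniformly in the radius and in large `n`, and `M f_n → M f` pointwise, so letting
the step be small after `n` is large gives one inequality; replacing `v` by `-v` gives the other. On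
annuli dominated convergence finishes, the gradients being bounded there.

Near the origin and near infinity there is a dichotomy. Either the best radius is large compared
with the position, and the explicit gradient bound has small integral there; or it is small, the
best ball stays near the origin (respectively near infinity), and the local bounds estimate the
gradient by the mass of the gradient of `f_n` there, which is small uniformly in large `n`. The case
`f = 0` is covered by the global bound. -/

lemma HasWeakGradOn.fderiv_convolution_single {f : EuclideanSpace ℝ (Fin d) → 𝕜}
    {g : EuclideanSpace ℝ (Fin d) → EuclideanSpace 𝕜 (Fin d)} (hw : HasWeakGradOn Set.univ f g)
    {η : EuclideanSpace ℝ (Fin d) → ℝ} (hη : ContDiff ℝ ∞ η) (hc : HasCompactSupport η)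
    (x : EuclideanSpace ℝ (Fin d)) (i : Fin d) :
    fderiv ℝ (convolution η f (lsmul ℝ ℝ) volume) x (EuclideanSpace.single i 1) =
      ∫ t, η (x - t) • g t i := by
  have hf : LocallyIntegrable f volume := locallyIntegrableOn_univ.1 hw.locallyIntegrableOn_fun
  have h1 : ContDiff ℝ 1 η := hη.of_le (by exact_mod_cast le_top)
  rw [(hc.hasFDerivAt_convolution_left (lsmul ℝ ℝ) h1 hf x).fderiv]
  have hex := (hc.fderiv (𝕜 := ℝ)).convolutionExists_left (precompL (EuclideanSpace ℝ (Fin d))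
    (lsmul ℝ ℝ : ℝ →L[ℝ] 𝕜 →L[ℝ] 𝕜)) (h1.continuous_fderiv one_ne_zero) hf x
  have hcomp : ContDiff ℝ ∞ fun t => η (x - t) := hη.comp (contDiff_const.sub contDiff_id)
  have hcs : HasCompactSupport fun t => η (x - t) :=
    hc.comp_homeomorph (Homeomorph.subLeft x)
  -- The test function is the reflected mollifier `t ↦ η (x - t)`; the sign produced by the
  -- reflection cancels the sign in the integration by parts.
  have key := hw.integral_eq _ hcomp hcs (Set.subset_univ _) i
  have hd : ∀ t, fderiv ℝ (fun t => η (x - t)) t (EuclideanSpace.single i 1) =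
      - fderiv ℝ η (x - t) (EuclideanSpace.single i 1) := by
    intro t
    have h2 : HasFDerivAt η (fderiv ℝ η (x - t)) (x - t) :=
      (h1.differentiable one_ne_zero _).hasFDerivAt
    have h3 := h2.comp t ((hasFDerivAt_id t).const_sub x)
    have h4 : fderiv ℝ (fun t => η (x - t)) t = _ := h3.fderiv
    rw [h4]
    simp
  simp only [hd, neg_smul, integral_neg, neg_inj] at key
  rw [← key, convolution_def]
  refine (ContinuousLinearMap.integral_apply hex _).trans ?_
  rw [← integral_sub_left_eq_self _ volume x]
  simp [precompL_apply]

lemma HasWeakGradOn.enorm_fderiv_convolution_le {f : EuclideanSpace ℝ (Fin d) → 𝕜}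
    {g : EuclideanSpace ℝ (Fin d) → EuclideanSpace 𝕜 (Fin d)} (hw : HasWeakGradOn Set.univ f g)
    {η : EuclideanSpace ℝ (Fin d) → ℝ} (hη : ContDiff ℝ ∞ η) (hc : HasCompactSupport η)
    (x : EuclideanSpace ℝ (Fin d)) :
    ‖fderiv ℝ (convolution η f (lsmul ℝ ℝ) volume) x‖ₑ ≤ ∫⁻ t, ‖η t‖ₑ * ‖g (x - t)‖ₑ := by
  have hg : LocallyIntegrable g volume := locallyIntegrableOn_univ.1 hw.locallyIntegrableOn_grad
  have hcs : HasCompactSupport fun t => η (x - t) :=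
    hc.comp_homeomorph (Homeomorph.subLeft x)
  have hcont : Continuous fun t => η (x - t) := hη.continuous.comp (by fun_prop)
  have hint : Integrable (fun t => η (x - t) • g t) :=
    hg.integrable_smul_left_of_hasCompactSupport hcont hcs
  have hinti : ∀ i, Integrable (fun t => η (x - t) • g t i) := fun i =>
    (((EuclideanSpace.proj (𝕜 := 𝕜) i).restrictScalars ℝ).integrable_comp hint).congr
      (Filter.Eventually.of_forall fun t => by simp)
  set S := ∫ t, ‖η (x - t)‖ * ‖g t‖ with hS
  have hSint : Integrable (fun t => ‖η (x - t)‖ * ‖g t‖) := by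
    simpa [norm_smul] using hint.norm
  have hb : ‖fderiv ℝ (convolution η f (lsmul ℝ ℝ) volume) x‖ ≤ S := by
    refine opNorm_le_bound _ (integral_nonneg fun t => by positivity) fun h => ?_
    have hh : h = ∑ i, h i • EuclideanSpace.single i (1 : ℝ) := by
      ext j
      simp [Finset.sum_apply, Pi.single_apply]
    have e1 : fderiv ℝ (convolution η f (lsmul ℝ ℝ) volume) x h =
        ∫ t, ∑ i, h i • (η (x - t) • g t i) := by
      conv_lhs => rw [hh]
      rw [map_sum, integral_finsetSum _ fun i _ =>
          (show Integrable (fun t => h i • (η (x - t) • g t i)) from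
      (hinti i).smul (h i))]
      refine Finset.sum_congr rfl fun i _ => ?_
      rw [map_smul, hw.fderiv_convolution_single hη hc, integral_smul]
    rw [e1, hS, ← integral_mul_const]
    refine norm_integral_le_of_norm_le (hSint.mul_const _) (Filter.Eventually.of_forall fun t => ?_)
    -- Gathering the coordinates into a single inner product lets Cauchy-Schwarz give constant 1
    -- instead of a dimensional one.
    have e2 : ∑ i, h i • (η (x - t) • g t i) =
        η (x - t) • inner 𝕜 (WithLp.toLp 2 fun i => (h i : 𝕜)) (g t) := by
      rw [PiLp.inner_apply, Finset.smul_sum]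
      refine Finset.sum_congr rfl fun i _ => ?_
      simp only [RCLike.inner_apply, RCLike.conj_ofReal, Algebra.smul_def,
        RCLike.algebraMap_eq_ofReal]
      ring
    rw [e2, norm_smul, mul_assoc]
    refine mul_le_mul_of_nonneg_left ?_ (norm_nonneg _)
    refine (norm_inner_le_norm _ _).trans_eq ?_
    rw [mul_comm]
    congr 1
    simp [EuclideanSpace.norm_eq]
  calc ‖fderiv ℝ (convolution η f (lsmul ℝ ℝ) volume) x‖ₑ ≤ ENNReal.ofReal S := by
        rw [← ofReal_norm]; exact ENNReal.ofReal_le_ofReal hb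
    _ = ∫⁻ t, ‖η (x - t)‖ₑ * ‖g t‖ₑ := by
        rw [hS, ofReal_integral_eq_lintegral_ofReal hSint
          (Filter.Eventually.of_forall fun t => by positivity)]
        simp only [ENNReal.ofReal_mul (norm_nonneg _), ofReal_norm]
    _ = ∫⁻ t, ‖η t‖ₑ * ‖g (x - t)‖ₑ := by
        rw [← lintegral_sub_left_eq_self _ x]
        simp

/-- Tonelli: for each fixed `t` in the support of `η` the translate of `A` by `-t` lies in `A'`, and
`η` has mass at most one. -/
lemma lintegral_convolution_le {F : Type*} [NormedAddCommGroup F]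
    {g : EuclideanSpace ℝ (Fin d) → F} (hg : AEStronglyMeasurable g volume)
    {η : EuclideanSpace ℝ (Fin d) → ℝ} (hη : Continuous η) (h1 : ∫⁻ t, ‖η t‖ₑ ≤ 1)
    {A A' : Set (EuclideanSpace ℝ (Fin d))}
    (hAA : ∀ x ∈ A, ∀ t ∈ Function.support η, x - t ∈ A') :
    ∫⁻ x in A, ∫⁻ t, ‖η t‖ₑ * ‖g (x - t)‖ₑ ≤ ∫⁻ x in A', ‖g x‖ₑ := by
  have hm : AEMeasurable (Function.uncurry fun x t : EuclideanSpace ℝ (Fin d) =>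
      ‖η t‖ₑ * ‖g (x - t)‖ₑ) ((volume.restrict A).prod volume) := by
    refine AEMeasurable.mul (hη.comp continuous_snd).measurable.enorm.aemeasurable ?_
    have := hg.comp_quasiMeasurePreserving
      (quasiMeasurePreserving_sub (volume : Measure (EuclideanSpace ℝ (Fin d))) volume)
    exact (this.enorm).mono_ac
      (Measure.AbsolutelyContinuous.prod Measure.restrict_le_self.absolutelyContinuous .rfl)
  rw [lintegral_lintegral_swap hm]
  calc ∫⁻ t, ∫⁻ x in A, ‖η t‖ₑ * ‖g (x - t)‖ₑ
      ≤ ∫⁻ t, ‖η t‖ₑ * ∫⁻ x in A', ‖g x‖ₑ := by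
        refine lintegral_mono fun t => ?_
        rw [lintegral_const_mul' _ _ enorm_ne_top]
        by_cases ht : t ∈ Function.support η
        · refine mul_le_mul_right ?_ _
          have : (fun x => x - t) ⁻¹' A' ⊇ A := fun x hx => hAA x hx t ht
          refine (lintegral_mono_set this).trans_eq ?_
          exact (measurePreserving_sub_right volume t).setLIntegral_comp_preimage_emb
            (MeasurableEquiv.subRight t).measurableEmbedding (fun x => ‖g x‖ₑ) A'
        · rw [Function.notMem_support] at ht
          simp [ht]
    _ = (∫⁻ t, ‖η t‖ₑ) * ∫⁻ x in A', ‖g x‖ₑ := by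
        rw [lintegral_mul_const]; fun_prop
    _ ≤ _ := by simpa using mul_le_mul_left h1 _

/-- A function with integrable weak gradient is an a.e. limit of smooth functions whose
gradients are controlled by averages of the weak gradient. -/
lemma HasWeakGradOn.exists_smooth_approx {f : EuclideanSpace ℝ (Fin d) → 𝕜}
    {g : EuclideanSpace ℝ (Fin d) → EuclideanSpace 𝕜 (Fin d)} (hw : HasWeakGradOn Set.univ f g)
    (hf : Integrable f) (hg : Integrable g) {δ : ℝ} (hδ : 0 < δ) :
    ∃ F : ℕ → EuclideanSpace ℝ (Fin d) → 𝕜,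
      (∀ n, ContDiff ℝ 1 (F n)) ∧ (∀ n, ∫⁻ x, ‖F n x‖ₑ < ⊤) ∧
      (∀ n, ∀ A A' : Set (EuclideanSpace ℝ (Fin d)), MeasurableSet A →
        (∀ x ∈ A, ball x δ ⊆ A') →
        ∫⁻ x in A, ‖fderiv ℝ (F n) x‖ₑ ≤ ∫⁻ x in A', ‖g x‖ₑ) ∧
      ∀ᵐ x, Filter.Tendsto (fun n => F n x) Filter.atTop (nhds (f x)) := by
  -- The outer radii are at most `δ`, so the mollified gradient at `x` only sees `ball x δ`. The
  -- fixed ratio 2 to the inner radius is what almost everywhere convergence at Lebesgue points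
  -- requires.
  let φ : ℕ → ContDiffBump (0 : EuclideanSpace ℝ (Fin d)) := fun n =>
    ⟨δ / (n + 1) / 2, δ / (n + 1), by positivity, half_lt_self (by positivity)⟩
  have hr : ∀ n, (φ n).rOut = δ / (n + 1) := fun n => rfl
  have hφ1 : ∀ n, ∫⁻ t, ‖(φ n).normed volume t‖ₑ ≤ 1 := fun n => by
    have := ofReal_integral_eq_lintegral_ofReal (μ := volume) ((φ n).integrable_normed)
      (Filter.Eventually.of_forall fun t => (φ n).nonneg_normed t)
    rw [(φ n).integral_normed] at this
    simp only [ENNReal.ofReal_one] at this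
    rw [this]
    refine lintegral_mono fun t => ?_
    rw [Real.enorm_eq_ofReal ((φ n).nonneg_normed t)]
  have hsm : ∀ n, ContDiff ℝ ∞ ((φ n).normed volume) := fun n => (φ n).contDiff_normed
  have hcs : ∀ n, HasCompactSupport ((φ n).normed volume) := fun n =>
    (φ n).hasCompactSupport_normed
  refine ⟨fun n => convolution ((φ n).normed volume) f (lsmul ℝ ℝ) volume, fun n => ?_, fun n => ?_,
    fun n A A' hA hAA => ?_, ?_⟩
  · exact_mod_cast (hcs n).contDiff_convolution_left (lsmul ℝ ℝ) (n := 1)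
      ((hsm n).of_le (by exact_mod_cast le_top)) hf.locallyIntegrable
  · refine lt_of_le_of_lt ?_ hf.2
    have := lintegral_convolution_le hf.1 (hsm n).continuous (hφ1 n) (A := Set.univ)
      (A' := Set.univ) (fun _ _ _ _ => Set.mem_univ _)
    simp only [Measure.restrict_univ] at this
    refine (lintegral_mono fun x => ?_).trans this
    beta_reduce
    rw [convolution_def]
    refine (enorm_integral_le_lintegral_enorm _).trans_eq ?_
    simp [enorm_smul]
  · refine (lintegral_mono fun x => hw.enorm_fderiv_convolution_le (hsm n) (hcs n) x).trans ?_
    refine lintegral_convolution_le hg.1 (hsm n).continuous (hφ1 n) fun x hx t ht => ?_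
    refine hAA x hx ?_
    rw [(φ n).support_normed_eq, mem_ball_zero_iff, hr] at ht
    rw [mem_ball, dist_eq_norm]
    simp only [sub_sub_cancel_left, norm_neg]
    exact ht.trans_le (div_le_self hδ.le (by simp))
  · refine ContDiffBump.ae_convolution_tendsto_right_of_locallyIntegrable (K := 2) ?_ ?_
      hf.locallyIntegrable
    · simp only [hr]
      exact tendsto_const_nhds.div_atTop
        (Filter.tendsto_atTop_add_const_right _ _ tendsto_natCast_atTop_atTop)
    · refine Filter.Eventually.of_forall fun n => ?_
      show δ / (n + 1) ≤ 2 * (δ / (n + 1) / 2)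
      linarith

end Mollification

/-! ### Translation estimates and integration along rays. -/

section TranslationAndDilation

variable {𝕜 : Type*} [RCLike 𝕜] {d : ℕ}

/-- Fatou's lemma; it carries `L¹` inequalities from the mollifications over to the Sobolev
function. -/
lemma lintegral_enorm_le_of_ae_tendsto {α F : Type*} [MeasurableSpace α] [NormedAddCommGroup F]
    {μ : Measure α} {u : ℕ → α → F} {v : α → F} {C : ℝ≥0∞}
    (hm : ∀ n, AEMeasurable (fun x => ‖u n x‖ₑ) μ)
    (hlim : ∀ᵐ x ∂μ, Filter.Tendsto (fun n => u n x) Filter.atTop (nhds (v x)))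
    (hC : ∀ n, ∫⁻ x, ‖u n x‖ₑ ∂μ ≤ C) : ∫⁻ x, ‖v x‖ₑ ∂μ ≤ C := by
  calc ∫⁻ x, ‖v x‖ₑ ∂μ = ∫⁻ x, Filter.liminf (fun n => ‖u n x‖ₑ) Filter.atTop ∂μ := by
        refine lintegral_congr_ae ?_
        filter_upwards [hlim] with x hx
        exact hx.enorm.liminf_eq.symm
    _ ≤ Filter.liminf (fun n => ∫⁻ x, ‖u n x‖ₑ ∂μ) Filter.atTop := lintegral_liminf_le' hm
    _ ≤ C := Filter.liminf_le_of_le (by isBoundedDefault)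
        (fun b hb => by
          obtain ⟨n, hn⟩ := hb.exists
          exact hn.trans (hC n))

lemma enorm_sub_le_lintegral_fderiv {F : EuclideanSpace ℝ (Fin d) → 𝕜} (hF : ContDiff ℝ 1 F)
    (x h : EuclideanSpace ℝ (Fin d)) {a b : ℝ} (hab : a ≤ b) :
    ‖F (x + b • h) - F (x + a • h)‖ₑ ≤
      ∫⁻ t in Set.Ioc a b, ‖fderiv ℝ F (x + t • h)‖ₑ * ‖h‖ₑ := by
  have hd : ∀ t, HasDerivAt (fun t : ℝ => F (x + t • h)) (fderiv ℝ F (x + t • h) h) t := by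
    intro t
    have h1 : HasDerivAt (fun t : ℝ => x + t • h) h t := by
      simpa using ((hasDerivAt_id t).smul_const h).const_add x
    exact ((hF.differentiable one_ne_zero _).hasFDerivAt).comp_hasDerivAt t h1
  have hc : Continuous fun t : ℝ => fderiv ℝ F (x + t • h) h :=
    ((hF.continuous_fderiv one_ne_zero).comp (by fun_prop)).clm_apply continuous_const
  rw [← intervalIntegral.integral_eq_sub_of_hasDerivAt (fun t _ => hd t)
    (hc.intervalIntegrable a b), intervalIntegral.integral_of_le hab]
  refine (enorm_integral_le_lintegral_enorm _).trans (lintegral_mono fun t => ?_)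
  exact ContinuousLinearMap.le_opENorm _ _

lemma lintegral_enorm_translate_sub_le_of_contDiff {F : EuclideanSpace ℝ (Fin d) → 𝕜}
    (hF : ContDiff ℝ 1 F) {A : Set (EuclideanSpace ℝ (Fin d))}
    (h : EuclideanSpace ℝ (Fin d)) {C : ℝ≥0∞}
    (hC : ∀ t ∈ Set.Ioc (0 : ℝ) 1, ∫⁻ x in (fun x => x - t • h) ⁻¹' A, ‖fderiv ℝ F x‖ₑ ≤ C) :
    ∫⁻ x in A, ‖F (x + h) - F x‖ₑ ≤ ‖h‖ₑ * C := by
  have hD : Continuous (fderiv ℝ F) := hF.continuous_fderiv one_ne_zero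
  calc ∫⁻ x in A, ‖F (x + h) - F x‖ₑ
      ≤ ∫⁻ x in A, ∫⁻ t in Set.Ioc (0 : ℝ) 1, ‖fderiv ℝ F (x + t • h)‖ₑ * ‖h‖ₑ := by
        refine lintegral_mono fun x => ?_
        simpa using enorm_sub_le_lintegral_fderiv hF x h zero_le_one
    _ = ∫⁻ t in Set.Ioc (0 : ℝ) 1, ∫⁻ x in A, ‖fderiv ℝ F (x + t • h)‖ₑ * ‖h‖ₑ := by
        refine lintegral_lintegral_swap (Measurable.aemeasurable ?_)
        refine Measurable.mul_const (Continuous.measurable ?_).enorm _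
        exact hD.comp (by fun_prop)
    _ ≤ ∫⁻ _ in Set.Ioc (0 : ℝ) 1, ‖h‖ₑ * C := by
        refine setLIntegral_mono measurable_const fun t ht => ?_
        rw [lintegral_mul_const' _ _ enorm_ne_top, mul_comm]
        gcongr
        refine le_trans (le_of_eq ?_) (hC t ht)
        have := (measurePreserving_add_right volume (t • h)).setLIntegral_comp_preimage_emb
            (MeasurableEquiv.addRight (t • h)).measurableEmbedding (fun x => ‖fderiv ℝ F x‖ₑ)
            ((fun x => x - t • h) ⁻¹' A)
        rw [← this]
        simp [← Set.preimage_comp, Function.comp_def]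
    _ = ‖h‖ₑ * C := by simp

/-- The smooth case is the fundamental theorem of calculus along `x + t • h` followed by Tonelli.
The set `A'` must contain the region swept by `A`, enlarged by `δ` to leave room for mollifying. -/
lemma HasWeakGradOn.lintegral_enorm_translate_sub_le {f : EuclideanSpace ℝ (Fin d) → 𝕜}
    {g : EuclideanSpace ℝ (Fin d) → EuclideanSpace 𝕜 (Fin d)} (hw : HasWeakGradOn Set.univ f g)
    (hf : Integrable f) (hg : Integrable g) {A A' : Set (EuclideanSpace ℝ (Fin d))}
    (hA : MeasurableSet A) (h : EuclideanSpace ℝ (Fin d)) {δ : ℝ} (hδ : 0 < δ)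
    (hAA : ∀ x ∈ A, ∀ t ∈ Set.Ioc (0 : ℝ) 1, ball (x + t • h) δ ⊆ A') :
    ∫⁻ x in A, ‖f (x + h) - f x‖ₑ ≤ ‖h‖ₑ * ∫⁻ x in A', ‖g x‖ₑ := by
  obtain ⟨F, hF, -, hFg, hlim⟩ := hw.exists_smooth_approx hf hg hδ
  refine lintegral_enorm_le_of_ae_tendsto (u := fun n x => F n (x + h) - F n x) (fun n => ?_) ?_
    fun n => ?_
  · have := (hF n).continuous
    exact (Continuous.measurable (by fun_prop)).enorm.aemeasurable
  · refine ae_restrict_of_ae ?_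
    filter_upwards [hlim,
      (measurePreserving_add_right volume h).quasiMeasurePreserving.ae hlim] with x h1 h2
    exact h2.sub h1
  · refine lintegral_enorm_translate_sub_le_of_contDiff (hF n) h fun t ht => ?_
    refine hFg n _ _ (measurable_sub_const _ hA) fun x hx => ?_
    have := hAA _ hx t ht
    simpa using this

lemma lintegral_comp_pos_smul (u : EuclideanSpace ℝ (Fin d) → ℝ≥0∞) {t : ℝ} (ht : 0 < t) :
    ∫⁻ x, u (t • x) = ENNReal.ofReal (t ^ d)⁻¹ * ∫⁻ x, u x := by
  have h1 := (Homeomorph.smulOfNeZero (α := EuclideanSpace ℝ (Fin d)) t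
    ht.ne').measurableEmbedding.lintegral_map u (μ := volume)
  simp only [Homeomorph.smulOfNeZero_apply] at h1
  rw [← h1, Measure.map_addHaar_smul _ ht.ne', lintegral_smul_measure,
    finrank_euclideanSpace_fin, abs_of_pos (by positivity), smul_eq_mul]

/-- The condition on `t⁻¹ * ρ` confines `t` to `(ρ/(s+e), ρ/s]`, of length `ρ e / (s (s+e))`, and
there `t⁻ᵈ ≤ t⁻¹ ≤ (s+e)/ρ`. The product is `e/s`, independent of `ρ` and `T`. -/
lemma lintegral_Ioc_inv_pow_le (hd : 1 ≤ d) {s e ρ : ℝ} (hs : 0 < s) (he : 0 < e) (hρ : 0 ≤ ρ)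
    (T : ℝ) :
    ∫⁻ t in Set.Ioc 1 T, ENNReal.ofReal (t ^ d)⁻¹ *
      (Set.Ico s (s + e)).indicator 1 (t⁻¹ * ρ) ≤ ENNReal.ofReal (e / s) := by
  have hse : 0 < s + e := by positivity
  rcases hρ.eq_or_lt with rfl | hρ
  · simp [Set.indicator, hs.not_ge]
  calc ∫⁻ t in Set.Ioc 1 T, ENNReal.ofReal (t ^ d)⁻¹ *
      (Set.Ico s (s + e)).indicator 1 (t⁻¹ * ρ)
      ≤ ∫⁻ t in Set.Ioc 1 T, (Set.Ioc (ρ / (s + e)) (ρ / s)).indicator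
          (fun _ => ENNReal.ofReal ((s + e) / ρ)) t := by
        refine setLIntegral_mono (Measurable.indicator measurable_const measurableSet_Ioc)
          fun t ht => ?_
        have ht0 : 0 < t := zero_lt_one.trans ht.1
        by_cases hm : t⁻¹ * ρ ∈ Set.Ico s (s + e)
        · have h1 : t * s ≤ ρ := by
            have := hm.1
            rw [inv_mul_eq_div, le_div_iff₀ ht0] at this
            linarith
          have h2 : ρ < t * (s + e) := by
            have := hm.2
            rw [inv_mul_eq_div, div_lt_iff₀ ht0] at this
            linarith
          have h3 : t ∈ Set.Ioc (ρ / (s + e)) (ρ / s) :=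
            ⟨by rw [div_lt_iff₀ hse]; exact h2, by rw [le_div_iff₀ hs]; exact h1⟩
          rw [Set.indicator_of_mem hm, Set.indicator_of_mem h3, Pi.one_apply, mul_one]
          refine ENNReal.ofReal_le_ofReal ?_
          calc (t ^ d)⁻¹ ≤ t⁻¹ := by
                refine inv_anti₀ ht0 (le_self_pow₀ ht.1.le (by omega))
            _ ≤ (s + e) / ρ := by
                rw [inv_eq_one_div, div_le_div_iff₀ ht0 hρ]
                linarith
        · simp [Set.indicator_of_notMem hm]
    _ ≤ ∫⁻ t, (Set.Ioc (ρ / (s + e)) (ρ / s)).indicator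
          (fun _ => ENNReal.ofReal ((s + e) / ρ)) t := setLIntegral_le_lintegral _ _
    _ = ENNReal.ofReal (e / s) := by
        rw [lintegral_indicator measurableSet_Ioc, setLIntegral_const, Real.volume_Ioc,
          ← ENNReal.ofReal_mul (by positivity)]
        congr 1
        field_simp
        ring

/-- The rings `s ≤ |x| < s + e` on which `f` is integrated in the radial Sobolev bound. -/
def normRing (d : ℕ) (s e : ℝ) : Set (EuclideanSpace ℝ (Fin d)) := {x | ‖x‖ ∈ Set.Ico s (s + e)}

lemma measurableSet_normRing (s e : ℝ) : MeasurableSet (normRing d s e) :=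
  measurable_norm measurableSet_Ico

/-- Integrate the derivative along the ray `c + t • x` from `t = 1` to `t = T`. The endpoint
contributes `T⁻ᵈ ‖F‖₁`, which vanishes as `T → ∞`; in the other term `‖x‖ ≤ s + e`, and the
substitution `y = t • x` reduces it to the time a ray spends over the ring. Radiality plays no role,
and the centre `c` is free because translates of one function are averaged later. -/
lemma lintegral_normRing_le_of_contDiff (hd : 1 ≤ d) {F : EuclideanSpace ℝ (Fin d) → 𝕜}
    (hF : ContDiff ℝ 1 F) (hFi : ∫⁻ x, ‖F x‖ₑ < ⊤) (c : EuclideanSpace ℝ (Fin d)) {s e : ℝ}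
    (hs : 0 < s) (he : 0 < e) :
    ∫⁻ x in normRing d s e, ‖F (c + x)‖ₑ ≤
      ENNReal.ofReal (e * (s + e) / s) * ∫⁻ x, ‖fderiv ℝ F x‖ₑ := by
  have hD : Continuous (fderiv ℝ F) := hF.continuous_fderiv one_ne_zero
  have hring := measurableSet_normRing (d := d) s e
  set I := ∫⁻ x, ‖fderiv ℝ F x‖ₑ with hI
  have main : ∀ T : ℝ, 1 ≤ T → ∫⁻ x in normRing d s e, ‖F (c + x)‖ₑ ≤
      ENNReal.ofReal (T ^ d)⁻¹ * (∫⁻ x, ‖F x‖ₑ) + ENNReal.ofReal (e * (s + e) / s) * I := by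
    intro T hT
    have hpt : ∀ x ∈ normRing d s e, ‖F (c + x)‖ₑ ≤ ‖F (c + T • x)‖ₑ +
        ∫⁻ t in Set.Ioc 1 T, ‖fderiv ℝ F (c + t • x)‖ₑ * ENNReal.ofReal (s + e) := by
      intro x hx
      have h1 := enorm_sub_le_lintegral_fderiv hF c x hT
      rw [one_smul] at h1
      calc ‖F (c + x)‖ₑ = ‖F (c + T • x) - (F (c + T • x) - F (c + x))‖ₑ := by simp
        _ ≤ ‖F (c + T • x)‖ₑ + ‖F (c + T • x) - F (c + x)‖ₑ := enorm_sub_le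
        _ ≤ _ := by
          refine add_le_add le_rfl (h1.trans (lintegral_mono fun t => ?_))
          gcongr
          rw [← ofReal_norm]
          exact ENNReal.ofReal_le_ofReal hx.2.le
    have hmeas2 : Measurable fun p : EuclideanSpace ℝ (Fin d) × ℝ =>
        ‖fderiv ℝ F (c + p.2 • p.1)‖ₑ := (hD.comp (by fun_prop)).measurable.enorm
    have hmeas1 : Measurable fun x : EuclideanSpace ℝ (Fin d) => ‖F (c + T • x)‖ₑ :=
      (hF.continuous.comp (by fun_prop)).measurable.enorm
    calc ∫⁻ x in normRing d s e, ‖F (c + x)‖ₑ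
        ≤ ∫⁻ x in normRing d s e, (‖F (c + T • x)‖ₑ +
          ∫⁻ t in Set.Ioc 1 T, ‖fderiv ℝ F (c + t • x)‖ₑ * ENNReal.ofReal (s + e)) :=
          setLIntegral_mono' hring hpt
      _ = (∫⁻ x in normRing d s e, ‖F (c + T • x)‖ₑ) + ∫⁻ x in normRing d s e,
          ∫⁻ t in Set.Ioc 1 T, ‖fderiv ℝ F (c + t • x)‖ₑ * ENNReal.ofReal (s + e) :=
          lintegral_add_left hmeas1 _
      _ ≤ _ := by
        refine add_le_add ?_ ?_
        · refine (setLIntegral_le_lintegral _ _).trans_eq ?_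
          rw [lintegral_comp_pos_smul (fun y => ‖F (c + y)‖ₑ) (by linarith),
            lintegral_add_left_eq_self (fun y => ‖F y‖ₑ) c]
        · have hsw := lintegral_lintegral_swap (μ := volume.restrict (normRing d s e))
            (ν := volume.restrict (Set.Ioc 1 T)) (f := fun x t =>
              ‖fderiv ℝ F (c + t • x)‖ₑ * ENNReal.ofReal (s + e))
            (hmeas2.mul_const _).aemeasurable
          rw [hsw]
          -- Substituting `y = t • x` turns the ring constraint on `x` into a constraint on `t⁻¹ *
          -- ‖y‖`, so that for fixed `y` the `t` integral can be carried out first.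
          have hin : ∀ t ∈ Set.Ioc 1 T, ∫⁻ x in normRing d s e,
              ‖fderiv ℝ F (c + t • x)‖ₑ * ENNReal.ofReal (s + e) =
              ∫⁻ y, ENNReal.ofReal (s + e) * (‖fderiv ℝ F (c + y)‖ₑ *
                (ENNReal.ofReal (t ^ d)⁻¹ *
                  (Set.Ico s (s + e)).indicator 1 (t⁻¹ * ‖y‖))) := by
            intro t ht
            have ht0 : 0 < t := zero_lt_one.trans ht.1
            rw [lintegral_mul_const' _ _ ENNReal.ofReal_ne_top,
              lintegral_const_mul' _ _ ENNReal.ofReal_ne_top, mul_comm]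
            congr 1
            have h3 := lintegral_comp_pos_smul (fun y => ‖fderiv ℝ F (c + y)‖ₑ *
              (Set.Ico s (s + e)).indicator 1 (t⁻¹ * ‖y‖)) ht0
            rw [← lintegral_const_mul' _ _ ENNReal.ofReal_ne_top] at h3
            rw [← lintegral_indicator hring]
            refine Eq.trans (lintegral_congr fun x => ?_)
              (h3.trans (lintegral_congr fun y => ?_))
            · rw [norm_smul, Real.norm_of_nonneg ht0.le, inv_mul_cancel_left₀ ht0.ne']
              by_cases hx : x ∈ normRing d s e
              · rw [Set.indicator_of_mem hx, Set.indicator_of_mem (by exact hx)]; simp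
              · rw [Set.indicator_of_notMem hx, Set.indicator_of_notMem (by exact hx)]; simp
            · ring
          rw [setLIntegral_congr_fun measurableSet_Ioc hin, lintegral_lintegral_swap]
          · have hin2 : ∀ y : EuclideanSpace ℝ (Fin d), ∫⁻ t in Set.Ioc 1 T,
                ENNReal.ofReal (s + e) * (‖fderiv ℝ F (c + y)‖ₑ *
                (ENNReal.ofReal (t ^ d)⁻¹ *
                  (Set.Ico s (s + e)).indicator 1 (t⁻¹ * ‖y‖))) ≤
                ENNReal.ofReal (s + e) * (‖fderiv ℝ F (c + y)‖ₑ * ENNReal.ofReal (e / s)) := by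
              intro y
              rw [lintegral_const_mul' _ _ ENNReal.ofReal_ne_top,
                lintegral_const_mul' _ _ enorm_ne_top]
              gcongr
              exact lintegral_Ioc_inv_pow_le hd hs he (norm_nonneg y) T
            refine (lintegral_mono hin2).trans_eq ?_
            rw [lintegral_const_mul' _ _ ENNReal.ofReal_ne_top,
              lintegral_mul_const' _ _ ENNReal.ofReal_ne_top,
              lintegral_add_left_eq_self (fun y => ‖fderiv ℝ F y‖ₑ) c, ← hI, mul_comm I,
              ← mul_assoc, ← ENNReal.ofReal_mul (by positivity)]
            congr 2
            ring
          · refine Measurable.aemeasurable (Measurable.const_mul (Measurable.mul ?_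
              (Measurable.mul ?_ ?_)) _)
            · exact (hD.comp (by fun_prop)).measurable.enorm
            · exact (measurable_fst.pow_const d).inv.ennreal_ofReal
            · exact (measurable_one.indicator measurableSet_Ico).comp
                (measurable_fst.inv.mul measurable_snd.norm)
  have hlim : Filter.Tendsto (fun T : ℝ => ENNReal.ofReal (T ^ d)⁻¹ * (∫⁻ x, ‖F x‖ₑ) +
      ENNReal.ofReal (e * (s + e) / s) * I) Filter.atTop
      (nhds (0 * (∫⁻ x, ‖F x‖ₑ) + ENNReal.ofReal (e * (s + e) / s) * I)) := by
    refine Filter.Tendsto.add (ENNReal.Tendsto.mul_const ?_ (Or.inr hFi.ne)) tendsto_const_nhds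
    rw [← ENNReal.ofReal_zero]
    exact ENNReal.tendsto_ofReal
      (tendsto_inv_atTop_zero.comp (Filter.tendsto_pow_atTop (by omega)))
  rw [zero_mul, zero_add] at hlim
  exact ge_of_tendsto hlim ((Filter.eventually_ge_atTop 1).mono main)

lemma HasWeakGradOn.lintegral_normRing_le (hd : 1 ≤ d) {f : EuclideanSpace ℝ (Fin d) → 𝕜}
    {g : EuclideanSpace ℝ (Fin d) → EuclideanSpace 𝕜 (Fin d)} (hw : HasWeakGradOn Set.univ f g)
    (hf : Integrable f) (hg : Integrable g) (c : EuclideanSpace ℝ (Fin d)) {s e : ℝ}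
    (hs : 0 < s) (he : 0 < e) :
    ∫⁻ x in normRing d s e, ‖f (c + x)‖ₑ ≤ ENNReal.ofReal (e * (s + e) / s) * ∫⁻ x, ‖g x‖ₑ := by
  obtain ⟨F, hF, hFi, hFg, hlim⟩ := hw.exists_smooth_approx hf hg zero_lt_one
  refine lintegral_enorm_le_of_ae_tendsto (u := fun n x => F n (c + x)) (fun n => ?_) ?_
    fun n => ?_
  · have := (hF n).continuous
    exact (Continuous.measurable (by fun_prop)).enorm.aemeasurable
  · exact ae_restrict_of_ae
      ((measurePreserving_add_left volume c).quasiMeasurePreserving.ae hlim)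
  · refine (lintegral_normRing_le_of_contDiff hd (hF n) (hFi n) c hs he).trans ?_
    refine mul_le_mul_right ?_ _
    simpa using hFg n Set.univ Set.univ MeasurableSet.univ (fun _ _ => Set.subset_univ _)

end TranslationAndDilation

/-! ### Mass of balls and the radial Sobolev bound. -/

section BallMass

variable {d : ℕ}

/-- The integral of `‖f‖` over the ball `B(x,r)`. -/
noncomputable def ballMass {F : Type*} [NormedAddCommGroup F] (f : EuclideanSpace ℝ (Fin d) → F)
    (x : EuclideanSpace ℝ (Fin d)) (r : ℝ) : ℝ :=
  ∫ y in ball x r, ‖f y‖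

section Basic

variable {F : Type*} [NormedAddCommGroup F] {f : EuclideanSpace ℝ (Fin d) → F}

lemma ballMass_nonneg (x : EuclideanSpace ℝ (Fin d)) (r : ℝ) : 0 ≤ ballMass f x r :=
  integral_nonneg fun _ => norm_nonneg _

lemma ballMass_le (hf : Integrable f) (x : EuclideanSpace ℝ (Fin d)) (r : ℝ) :
    ballMass f x r ≤ ∫ y, ‖f y‖ :=
  setIntegral_le_integral hf.norm (Filter.Eventually.of_forall fun _ => norm_nonneg _)

lemma ballMass_mono (hf : Integrable f) {x y : EuclideanSpace ℝ (Fin d)} {r s : ℝ}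
    (h : ball x r ⊆ ball y s) :
    ballMass f x r ≤ ballMass f y s :=
  setIntegral_mono_set hf.norm.integrableOn
    (Filter.Eventually.of_forall fun _ => norm_nonneg _) h.eventuallyLE

lemma ofReal_ballMass (hf : Integrable f) (x : EuclideanSpace ℝ (Fin d)) (r : ℝ) :
    ENNReal.ofReal (ballMass f x r) = ∫⁻ y in ball x r, ‖f y‖ₑ := by
  rw [ballMass, ofReal_integral_norm_eq_lintegral_enorm hf.integrableOn]

/-- Spheres of nonzero radius are null, so the indicators of nearby balls converge almost everywhere
and `‖f‖` dominates. -/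
lemma continuousAt_ballMass (hf : Integrable f) (x : EuclideanSpace ℝ (Fin d)) {r : ℝ}
    (hr : r ≠ 0) :
    ContinuousAt (fun p : (EuclideanSpace ℝ (Fin d)) × ℝ => ballMass f p.1 p.2) (x, r) := by
  have h1 : ∀ p : (EuclideanSpace ℝ (Fin d)) × ℝ, ballMass f p.1 p.2 =
      ∫ y, (ball p.1 p.2).indicator (fun y => ‖f y‖) y := fun p => by
    rw [ballMass, integral_indicator measurableSet_ball]
  rw [ContinuousAt, funext h1, h1]
  refine tendsto_integral_filter_of_dominated_convergence (l := nhds (x, r)) (fun y => ‖f y‖)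
      ?_ ?_ hf.norm ?_
  · exact Filter.Eventually.of_forall fun p => hf.norm.1.indicator measurableSet_ball
  · refine Filter.Eventually.of_forall fun p => Filter.Eventually.of_forall fun y => ?_
    refine (norm_indicator_le_norm_self _ _).trans_eq (norm_norm _)
  · have h0 : volume (sphere x r) = 0 := Measure.addHaar_sphere_of_ne_zero volume x hr
    have hae : ∀ᵐ y, y ∉ sphere x r := measure_eq_zero_iff_ae_notMem.1 h0
    filter_upwards [hae] with y hy
    have hc1 : ContinuousAt (fun p : (EuclideanSpace ℝ (Fin d)) × ℝ => dist y p.1) (x, r) := by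
      fun_prop
    have hc2 : ContinuousAt (fun p : (EuclideanSpace ℝ (Fin d)) × ℝ => p.2) (x, r) := by fun_prop
    rcases lt_or_gt_of_ne (show dist y x ≠ r from hy) with hlt | hgt
    · have hev : ∀ᶠ p : (EuclideanSpace ℝ (Fin d)) × ℝ in nhds (x, r), y ∈ ball p.1 p.2 :=
        (hc1.eventually_lt hc2 hlt).mono fun p hp => hp
      refine Filter.Tendsto.congr' (hev.mono fun p hp => ?_) tendsto_const_nhds
      beta_reduce
      rw [Set.indicator_of_mem hp, Set.indicator_of_mem (show y ∈ ball x r from hlt)]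
    · have hev : ∀ᶠ p : (EuclideanSpace ℝ (Fin d)) × ℝ in nhds (x, r), y ∉ ball p.1 p.2 :=
        (hc2.eventually_lt hc1 hgt).mono fun p hp => by simpa using hp.le
      refine Filter.Tendsto.congr' (hev.mono fun p hp => ?_) tendsto_const_nhds
      beta_reduce
      rw [Set.indicator_of_notMem hp, Set.indicator_of_notMem (by simpa using hgt.le)]

lemma continuousAt_ballMass_smul (hf : Integrable f) (x : EuclideanSpace ℝ (Fin d)) {r : ℝ}
    (hr : r ≠ 0) :
    ContinuousAt (fun t : ℝ => ballMass f (t • x) r) 1 := by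
  have h2 : Filter.Tendsto (fun t : ℝ => (t • x, r)) (nhds 1) (nhds (x, r)) := by
    have : Continuous fun t : ℝ => (t • x, r) := by fun_prop
    simpa using this.tendsto 1
  have h3 := (continuousAt_ballMass hf x hr).tendsto.comp h2
  rw [ContinuousAt, one_smul]
  exact h3

lemma continuousAt_ballMass_radius (hf : Integrable f) (x : EuclideanSpace ℝ (Fin d)) {r : ℝ}
    (hr : r ≠ 0) :
    ContinuousAt (fun t => ballMass f x t) r := by
  have h2 : Filter.Tendsto (fun t : ℝ => (x, t)) (nhds r) (nhds (x, r)) :=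
    (Continuous.prodMk_right x).tendsto r
  have h3 := (continuousAt_ballMass hf x hr).tendsto.comp h2
  exact h3

end Basic

lemma ae_eq_comp_isometry {α : Type*} {f : EuclideanSpace ℝ (Fin d) → α}
    (hrad : ∃ φ : ℝ → α, f =ᵐ[volume] fun x => φ ‖x‖)
    (T : (EuclideanSpace ℝ (Fin d)) ≃ₗᵢ[ℝ] (EuclideanSpace ℝ (Fin d))) : ∀ᵐ x, f (T x) = f x := by
  obtain ⟨φ, hφ⟩ := hrad
  filter_upwards [hφ, T.measurePreserving.quasiMeasurePreserving.ae hφ] with x h1 h2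
  rw [h1, h2, T.norm_map]

lemma setLIntegral_ball_isometry {F : Type*} [NormedAddCommGroup F]
    {f : EuclideanSpace ℝ (Fin d) → F}
    (hrad : ∃ φ : ℝ → F, f =ᵐ[volume] fun x => φ ‖x‖)
    (T : (EuclideanSpace ℝ (Fin d)) ≃ₗᵢ[ℝ] (EuclideanSpace ℝ (Fin d)))
    (x : EuclideanSpace ℝ (Fin d)) (r : ℝ) :
    ∫⁻ y in ball (T x) r, ‖f y‖ₑ = ∫⁻ y in ball x r, ‖f y‖ₑ := by
  rw [← T.measurePreserving.setLIntegral_comp_preimage_emb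
    T.toHomeomorph.measurableEmbedding (fun y => ‖f y‖ₑ)]
  have : T ⁻¹' ball (T x) r = ball x r := by
    ext y; simp
  rw [this]
  refine lintegral_congr_ae (ae_restrict_of_ae ?_)
  filter_upwards [ae_eq_comp_isometry hrad T] with y hy
  rw [hy]

lemma exists_isometry_eq {x y : EuclideanSpace ℝ (Fin d)} (h : ‖x‖ = ‖y‖) :
    ∃ T : (EuclideanSpace ℝ (Fin d)) ≃ₗᵢ[ℝ] (EuclideanSpace ℝ (Fin d)), T x = y :=
  ⟨_, Submodule.reflection_sub h⟩

variable {𝕜 : Type*} [RCLike 𝕜]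

lemma ballMass_eq_of_norm_eq {f : EuclideanSpace ℝ (Fin d) → 𝕜} (hf : Integrable f)
    (hrad : ∃ φ : ℝ → 𝕜, f =ᵐ[volume] fun x => φ ‖x‖) {x y : EuclideanSpace ℝ (Fin d)}
    (h : ‖x‖ = ‖y‖) (r : ℝ) :
    ballMass f x r = ballMass f y r := by
  obtain ⟨T, rfl⟩ := exists_isometry_eq h
  rw [← ENNReal.toReal_ofReal (ballMass_nonneg x r), ofReal_ballMass hf,
    ← setLIntegral_ball_isometry hrad T, ← ofReal_ballMass hf,
    ENNReal.toReal_ofReal (ballMass_nonneg _ r)]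

lemma volume_real_ball (x : EuclideanSpace ℝ (Fin d)) {r : ℝ} (hr : 0 < r) :
    volume.real (ball x r) = r ^ d * volume.real (ball (0 : EuclideanSpace ℝ (Fin d)) 1) := by
  rw [Measure.real, Measure.addHaar_ball_of_pos _ _ hr, ENNReal.toReal_mul,
    ENNReal.toReal_ofReal (by positivity), finrank_euclideanSpace_fin, Measure.real]

lemma unitBallVolume_pos : 0 < volume.real (ball (0 : EuclideanSpace ℝ (Fin d)) 1) :=
  ENNReal.toReal_pos (measure_ball_pos volume _ zero_lt_one).ne' measure_ball_lt_top.ne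

lemma le_volume_real_normRing (hd : 1 ≤ d) {s e : ℝ} (hs : 0 < s) (he : 0 < e) :
    s ^ (d - 1) * e * volume.real (ball (0 : EuclideanSpace ℝ (Fin d)) 1) ≤
        volume.real (normRing d s e) := by
  have h1 : normRing d s e = ball 0 (s + e) \ ball 0 s := by
    ext x; simp [normRing, and_comm]
  rw [h1, measureReal_sdiff (ball_subset_ball (by linarith)) measurableSet_ball,
    volume_real_ball _ hs, volume_real_ball _ (show 0 < s + e by positivity), ← sub_mul]
  refine mul_le_mul_of_nonneg_right ?_ measureReal_nonneg
  obtain ⟨k, rfl⟩ : ∃ k, d = k + 1 := ⟨d - 1, by omega⟩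
  have : s ^ k ≤ (s + e) ^ k := pow_le_pow_left₀ hs.le (by linarith) k
  rw [pow_succ, pow_succ, Nat.add_sub_cancel]
  nlinarith

/-- Swapping the integrals turns the mean over centres in the ring into an integral over `z ∈ ball 0
r` of the ring integral of the translate `f (z + ·)`, to which the ring bound applies with centre
`z`. -/
lemma IsRadialW11.setLIntegral_normRing_ballMass_le (hd : 1 ≤ d) {f : EuclideanSpace ℝ (Fin d) → 𝕜}
    {g : EuclideanSpace ℝ (Fin d) → EuclideanSpace 𝕜 (Fin d)} (h : IsRadialW11 f g) {s e r : ℝ}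
    (hs : 0 < s)
    (he : 0 < e) : ∫⁻ y in normRing d s e, ENNReal.ofReal (ballMass f y r) ≤
      ENNReal.ofReal (e * (s + e) / s) * (∫⁻ x, ‖g x‖ₑ) *
        volume (ball (0 : EuclideanSpace ℝ (Fin d)) r) := by
  have hf := h.integrable_fun
  have h1 : ∀ y, ENNReal.ofReal (ballMass f y r) = ∫⁻ z in ball (0 : EuclideanSpace ℝ (Fin d)) r,
      ‖f (z + y)‖ₑ := by
    intro y
    rw [ofReal_ballMass hf, ← (measurePreserving_add_right volume y).setLIntegral_comp_preimage_emb
            (MeasurableEquiv.addRight y).measurableEmbedding (fun x => ‖f x‖ₑ)]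
    congr 2
    ext z; simp
  simp only [h1]
  rw [lintegral_lintegral_swap]
  · calc ∫⁻ z in ball (0 : EuclideanSpace ℝ (Fin d)) r, ∫⁻ y in normRing d s e, ‖f (z + y)‖ₑ
        ≤ ∫⁻ _ in ball (0 : EuclideanSpace ℝ (Fin d)) r,
            ENNReal.ofReal (e * (s + e) / s) * (∫⁻ x, ‖g x‖ₑ) :=
          lintegral_mono fun z => h.hasWeakGradOn.lintegral_normRing_le hd hf h.integrable_grad z
            hs he
      _ = _ := by simp
  · have := hf.1.comp_quasiMeasurePreserving
      (quasiMeasurePreserving_add (volume : Measure (EuclideanSpace ℝ (Fin d))) volume)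
    refine ((this.enorm).comp_quasiMeasurePreserving
      (Measure.measurePreserving_swap (μ := (volume : Measure (EuclideanSpace ℝ (Fin d))))
        (ν := volume)).quasiMeasurePreserving).mono_ac ?_
    exact (Measure.AbsolutelyContinuous.prod Measure.restrict_le_self.absolutelyContinuous
      Measure.restrict_le_self.absolutelyContinuous)

/-- The ring has volume at least `s^(d-1) * e` times that of the unit ball, while the upper bound is
also linear in `e`, since `e * (s + e) / s ≤ 2 * e` for `e ≤ s`. The thickness cancels and leaves
the factor 2. -/
lemma IsRadialW11.le_of_forall_mem_normRing (hd : 1 ≤ d) {f : EuclideanSpace ℝ (Fin d) → 𝕜}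
    {g : EuclideanSpace ℝ (Fin d) → EuclideanSpace 𝕜 (Fin d)} (h : IsRadialW11 f g) {s e r m : ℝ}
    (hs : 0 < s)
    (he : 0 < e) (hes : e ≤ s) (hr : 0 < r) (hm : 0 < m)
    (hlow : ∀ y ∈ normRing d s e, m ≤ ballMass f y r) :
    m ≤ 2 * r ^ d * (s ^ (d - 1))⁻¹ * ∫ y, ‖g y‖ := by
  have hring := measurableSet_normRing (d := d) s e
  have hringfin : volume (normRing d s e) ≠ ⊤ := by
    refine ((measure_mono (t := ball 0 (s + e)) fun y hy => ?_).trans_lt measure_ball_lt_top).ne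
    simpa using hy.2
  have key : ENNReal.ofReal m * volume (normRing d s e) ≤
      ENNReal.ofReal (e * (s + e) / s) * (∫⁻ x, ‖g x‖ₑ) *
        volume (ball (0 : EuclideanSpace ℝ (Fin d)) r) := by
    refine le_trans ?_ (h.setLIntegral_normRing_ballMass_le hd hs he)
    rw [← setLIntegral_const]
    exact setLIntegral_mono' hring fun y hy => ENNReal.ofReal_le_ofReal (hlow y hy)
  rw [← ofReal_integral_norm_eq_lintegral_enorm h.integrable_grad,
    ← ofReal_measureReal hringfin, ← ofReal_measureReal measure_ball_lt_top.ne,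
    volume_real_ball _ hr] at key
  have hN0 : 0 ≤ ∫ y, ‖g y‖ := integral_nonneg fun _ => norm_nonneg _
  have hV := le_volume_real_normRing hd hs he
  have hκ0 := unitBallVolume_pos (d := d)
  generalize ∫ y, ‖g y‖ = N at *
  generalize volume.real (ball (0 : EuclideanSpace ℝ (Fin d)) 1) = κ at *
  generalize volume.real (normRing d s e) = V at *
  have h0 : 0 ≤ e * (s + e) / s := by positivity
  rw [← ENNReal.ofReal_mul hm.le, ← ENNReal.ofReal_mul h0,
    ← ENNReal.ofReal_mul (mul_nonneg h0 hN0),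
    ENNReal.ofReal_le_ofReal_iff (by positivity)] at key
  have h1 := (mul_le_mul_of_nonneg_left hV hm.le).trans key
  have h2 : e * (s + e) / s ≤ 2 * e := by
    rw [div_le_iff₀ hs]; nlinarith
  have h3 : m * (s ^ (d - 1) * e * κ) ≤ 2 * e * N * (r ^ d * κ) :=
    h1.trans (by gcongr)
  have h4 : m * s ^ (d - 1) ≤ 2 * N * r ^ d := by
    have : 0 < e * κ := by positivity
    refine le_of_mul_le_mul_right ?_ this
    linarith
  rw [← le_div_iff₀ (by positivity)] at h4
  refine h4.trans_eq ?_
  field_simp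

/-- The radial Sobolev bound for averages over balls. -/
lemma IsRadialW11.ballMass_le (hd : 1 ≤ d) {f : EuclideanSpace ℝ (Fin d) → 𝕜}
    {g : EuclideanSpace ℝ (Fin d) → EuclideanSpace 𝕜 (Fin d)} (h : IsRadialW11 f g)
    {x : EuclideanSpace ℝ (Fin d)} (hx : x ≠ 0) {r : ℝ}
    (hr : 0 < r) :
    ballMass f x r ≤ 2 * r ^ d * (‖x‖ ^ (d - 1))⁻¹ * ∫ y, ‖g y‖ := by
  have hf := h.integrable_fun
  have hs : 0 < ‖x‖ := norm_pos_iff.2 hx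
  -- The ball mass depends only on the norm of the centre and is continuous in it, so it drops by
  -- less than `η` on a sufficiently thin ring starting at `‖x‖`.
  refine le_of_forall_pos_le_add fun η hη => ?_
  have hc := continuousAt_ballMass_smul hf x hr.ne'
  obtain ⟨e₀, he₀, hball⟩ := Metric.continuousAt_iff.1 hc η hη
  obtain ⟨e, he, hes, hee⟩ : ∃ e : ℝ, 0 < e ∧ e ≤ ‖x‖ ∧ e ≤ e₀ * ‖x‖ / 2 :=
    ⟨min ‖x‖ (e₀ * ‖x‖ / 2), lt_min hs (by positivity), min_le_left _ _, min_le_right _ _⟩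
  have hlow : ∀ y ∈ normRing d ‖x‖ e, ballMass f x r - η ≤ ballMass f y r := by
    intro y hy
    have h1 : ‖y‖ = ‖(‖y‖ / ‖x‖) • x‖ := by
      rw [norm_smul, Real.norm_of_nonneg (by positivity)]; field_simp
    rw [ballMass_eq_of_norm_eq hf h.radial h1]
    have h2 : dist (‖y‖ / ‖x‖) 1 < e₀ := by
      rw [Real.dist_eq, div_sub_one hs.ne', abs_div, abs_of_pos hs, div_lt_iff₀ hs,
        abs_of_nonneg (by linarith [hy.1])]
      have := hy.2
      nlinarith
    have h3 := hball h2
    rw [Real.dist_eq, one_smul] at h3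
    linarith [(abs_lt.1 h3).1]
  rcases le_or_gt (ballMass f x r - η) 0 with hneg | hpos
  · have hN0 : 0 ≤ ∫ y, ‖g y‖ := integral_nonneg fun _ => norm_nonneg _
    have : 0 ≤ 2 * r ^ d * (‖x‖ ^ (d - 1))⁻¹ * ∫ y, ‖g y‖ := mul_nonneg (by positivity) hN0
    linarith
  · linarith [h.le_of_forall_mem_normRing hd hs he hes hr hpos hlow]

end BallMass

/-! ### Fractional averages, existence and size of best radii. -/

section Averages

variable {d : ℕ}

/-- The volume of the unit ball of `ℝᵈ`. -/
noncomputable def unitVol (d : ℕ) : ℝ := volume.real (ball (0 : EuclideanSpace ℝ (Fin d)) 1)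

lemma unitVol_pos : 0 < unitVol d := unitBallVolume_pos

/-- The fractional average of `‖f‖` over `B(x,r)` as a real number. -/
noncomputable def fracAvg {F : Type*} [NormedAddCommGroup F] (β : ℝ)
    (f : EuclideanSpace ℝ (Fin d) → F) (x : EuclideanSpace ℝ (Fin d)) (r : ℝ) :
    ℝ := (unitVol d)⁻¹ * r ^ (β - d) * ballMass f x r

variable {𝕜 : Type*} [RCLike 𝕜] {β : ℝ} {f : EuclideanSpace ℝ (Fin d) → 𝕜}
    {g : EuclideanSpace ℝ (Fin d) → EuclideanSpace 𝕜 (Fin d)}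

/-- The fractional maximal function as a real-valued function. -/
noncomputable def maxFun (β : ℝ) (f : EuclideanSpace ℝ (Fin d) → 𝕜)
    (x : EuclideanSpace ℝ (Fin d)) : ℝ := (fracMaximal β f x).toReal

lemma maxFun_nonneg (x : EuclideanSpace ℝ (Fin d)) : 0 ≤ maxFun β f x := ENNReal.toReal_nonneg

lemma fracAvg_nonneg (x : EuclideanSpace ℝ (Fin d)) {r : ℝ} (hr : 0 < r) : 0 ≤ fracAvg β f x r :=
  mul_nonneg (mul_nonneg (inv_nonneg.2 unitVol_pos.le) (Real.rpow_nonneg hr.le _))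
    (ballMass_nonneg x r)

lemma fracAverage_eq (hf : Integrable f) (x : EuclideanSpace ℝ (Fin d)) {r : ℝ} (hr : 0 < r) :
    fracAverage β f x r = ENNReal.ofReal (fracAvg β f x r) := by
  have hκ := unitVol_pos (d := d)
  have hv : volume (ball x r) = ENNReal.ofReal (r ^ d * unitVol d) := by
    rw [unitVol, ← volume_real_ball x hr, ofReal_measureReal measure_ball_lt_top.ne]
  rw [fracAverage, setLAverage_eq, hv, ← ofReal_ballMass hf,
    ← ENNReal.ofReal_div_of_pos (by positivity), ← ENNReal.ofReal_mul (by positivity), fracAvg,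
    Real.rpow_sub hr, Real.rpow_natCast]
  congr 1
  field_simp

lemma fracAvg_le_integral (hf : Integrable f) (x : EuclideanSpace ℝ (Fin d)) {r : ℝ} (hr : 0 < r) :
    fracAvg β f x r ≤ (unitVol d)⁻¹ * r ^ (β - d) * ∫ y, ‖f y‖ :=
  mul_le_mul_of_nonneg_left (ballMass_le hf x r)
    (mul_nonneg (inv_nonneg.2 unitVol_pos.le) (Real.rpow_nonneg hr.le _))

/-- The factor `r ^ d` of the ball mass cancels the normalization and leaves `r ^ β`: away from the
origin, small balls have small averages. -/
lemma IsRadialW11.fracAvg_le (hd : 1 ≤ d) (h : IsRadialW11 f g) {x : EuclideanSpace ℝ (Fin d)}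
    (hx : x ≠ 0) {r : ℝ}
    (hr : 0 < r) :
    fracAvg β f x r ≤ (unitVol d)⁻¹ * r ^ β * (2 * (‖x‖ ^ (d - 1))⁻¹ * ∫ y, ‖g y‖) := by
  have hκ := unitVol_pos (d := d)
  refine (mul_le_mul_of_nonneg_left (h.ballMass_le hd hx hr)
    (mul_nonneg (inv_nonneg.2 hκ.le) (Real.rpow_nonneg hr.le _))).trans_eq ?_
  rw [Real.rpow_sub hr, Real.rpow_natCast]
  field_simp

lemma IsRadialW11.fracAvg_le_const (hd : 1 ≤ d) (hβ0 : 0 < β) (hβd : β < d)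
    (h : IsRadialW11 f g) {x : EuclideanSpace ℝ (Fin d)} (hx : x ≠ 0) {r : ℝ} (hr : 0 < r) :
    fracAvg β f x r ≤
      (unitVol d)⁻¹ * (2 * (‖x‖ ^ (d - 1))⁻¹ * (∫ y, ‖g y‖) + ∫ y, ‖f y‖) := by
  have hκ := unitVol_pos (d := d)
  have h1 := fracAvg_le_integral (β := β) h.integrable_fun x hr
  have h2 := h.fracAvg_le (β := β) hd hx hr
  have hN1 : 0 ≤ ∫ y, ‖f y‖ := integral_nonneg fun _ => norm_nonneg _
  have hN2 : 0 ≤ ∫ y, ‖g y‖ := integral_nonneg fun _ => norm_nonneg _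
  generalize ∫ y, ‖f y‖ = N1 at *
  generalize ∫ y, ‖g y‖ = N2 at *
  have hN3 : 0 ≤ 2 * (‖x‖ ^ (d - 1))⁻¹ * N2 := by positivity
  rcases le_total r 1 with hr1 | hr1
  · refine h2.trans ?_
    have : r ^ β ≤ 1 := Real.rpow_le_one hr.le hr1 hβ0.le
    rw [mul_assoc]
    refine mul_le_mul_of_nonneg_left ?_ (inv_nonneg.2 hκ.le)
    nlinarith
  · refine h1.trans ?_
    have : r ^ (β - d) ≤ 1 := Real.rpow_le_one_of_one_le_of_nonpos hr1 (by linarith)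
    rw [mul_assoc]
    refine mul_le_mul_of_nonneg_left ?_ (inv_nonneg.2 hκ.le)
    nlinarith

lemma IsRadialW11.fracMaximal_le (hd : 1 ≤ d) (hβ0 : 0 < β) (hβd : β < d)
    (h : IsRadialW11 f g) {x : EuclideanSpace ℝ (Fin d)} (hx : x ≠ 0) :
    fracMaximal β f x ≤ ENNReal.ofReal
      ((unitVol d)⁻¹ * (2 * (‖x‖ ^ (d - 1))⁻¹ * (∫ y, ‖g y‖) + ∫ y, ‖f y‖)) := by
  refine iSup₂_le fun r hr => ?_
  rw [fracAverage_eq h.integrable_fun x hr]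
  exact ENNReal.ofReal_le_ofReal (h.fracAvg_le_const hd hβ0 hβd hx hr)

lemma IsRadialW11.ofReal_maxFun (hd : 1 ≤ d) (hβ0 : 0 < β) (hβd : β < d)
    (h : IsRadialW11 f g) {x : EuclideanSpace ℝ (Fin d)} (hx : x ≠ 0) :
    ENNReal.ofReal (maxFun β f x) = fracMaximal β f x :=
  ENNReal.ofReal_toReal
    ((h.fracMaximal_le hd hβ0 hβd hx).trans_lt ENNReal.ofReal_lt_top).ne

lemma IsRadialW11.maxFun_le (hd : 1 ≤ d) (hβ0 : 0 < β) (hβd : β < d)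
    (h : IsRadialW11 f g) {x : EuclideanSpace ℝ (Fin d)} (hx : x ≠ 0) : maxFun β f x ≤
      (unitVol d)⁻¹ * (2 * (‖x‖ ^ (d - 1))⁻¹ * (∫ y, ‖g y‖) + ∫ y, ‖f y‖) := by
  refine ENNReal.toReal_le_of_le_ofReal ?_ (h.fracMaximal_le hd hβ0 hβd hx)
  exact (fracAvg_nonneg x one_pos).trans (h.fracAvg_le_const hd hβ0 hβd hx one_pos)

lemma IsRadialW11.fracAvg_le_maxFun (hd : 1 ≤ d) (hβ0 : 0 < β) (hβd : β < d)
    (h : IsRadialW11 f g) {x : EuclideanSpace ℝ (Fin d)} (hx : x ≠ 0) {r : ℝ} (hr : 0 < r) :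
    fracAvg β f x r ≤ maxFun β f x := by
  rw [← ENNReal.ofReal_le_ofReal_iff (maxFun_nonneg x), h.ofReal_maxFun hd hβ0 hβd hx,
    ← fracAverage_eq h.integrable_fun x hr]
  exact le_iSup₂ (f := fun r (_ : 0 < r) => fracAverage β f x r) r hr

lemma IsRadialW11.maxFun_le_of_forall (h : IsRadialW11 f g) {x : EuclideanSpace ℝ (Fin d)} {c : ℝ}
    (hc : 0 ≤ c)
    (hle : ∀ r, 0 < r → fracAvg β f x r ≤ c) : maxFun β f x ≤ c := by
  refine ENNReal.toReal_le_of_le_ofReal hc (iSup₂_le fun r hr => ?_)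
  rw [fracAverage_eq h.integrable_fun x hr]
  exact ENNReal.ofReal_le_ofReal (hle r hr)

lemma IsRadialW11.mem_bestBalls (hd : 1 ≤ d) (hβ0 : 0 < β) (hβd : β < d)
    (h : IsRadialW11 f g) {x : EuclideanSpace ℝ (Fin d)} (hx : x ≠ 0) {r : ℝ} (hr : 0 < r)
    (hbest : maxFun β f x = fracAvg β f x r) : closedBall x r ∈ bestBalls β f x :=
  ⟨r, hr, rfl, by rw [fracAverage_eq h.integrable_fun x hr, ← hbest, h.ofReal_maxFun hd hβ0 hβd hx]⟩

/-- Radii with large averages are bounded from below and from above. -/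
lemma exists_radius_bounds (𝕜 : Type*) [RCLike 𝕜] (hd : 1 ≤ d) (hβ0 : 0 < β) (hβd : β < d)
    {a m : ℝ} (N : ℝ) (ha : 0 < a) (hm : 0 < m) :
    ∃ r₀ R : ℝ, 0 < r₀ ∧ ∀ (f : EuclideanSpace ℝ (Fin d) → 𝕜)
        (g : EuclideanSpace ℝ (Fin d) → EuclideanSpace 𝕜 (Fin d)), IsRadialW11 f g →
      ∫ y, ‖f y‖ ≤ N → ∫ y, ‖g y‖ ≤ N → ∀ x, a ≤ ‖x‖ → ∀ r, 0 < r → m ≤ fracAvg β f x r →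
      r₀ ≤ r ∧ r ≤ R := by
  have hκ := unitVol_pos (d := d)
  -- The radial Sobolev bound tends to zero as `r → 0` because `β > 0`, and the `L¹` bound tends to
  -- zero as `r → ∞` because `β < d`; `r₀` and `R` are where they fall below `m`.
  have h1 : Filter.Tendsto (fun r : ℝ => (unitVol d)⁻¹ * r ^ β * (2 * (a ^ (d - 1))⁻¹ * N))
      (nhds 0) (nhds 0) := by
    have : ContinuousAt (fun r : ℝ => (unitVol d)⁻¹ * r ^ β * (2 * (a ^ (d - 1))⁻¹ * N)) 0 :=
      ((Real.continuousAt_rpow_const 0 β (Or.inr hβ0.le)).const_mul _).mul_const _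
    simpa [ContinuousAt, Real.zero_rpow hβ0.ne'] using this
  have h2 : Filter.Tendsto (fun r : ℝ => (unitVol d)⁻¹ * r ^ (β - d) * N) Filter.atTop
      (nhds 0) := by
    have := tendsto_rpow_neg_atTop (show 0 < (d : ℝ) - β by linarith)
    simpa using (this.const_mul (unitVol d)⁻¹).mul_const N
  obtain ⟨r₀, hr₀, hr₀'⟩ := Metric.eventually_nhds_iff.1 (h1.eventually (gt_mem_nhds hm))
  obtain ⟨R, hR⟩ := Filter.eventually_atTop.1 (h2.eventually (gt_mem_nhds hm))
  refine ⟨r₀, R, hr₀, fun f g h hN1 hN2 x hx r hr hmr => ⟨?_, ?_⟩⟩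
  · by_contra! hlt
    have hx0 : x ≠ 0 := norm_pos_iff.1 (ha.trans_le hx)
    have h3 := hr₀' (y := r) (by rw [Real.dist_eq, sub_zero, abs_of_pos hr]; exact hlt)
    have h4 := h.fracAvg_le (β := β) hd hx0 hr
    have hN0 : 0 ≤ ∫ y, ‖g y‖ := integral_nonneg fun _ => norm_nonneg _
    generalize ∫ y, ‖g y‖ = N2 at *
    have h5 : (unitVol d)⁻¹ * r ^ β * (2 * (‖x‖ ^ (d - 1))⁻¹ * N2) ≤
        (unitVol d)⁻¹ * r ^ β * (2 * (a ^ (d - 1))⁻¹ * N) := by gcongr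
    linarith
  · by_contra! hlt
    have h3 := hR r hlt.le
    have h4   := fracAvg_le_integral (β := β) h.integrable_fun x hr
    have h5 := mul_le_mul_of_nonneg_left hN1
      (mul_nonneg (inv_nonneg.2 hκ.le) (Real.rpow_nonneg hr.le (β - d)))
    linarith

/-- The ball of radius `ρ + ‖x‖` about `x` contains `ball 0 ρ`, so mass near the origin alone bounds
the maximal function from below on bounded sets. -/
lemma le_fracAvg (hf : Integrable f) (x : EuclideanSpace ℝ (Fin d)) {ρ : ℝ} (hρ : 0 < ρ) :
    (unitVol d)⁻¹ * (ρ + ‖x‖) ^ (β - d) * ballMass f 0 ρ ≤ fracAvg β f x (ρ + ‖x‖) := by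
  refine mul_le_mul_of_nonneg_left (ballMass_mono hf ?_)
    (mul_nonneg (inv_nonneg.2 unitVol_pos.le) (Real.rpow_nonneg (by positivity) _))
  refine ball_subset_ball' ?_
  simp

lemma exists_ballMass_pos (hf : Integrable f) (h0 : 0 < ∫ y, ‖f y‖) :
    ∃ ρ, 0 < ρ ∧ 0 < ballMass f 0 ρ := by
  have h1 := (aecover_ball (μ := volume) (x := (0 : EuclideanSpace ℝ (Fin d)))
    Filter.tendsto_id).integral_tendsto_of_countably_generated hf.norm
  obtain ⟨ρ, h2, h3⟩ := ((h1.eventually (lt_mem_nhds h0)).and (Filter.eventually_gt_atTop 0)).exists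
  exact ⟨ρ, h3, h2⟩

lemma continuousOn_fracAvg (hf : Integrable f) (x : EuclideanSpace ℝ (Fin d)) :
    ContinuousOn (fun r => fracAvg β f x r) (Set.Ioi 0) := by
  intro r hr
  have hr0 : r ≠ 0 := (Set.mem_Ioi.1 hr).ne'
  have h3 := continuousAt_ballMass_radius hf x hr0
  have h4 : ContinuousAt (fun t : ℝ => (unitVol d)⁻¹ * t ^ (β - d)) r :=
    (Real.continuousAt_rpow_const _ _ (Or.inl hr0)).const_mul _
  refine ContinuousAt.continuousWithinAt ?_
  unfold fracAvg
  exact h4.mul h3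

lemma fracAvg_pos (x : EuclideanSpace ℝ (Fin d)) {ρ : ℝ} (hρ : 0 < ρ) (hf : Integrable f)
    (h : 0 < ballMass f 0 ρ) :
    0 < fracAvg β f x (ρ + ‖x‖) := by
  refine lt_of_lt_of_le ?_ (le_fracAvg hf x hρ)
  exact mul_pos (mul_pos (inv_pos.2 unitVol_pos) (Real.rpow_pos_of_pos (by positivity) _)) h

/-- The supremum defining the maximal function is attained away from the origin. -/
lemma IsRadialW11.exists_best (hd : 1 ≤ d) (hβ0 : 0 < β) (hβd : β < d)
    (h : IsRadialW11 f g) (h0 : 0 < ∫ y, ‖f y‖) {x : EuclideanSpace ℝ (Fin d)} (hx : x ≠ 0) :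
    ∃ r, 0 < r ∧ maxFun β f x = fracAvg β f x r := by
  have hf := h.integrable_fun
  obtain ⟨ρ, hρ, hm⟩ := exists_ballMass_pos hf h0
  have hpos := fracAvg_pos (β := β) x hρ hf hm
  have hrs : 0 < ρ + ‖x‖ := by positivity
  obtain ⟨r₀, R, hr₀, hb⟩ := exists_radius_bounds 𝕜 hd hβ0 hβd
    (max (∫ y, ‖f y‖) (∫ y, ‖g y‖)) (norm_pos_iff.2 hx) hpos
  have hb' := hb f g h (le_max_left _ _) (le_max_right _ _) x le_rfl
  -- Every radius doing at least as well as `ρ + ‖x‖` lies in `[r₀, R]`, so the maximum over this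
  -- compact interval is global.
  obtain ⟨r, hr, hmax⟩ := isCompact_Icc.exists_isMaxOn (s := Set.Icc r₀ R)
    ⟨ρ + ‖x‖, hb' _ hrs le_rfl⟩
    ((continuousOn_fracAvg (β := β) hf x).mono fun s hs => hr₀.trans_le hs.1)
  have hr0 : 0 < r := hr₀.trans_le hr.1
  have hge : fracAvg β f x (ρ + ‖x‖) ≤ fracAvg β f x r := hmax (hb' _ hrs le_rfl)
  refine ⟨r, hr0, le_antisymm ?_ (h.fracAvg_le_maxFun hd hβ0 hβd hx hr0)⟩
  refine h.maxFun_le_of_forall (fracAvg_nonneg x hr0) fun s hs => ?_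
  rcases le_or_gt (fracAvg β f x (ρ + ‖x‖)) (fracAvg β f x s) with hle | hlt
  · exact hmax (hb' s hs hle)
  · exact hlt.le.trans hge

/-- Best radii are uniformly bounded on annuli. -/
lemma exists_best_radius_bounds (𝕜 : Type*) [RCLike 𝕜] (hd : 1 ≤ d) (hβ0 : 0 < β) (hβd : β < d)
    {a b m ρ : ℝ} (N : ℝ) (ha : 0 < a) (hb : 0 < b) (hm : 0 < m) (hρ : 0 < ρ) :
    ∃ r₀ R : ℝ, 0 < r₀ ∧ ∀ (f : EuclideanSpace ℝ (Fin d) → 𝕜)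
        (g : EuclideanSpace ℝ (Fin d) → EuclideanSpace 𝕜 (Fin d)), IsRadialW11 f g →
      ∫ y, ‖f y‖ ≤ N → ∫ y, ‖g y‖ ≤ N → m ≤ ballMass f 0 ρ →
      ∀ x, a ≤ ‖x‖ → ‖x‖ ≤ b → ∀ r, 0 < r → maxFun β f x = fracAvg β f x r → r₀ ≤ r ∧ r ≤ R := by
  have hκ := unitVol_pos (d := d)
  -- The threshold bounds the average at radius `ρ + ‖x‖` from below for all `‖x‖ ≤ b`. It involves
  -- the function only through `m` and `N`, which makes the radii uniform along sequences.
  obtain ⟨r₀, R, hr₀, H⟩ := exists_radius_bounds (β := β) 𝕜 hd hβ0 hβd N ha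
    (m := (unitVol d)⁻¹ * (ρ + b) ^ (β - d) * m) (by positivity)
  refine ⟨r₀, R, hr₀, fun f g h hN1 hN2 hmass x hxa hxb r hr hbest =>
    H f g h hN1 hN2 x hxa r hr ?_⟩
  have hx0 : x ≠ 0 := norm_pos_iff.1 (ha.trans_le hxa)
  rw [← hbest]
  refine le_trans ?_ (h.fracAvg_le_maxFun hd hβ0 hβd hx0 (show 0 < ρ + ‖x‖ by positivity))
  refine le_trans ?_ (le_fracAvg h.integrable_fun x hρ)
  have : (ρ + b) ^ (β - d) ≤ (ρ + ‖x‖) ^ (β - d) :=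
    Real.rpow_le_rpow_of_nonpos (by positivity) (by linarith) (by linarith)
  gcongr

end Averages

/-! ### Lipschitz estimates and the gradient off the origin. -/

section Gradient

variable {d : ℕ}

lemma one_sub_mul_le_one_add_rpow_neg {s t : ℝ} (hs : 0 ≤ s) (ht : 0 ≤ t) :
    1 - s * t ≤ (1 + t) ^ (-s) := by
  have h1 : 0 < 1 + t := by positivity
  rw [Real.rpow_def_of_pos h1]
  have h2 := Real.add_one_le_exp (Real.log (1 + t) * -s)
  have h3 := Real.log_le_sub_one_of_pos h1
  nlinarith

lemma ae_ne_zero (hd : 1 ≤ d) : ∀ᵐ x : EuclideanSpace ℝ (Fin d), x ≠ 0 := by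
  have : NeZero d := ⟨by omega⟩
  simp [ae_iff]

/-- A one-sided bound suffices because the derivative is linear: it is tested on `v` and `-v`.
Differentiability need not be assumed, as `fderiv` defaults to zero. -/
lemma norm_fderiv_le_of_sub_le {u : EuclideanSpace ℝ (Fin d) → ℝ} {x : EuclideanSpace ℝ (Fin d)}
    {c : ℝ} (hc : 0 ≤ c)
    (h : ∀ᶠ y in nhds x, u x - u y ≤ c * ‖y - x‖) : ‖fderiv ℝ u x‖ ≤ c := by
  by_cases hu : DifferentiableAt ℝ u x
  swap
  · rw [fderiv_zero_of_not_differentiableAt hu]; simpa using hc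
  have key : ∀ v, -(c * ‖v‖) ≤ fderiv ℝ u x v := by
    intro v
    have h1 : HasDerivAt (fun t : ℝ => u (x + t • v)) (fderiv ℝ u x v) 0 := by
      have h2 : HasDerivAt (fun t : ℝ => x + t • v) v 0 := by
        simpa using ((hasDerivAt_id (0 : ℝ)).smul_const v).const_add x
      exact HasFDerivAt.comp_hasDerivAt (x := (0 : ℝ)) (f := fun t : ℝ => x + t • v)
        (by simpa using hu.hasFDerivAt) h2
    refine ge_of_tendsto h1.tendsto_slope_zero_right ?_
    have h3 : Filter.Tendsto (fun t : ℝ => x + t • v) (nhdsWithin 0 (Set.Ioi 0)) (nhds x) := by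
      have : Continuous (fun t : ℝ => x + t • v) := by fun_prop
      simpa using (this.tendsto 0).mono_left nhdsWithin_le_nhds
    filter_upwards [h3.eventually h, self_mem_nhdsWithin] with t ht ht0
    have ht0' : 0 < t := ht0
    rw [add_sub_cancel_left, norm_smul, Real.norm_of_nonneg ht0'.le] at ht
    simp only [zero_add, zero_smul, add_zero, smul_eq_mul]
    rw [inv_mul_eq_div, le_div_iff₀ ht0']
    linarith
  refine ContinuousLinearMap.opNorm_le_bound _ hc fun v => ?_
  rw [Real.norm_eq_abs, abs_le]
  refine ⟨key v, ?_⟩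
  have := key (-v)
  rw [map_neg, norm_neg] at this
  linarith

lemma gradient_apply (u : EuclideanSpace ℝ (Fin d) → ℝ) (x : EuclideanSpace ℝ (Fin d)) (i : Fin d) :
    gradient u x i = fderiv ℝ u x (EuclideanSpace.single i 1) := by
  have := InnerProductSpace.toDual_symm_apply (𝕜 := ℝ) (x := EuclideanSpace.single i (1 : ℝ))
    (y := fderiv ℝ u x)
  rw [← this, EuclideanSpace.inner_single_right]
  simp [gradient]

lemma norm_gradient (u : EuclideanSpace ℝ (Fin d) → ℝ) (x : EuclideanSpace ℝ (Fin d)) :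
    ‖gradient u x‖ = ‖fderiv ℝ u x‖ := by
  simp [gradient]

lemma measurable_gradient (u : EuclideanSpace ℝ (Fin d) → ℝ) : Measurable (gradient u) :=
  (LinearIsometryEquiv.continuous _).measurable.comp (measurable_fderiv ℝ u)

variable {𝕜 : Type*} [RCLike 𝕜] {β : ℝ} {f : EuclideanSpace ℝ (Fin d) → 𝕜}
    {g : EuclideanSpace ℝ (Fin d) → EuclideanSpace 𝕜 (Fin d)}

/-- If `f` vanishes almost everywhere, every radius is best and no bounds on best radii can hold;
hence this case is always split off. -/
lemma maxFun_eq_zero (hf : Integrable f) (h0 : ∫ y, ‖f y‖ = 0) (x : EuclideanSpace ℝ (Fin d)) :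
    maxFun β f x = 0 := by
  have h1 : fracMaximal β f x = 0 := by
    simp only [fracMaximal, ENNReal.iSup_eq_zero]
    intro r hr
    have h2 : ballMass f x r = 0 :=
      le_antisymm ((ballMass_le hf x r).trans_eq h0) (ballMass_nonneg x r)
    rw [fracAverage_eq hf x hr, fracAvg, h2]
    simp
  simp [maxFun, h1]

/-- One-sided Lipschitz estimate of the maximal function at a point with a best radius `r`. -/
lemma IsRadialW11.maxFun_sub_le (hd : 1 ≤ d) (hβ0 : 0 < β) (hβd : β < d) (h : IsRadialW11 f g)
    {x y : EuclideanSpace ℝ (Fin d)} (hy : y ≠ 0) {r : ℝ} (hr : 0 < r)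
    (hbest : maxFun β f x = fracAvg β f x r) :
    maxFun β f x - maxFun β f y ≤ (d - β) / r * maxFun β f x * ‖y - x‖ := by
  set t := ‖y - x‖
  have ht : 0 ≤ t := norm_nonneg _
  have hrt : 0 < r + t := by positivity
  have h1 := h.fracAvg_le_maxFun hd hβ0 hβd hy hrt
  -- Passing from `B(x,r)` to the larger ball `B(y, r + t)` loses only the normalizing factor `(1 +
  -- t/r)^(β-d)`, which is at least `1 - (d-β) t/r`.
  have h2 : ballMass f x r ≤ ballMass f y (r + t) := by
    refine ballMass_mono h.integrable_fun (ball_subset_ball' ?_)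
    rw [dist_comm, dist_eq_norm]
  have h3 : 1 - (d - β) * (t / r) ≤ (1 + t / r) ^ (-((d : ℝ) - β)) :=
    one_sub_mul_le_one_add_rpow_neg (by linarith) (by positivity)
  have h4 : r + t = r * (1 + t / r) := by field_simp
  have h5 : (1 + t / r) ^ (β - d) * fracAvg β f x r ≤ fracAvg β f y (r + t) := by
    rw [fracAvg, fracAvg, h4, Real.mul_rpow hr.le (by positivity), ← h4]
    have h6 : 0 ≤ (unitVol d)⁻¹ * (r ^ (β - d) * (1 + t / r) ^ (β - d)) :=
      mul_nonneg (inv_nonneg.2 unitVol_pos.le) (by positivity)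
    have := mul_le_mul_of_nonneg_left h2 h6
    linarith
  rw [neg_sub] at h3
  have h7 := mul_le_mul_of_nonneg_right h3 (fracAvg_nonneg (β := β) (f := f) x hr)
  rw [hbest]
  have h8 : (d - β) / r * fracAvg β f x r * t = (d - β) * (t / r) * fracAvg β f x r := by ring
  linarith

lemma IsRadialW11.norm_fderiv_maxFun_le (hd : 1 ≤ d) (hβ0 : 0 < β) (hβd : β < d)
    (h : IsRadialW11 f g) {x : EuclideanSpace ℝ (Fin d)} (hx : x ≠ 0) {r : ℝ} (hr : 0 < r)
    (hbest : maxFun β f x = fracAvg β f x r) :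
    ‖fderiv ℝ (maxFun β f) x‖ ≤ (d - β) / r * maxFun β f x := by
  refine norm_fderiv_le_of_sub_le
    (mul_nonneg (div_nonneg (by linarith) hr.le) (maxFun_nonneg x)) ?_
  filter_upwards [isOpen_ne.mem_nhds hx] with y hy
  exact h.maxFun_sub_le hd hβ0 hβd hy hr hbest

/-- Inserting the `L¹` bound `O(r^(β-d))` for the best average makes the gradient bound decreasing
in `r`, so only a lower bound `s` on the best radius matters. -/
lemma IsRadialW11.norm_fderiv_maxFun_le_rpow (hd : 1 ≤ d) (hβ0 : 0 < β) (hβd : β < d)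
    (h : IsRadialW11 f g) {x : EuclideanSpace ℝ (Fin d)} (hx : x ≠ 0) {r s : ℝ} (hs : 0 < s)
    (hsr : s ≤ r)
    (hbest : maxFun β f x = fracAvg β f x r) :
    ‖fderiv ℝ (maxFun β f) x‖ ≤
      (d - β) * (unitVol d)⁻¹ * s ^ (β - d - 1) * ∫ y, ‖f y‖ := by
  have hr : 0 < r := hs.trans_le hsr
  have hκ := unitVol_pos (d := d)
  have hdβ : 0 < d - β := by linarith
  refine (h.norm_fderiv_maxFun_le hd hβ0 hβd hx hr hbest).trans ?_
  have h1 := fracAvg_le_integral (β := β) h.integrable_fun x hr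
  have hN : 0 ≤ ∫ y, ‖f y‖ := integral_nonneg fun _ => norm_nonneg _
  generalize ∫ y, ‖f y‖ = N at *
  rw [hbest]
  calc (d - β) / r * fracAvg β f x r
      ≤ (d - β) / r * ((unitVol d)⁻¹ * r ^ (β - d) * N) := by gcongr
    _ = (d - β) * (unitVol d)⁻¹ * r ^ (β - d - 1) * N := by
        rw [Real.rpow_sub_one hr.ne']; ring
    _ ≤ _ := by
        have : r ^ (β - d - 1) ≤ s ^ (β - d - 1) :=
          Real.rpow_le_rpow_of_nonpos hs hsr (by linarith)
        gcongr

/-- On an annulus `M f` is bounded and best radii are at least `r₀`, so the one-sided estimate holds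
with a uniform constant; exchanging the points makes it two-sided. The global extension `v` allows
Rademacher's theorem and integration by parts for Lipschitz functions. -/
lemma IsRadialW11.exists_lipschitz_eqOn (hd : 1 ≤ d) (hβ0 : 0 < β) (hβd : β < d)
    (h : IsRadialW11 f g) {a b : ℝ} (ha : 0 < a) (hb : 0 < b) :
    ∃ (L : ℝ≥0) (v : EuclideanSpace ℝ (Fin d) → ℝ), LipschitzWith L v ∧
      ∀ x, a ≤ ‖x‖ → ‖x‖ ≤ b → maxFun β f x = v x := by
  have hN1 : 0 ≤ ∫ y, ‖f y‖ := integral_nonneg fun _ => norm_nonneg _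
  rcases hN1.eq_or_lt with h0 | h0
  · exact ⟨0, fun _ => 0, LipschitzWith.const _, fun x _ _ =>
      maxFun_eq_zero h.integrable_fun h0.symm x⟩
  have hN2 : 0 ≤ ∫ y, ‖g y‖ := integral_nonneg fun _ => norm_nonneg _
  obtain ⟨ρ, hρ, hm⟩ := exists_ballMass_pos h.integrable_fun h0
  obtain ⟨r₀, R, hr₀, H⟩ := exists_best_radius_bounds 𝕜 hd hβ0 hβd
    (max (∫ y, ‖f y‖) (∫ y, ‖g y‖)) ha hb hm hρ
  have hκ := unitVol_pos (d := d)
  have hdβ : 0 < d - β := by linarith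
  have hM : ∀ x, a ≤ ‖x‖ → maxFun β f x ≤
      (unitVol d)⁻¹ * (2 * (a ^ (d - 1))⁻¹ * (∫ y, ‖g y‖) + ∫ y, ‖f y‖) := by
    intro x hx
    refine (h.maxFun_le hd hβ0 hβd (norm_pos_iff.1 (ha.trans_le hx))).trans ?_
    generalize ∫ y, ‖g y‖ = N2 at *
    gcongr
  obtain ⟨M, hM0, hM⟩ : ∃ M, 0 ≤ M ∧ ∀ x, a ≤ ‖x‖ → maxFun β f x ≤ M := by
    refine ⟨_, ?_, hM⟩
    generalize ∫ y, ‖g y‖ = N2 at *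
    generalize ∫ y, ‖f y‖ = N1 at *
    positivity
  have hone : ∀ x, a ≤ ‖x‖ → ‖x‖ ≤ b → ∀ y, a ≤ ‖y‖ →
      maxFun β f x - maxFun β f y ≤ (d - β) / r₀ * M * dist x y := by
    intro x hxa hxb y hy
    have hx0 : x ≠ 0 := norm_pos_iff.1 (ha.trans_le hxa)
    have hy0 : y ≠ 0 := norm_pos_iff.1 (ha.trans_le hy)
    obtain ⟨r, hr, hbest⟩ := h.exists_best hd hβ0 hβd h0 hx0
    refine (h.maxFun_sub_le hd hβ0 hβd hy0 hr hbest).trans ?_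
    have hr0r := (H f g h (le_max_left _ _) (le_max_right _ _) le_rfl x hxa hxb r hr hbest).1
    have := hM x hxa
    have := maxFun_nonneg (β := β) (f := f) x
    rw [dist_comm, dist_eq_norm]
    gcongr
  have hlip : LipschitzOnWith (Real.toNNReal ((d - β) / r₀ * M)) (maxFun β f)
      {x | a ≤ ‖x‖ ∧ ‖x‖ ≤ b} := by
    refine LipschitzOnWith.of_dist_le_mul fun x hx y hy => ?_
    rw [Real.coe_toNNReal _ (by positivity), Real.dist_eq, abs_le]
    have h1 := hone x hx.1 hx.2 y hy.1
    have h2 := hone y hy.1 hy.2 x hx.1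
    rw [dist_comm y x] at h2
    constructor <;> linarith
  obtain ⟨v, hv, hev⟩ := hlip.extend_real
  exact ⟨_, v, hv, fun x h1 h2 => hev ⟨h1, h2⟩⟩

lemma annulus_mem_nhds {a b : ℝ} {x : EuclideanSpace ℝ (Fin d)} (h1 : a < ‖x‖) (h2 : ‖x‖ < b) :
    {y : (EuclideanSpace ℝ (Fin d)) | a < ‖y‖ ∧ ‖y‖ < b} ∈ nhds x :=
  ((isOpen_lt continuous_const continuous_norm).inter
    (isOpen_lt continuous_norm continuous_const)).mem_nhds ⟨h1, h2⟩

lemma eventuallyEq_of_eq_on_annulus {u v : EuclideanSpace ℝ (Fin d) → ℝ} {a b : ℝ}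
    (h : ∀ x, a ≤ ‖x‖ → ‖x‖ ≤ b → u x = v x) {x : EuclideanSpace ℝ (Fin d)} (h1 : a < ‖x‖)
    (h2 : ‖x‖ < b) :
    u =ᶠ[nhds x] v :=
  Filter.eventually_of_mem (annulus_mem_nhds h1 h2) fun y hy => h y hy.1.le hy.2.le

lemma IsRadialW11.continuousAt_maxFun (hd : 1 ≤ d) (hβ0 : 0 < β) (hβd : β < d)
    (h : IsRadialW11 f g) {x : EuclideanSpace ℝ (Fin d)} (hx : x ≠ 0) :
    ContinuousAt (maxFun β f) x := by
  have hx' : 0 < ‖x‖ := norm_pos_iff.2 hx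
  obtain ⟨L, v, hv, hev⟩ := h.exists_lipschitz_eqOn hd hβ0 hβd (a := ‖x‖ / 2) (b := 2 * ‖x‖)
    (by positivity) (by positivity)
  exact hv.continuous.continuousAt.congr
    (eventuallyEq_of_eq_on_annulus hev (by linarith) (by linarith)).symm

lemma IsRadialW11.ae_differentiableAt_maxFun (hd : 1 ≤ d) (hβ0 : 0 < β) (hβd : β < d)
    (h : IsRadialW11 f g) : ∀ᵐ x, DifferentiableAt ℝ (maxFun β f) x := by
  have h1 : ∀ n : ℕ, ∀ᵐ x : EuclideanSpace ℝ (Fin d), (n + 1 : ℝ)⁻¹ < ‖x‖ → ‖x‖ < n + 1 →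
      DifferentiableAt ℝ (maxFun β f) x := by
    intro n
    obtain ⟨L, v, hv, hev⟩ := h.exists_lipschitz_eqOn hd hβ0 hβd (a := (n + 1 : ℝ)⁻¹)
      (b := n + 1) (by positivity) (by positivity)
    filter_upwards [hv.ae_differentiableAt] with x hx h1 h2
    exact hx.congr_of_eventuallyEq (eventuallyEq_of_eq_on_annulus hev h1 h2)
  filter_upwards [ae_all_iff.2 h1, ae_ne_zero hd] with x hx hx0
  have hx' : 0 < ‖x‖ := norm_pos_iff.2 hx0
  obtain ⟨n, hn⟩ := exists_nat_gt (max ‖x‖ ‖x‖⁻¹)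
  have hn1 := (le_max_left _ _).trans_lt hn
  have hn2 := (le_max_right _ _).trans_lt hn
  exact hx n (inv_lt_of_inv_lt₀ hx' (by linarith)) (by linarith)

/-- The classical gradient of the maximal function is its weak gradient off the origin. -/
lemma IsRadialW11.hasWeakGradOn_gradient (hd : 1 ≤ d) (hβ0 : 0 < β) (hβd : β < d)
    (h : IsRadialW11 f g) : HasWeakGradFracMaximalOn {0}ᶜ β f (gradient (maxFun β f)) where
  locallyIntegrableOn_fun := by
    refine ContinuousOn.locallyIntegrableOn (fun x hx => ?_) (measurableSet_singleton _).compl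
    exact (h.continuousAt_maxFun hd hβ0 hβd hx).continuousWithinAt
  locallyIntegrableOn_grad := by
    intro x hx
    have hx' : 0 < ‖x‖ := norm_pos_iff.2 hx
    obtain ⟨L, v, hv, hev⟩ := h.exists_lipschitz_eqOn hd hβ0 hβd (a := ‖x‖ / 2) (b := 2 * ‖x‖)
      (by positivity) (by positivity)
    refine ⟨{y | ‖x‖ / 2 < ‖y‖ ∧ ‖y‖ < 2 * ‖x‖}, mem_nhdsWithin_of_mem_nhds
      (annulus_mem_nhds (by linarith) (by linarith)), ?_⟩
    have hm : MeasurableSet {y : (EuclideanSpace ℝ (Fin d)) | ‖x‖ / 2 < ‖y‖ ∧ ‖y‖ < 2 * ‖x‖} :=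
      (measurableSet_lt measurable_const measurable_norm).inter
        (measurableSet_lt measurable_norm measurable_const)
    refine Measure.integrableOn_of_bounded (M := L) ?_
      (measurable_gradient _).aestronglyMeasurable ?_
    · refine ((measure_mono (t := ball 0 (2 * ‖x‖)) fun y hy => ?_).trans_lt
        measure_ball_lt_top).ne
      simpa using hy.2
    · filter_upwards [ae_restrict_mem hm] with y hy
      rw [norm_gradient, (eventuallyEq_of_eq_on_annulus hev hy.1 hy.2).fderiv_eq]
      exact norm_fderiv_le_of_lipschitz ℝ hv
  integral_eq := by
    intro φ hφ hφc hφs i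
    change ∫ x, fderiv ℝ φ x (EuclideanSpace.single i 1) • maxFun β f x = _
    -- A test function whose support misses the origin lives on an annulus, where `M f` equals a
    -- globally Lipschitz `v`; integration by parts is then done for `v`.
    have h0 : (0 : EuclideanSpace ℝ (Fin d)) ∉ tsupport φ := fun h0 => hφs h0 rfl
    obtain ⟨a, ha, hball⟩ := Metric.isOpen_iff.1 (isClosed_tsupport φ).isOpen_compl 0 h0
    obtain ⟨b, hb, hsub⟩ := hφc.isCompact.isBounded.subset_ball_lt 0 0
    have hin : ∀ x ∈ tsupport φ, a / 2 < ‖x‖ ∧ ‖x‖ < b := by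
      intro x hx
      refine ⟨?_, by simpa using hsub hx⟩
      by_contra! hle
      exact hball (show x ∈ ball 0 a by rw [mem_ball_zero_iff]; linarith) hx
    obtain ⟨L, v, hv, hev⟩ := h.exists_lipschitz_eqOn hd hβ0 hβd (half_pos ha) hb
    have hφ1 : ContDiff ℝ 1 φ := hφ.of_le (by exact_mod_cast le_top)
    obtain ⟨D, hD⟩ := hφ1.lipschitzWith_of_hasCompactSupport hφc one_ne_zero
    have key := hv.integral_lineDeriv_mul_eq (μ := volume) hD hφc
      (EuclideanSpace.single i (1 : ℝ))
    have e1 : ∀ x, fderiv ℝ φ x (EuclideanSpace.single i 1) • maxFun β f x =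
        -(lineDeriv ℝ φ x (-EuclideanSpace.single i 1) * v x) := by
      intro x
      rw [lineDeriv_neg, (hφ1.differentiable one_ne_zero x).lineDeriv_eq_fderiv]
      by_cases hx : x ∈ tsupport φ
      · rw [hev x (hin x hx).1.le (hin x hx).2.le]; simp
      · rw [fderiv_of_notMem_tsupport ℝ hx]; simp
    simp only [e1]
    rw [integral_neg, ← key]
    congr 1
    refine integral_congr_ae ?_
    filter_upwards [hv.ae_differentiableAt] with x hx
    by_cases hxs : x ∈ tsupport φ
    · rw [hx.lineDeriv_eq_fderiv, gradient_apply,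
        (eventuallyEq_of_eq_on_annulus hev (hin x hxs).1 (hin x hxs).2).fderiv_eq,
        smul_eq_mul, mul_comm]
    · rw [image_eq_zero_of_notMem_tsupport hxs]; simp

end Gradient

/-! ### Removing the origin. -/

section WeakGradient

variable {d : ℕ}

lemma HasWeakGradOn.mono {𝕜 : Type*} [RCLike 𝕜] {Ω Ω' : Set (EuclideanSpace ℝ (Fin d))}
    {u : EuclideanSpace ℝ (Fin d) → 𝕜}
    {G : EuclideanSpace ℝ (Fin d) → EuclideanSpace 𝕜 (Fin d)} (h : HasWeakGradOn Ω u G)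
    (hΩ : Ω' ⊆ Ω) :
    HasWeakGradOn Ω' u G :=
  ⟨h.1.mono_set hΩ, h.2.mono_set hΩ, fun φ h1 h2 h3 i => h.3 φ h1 h2 (h3.trans hΩ) i⟩

lemma integrable_smul_of_locallyIntegrableOn {F : Type*} [NormedAddCommGroup F] [NormedSpace ℝ F]
    {Ω : Set (EuclideanSpace ℝ (Fin d))} {G : EuclideanSpace ℝ (Fin d) → F}
    (hG : LocallyIntegrableOn G Ω)
    {φ : EuclideanSpace ℝ (Fin d) → ℝ} (hφ : Continuous φ) (hc : HasCompactSupport φ)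
    (hs : tsupport φ ⊆ Ω) :
    Integrable fun x => φ x • G x := by
  have h1 : IntegrableOn G (tsupport φ) := hG.integrableOn_compact_subset hs hc.isCompact
  have h2 : IntegrableOn (fun x => φ x • G x) (tsupport φ) :=
    h1.continuousOn_smul hφ.continuousOn hc.isCompact
  rwa [integrableOn_iff_integrable_of_support_subset] at h2
  intro x hx
  refine subset_tsupport φ fun h0 => hx ?_
  simp [h0]

lemma HasWeakGradOn.ae_eq {𝕜 : Type*} [RCLike 𝕜] {Ω : Set (EuclideanSpace ℝ (Fin d))}
    (hΩ : IsOpen Ω) {u : EuclideanSpace ℝ (Fin d) → 𝕜}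
    {G G' : EuclideanSpace ℝ (Fin d) → EuclideanSpace 𝕜 (Fin d)} (h : HasWeakGradOn Ω u G)
    (h' : HasWeakGradOn Ω u G') : ∀ᵐ x, x ∈ Ω → G x = G' x := by
  have key : ∀ i, ∀ᵐ x, x ∈ Ω → G x i - G' x i = 0 := by
    intro i
    have hl : ∀ G : EuclideanSpace ℝ (Fin d) → EuclideanSpace 𝕜 (Fin d), LocallyIntegrableOn G Ω →
        LocallyIntegrableOn (fun x => G x i) Ω := by
      intro G hG x hx
      obtain ⟨s, hs, hi⟩ := hG x hx
      exact ⟨s, hs, (EuclideanSpace.proj (𝕜 := 𝕜) i).integrable_comp hi⟩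
    have hG := hl G h.2
    have hG' := hl G' h'.2
    refine hΩ.ae_eq_zero_of_integral_contDiff_smul_eq_zero (hG.sub hG')
      fun φ hφ hc hs => ?_
    have h1 := integrable_smul_of_locallyIntegrableOn hG hφ.continuous hc hs
    have h2 := integrable_smul_of_locallyIntegrableOn hG' hφ.continuous hc hs
    have h3 := (h.3 φ hφ hc hs i).symm.trans (h'.3 φ hφ hc hs i)
    simp only [smul_sub]
    rw [integral_sub h1 h2, sub_eq_zero]
    exact neg_inj.1 h3
  filter_upwards [ae_all_iff.2 key] with x hx hxΩ
  ext i
  exact sub_eq_zero.1 (hx i hxΩ)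

/-- A point is removable for the weak gradient of an even function. -/
lemma HasWeakGradOn.of_compl_zero (hd : 1 ≤ d) {u : EuclideanSpace ℝ (Fin d) → ℝ}
    {G : EuclideanSpace ℝ (Fin d) → EuclideanSpace ℝ (Fin d)}
    (h : HasWeakGradOn {0}ᶜ u G) (hu : LocallyIntegrable u) (hG : LocallyIntegrable G)
    (heven : ∀ x, u (-x) = u x) : HasWeakGradOn Set.univ u G := by
  refine ⟨hu.locallyIntegrableOn _, hG.locallyIntegrableOn _, fun φ hφ hφc _ i => ?_⟩
  let ψ : ContDiffBump (0 : EuclideanSpace ℝ (Fin d)) := ⟨1, 2, one_pos, one_lt_two⟩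
  have hψ : ContDiff ℝ ∞ ψ := ψ.contDiff
  have hψ1 : ContDiff ℝ 1 ψ := hψ.of_le (by exact_mod_cast le_top)
  have hφ1 : ContDiff ℝ 1 φ := hφ.of_le (by exact_mod_cast le_top)
  set e : EuclideanSpace ℝ (Fin d) := EuclideanSpace.single i 1
  have hGi : LocallyIntegrable (fun x => G x i) := fun x => by
    obtain ⟨s, hs, hi⟩ := hG x
    exact ⟨s, hs, (EuclideanSpace.proj (𝕜 := ℝ) i).integrable_comp hi⟩
  have hdφ : Continuous fun x => fderiv ℝ φ x e :=
    (hφ1.continuous_fderiv one_ne_zero).clm_apply continuous_const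
  have hdψ : Continuous fun x => fderiv ℝ ψ x e :=
    (hψ1.continuous_fderiv one_ne_zero).clm_apply continuous_const
  -- The cutoff `χ n` vanishes near the origin and `k n` is minus its derivative along `e`, of size
  -- `n + 1` on a ball of radius `2 / (n + 1)`. Since `k n` is odd and `u` even, the integral of `k
  -- n * u` is zero, so `φ` may be replaced by `φ - φ 0`, whose size `O(‖x‖)` absorbs the factor `n
  -- + 1`. Evenness matters in dimension one, where a jump at the origin would contribute.
  let χ : ℕ → EuclideanSpace ℝ (Fin d) → ℝ := fun n x => 1 - ψ ((n + 1 : ℝ) • x)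
  let k : ℕ → EuclideanSpace ℝ (Fin d) → ℝ := fun n x => (n + 1) * fderiv ℝ ψ ((n + 1 : ℝ) • x) e
  have hχ : ∀ n, ContDiff ℝ ∞ (χ n) := fun n =>
    contDiff_const.sub (hψ.comp (contDiff_const_smul _))
  have hχb : ∀ n x, |χ n x| ≤ 1 := fun n x => by
    have h1 := ψ.nonneg (x := (n + 1 : ℝ) • x)
    have h2 := ψ.le_one (x := (n + 1 : ℝ) • x)
    simp only [χ]
    rw [abs_le]; constructor <;> linarith
  have hkc : ∀ n, Continuous (k n) := fun n =>
    continuous_const.mul (hdψ.comp (continuous_const_smul _))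
  have hχd : ∀ n x, HasFDerivAt (χ n) (-((n + 1 : ℝ) • fderiv ℝ ψ ((n + 1 : ℝ) • x))) x := by
    intro n x
    have h1 : HasFDerivAt (fun x : EuclideanSpace ℝ (Fin d) => (n + 1 : ℝ) • x)
        ((n + 1 : ℝ) • ContinuousLinearMap.id ℝ (EuclideanSpace ℝ (Fin d))) x :=
      ((n + 1 : ℝ) • ContinuousLinearMap.id ℝ (EuclideanSpace ℝ (Fin d))).hasFDerivAt
    have h2 := ((hψ1.differentiable one_ne_zero ((n + 1 : ℝ) • x)).hasFDerivAt.comp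
        x h1).const_sub 1
    refine h2.congr_fderiv ?_
    ext v; simp
  have hlarge : ∀ (n : ℕ) (x : EuclideanSpace ℝ (Fin d)), 2 ≤ (n + 1 : ℝ) * ‖x‖ → χ n x = 1 := by
    intro n x hx
    have : ψ ((n + 1 : ℝ) • x) = 0 := by
      refine ψ.zero_of_le_dist ?_
      rw [dist_zero_right, norm_smul, Real.norm_of_nonneg (by positivity)]
      exact hx
    simp [χ, this]
  have hk0 : ∀ (n : ℕ) (x : EuclideanSpace ℝ (Fin d)), 2 < (n + 1 : ℝ) * ‖x‖ → k n x = 0 := by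
    intro n x hx
    have : (n + 1 : ℝ) • x ∉ tsupport ψ := by
      rw [ψ.tsupport_eq, mem_closedBall_zero_iff, norm_smul, Real.norm_of_nonneg (by positivity)]
      exact not_le.2 hx
    simp [k, fderiv_of_notMem_tsupport ℝ this]
  have hlim : ∀ x : EuclideanSpace ℝ (Fin d), x ≠ 0 → ∀ᶠ n : ℕ in Filter.atTop,
      2 < (n + 1 : ℝ) * ‖x‖ := by
    intro x hx
    have hx' : 0 < ‖x‖ := norm_pos_iff.2 hx
    obtain ⟨m, hm⟩ := exists_nat_gt (2 / ‖x‖)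
    filter_upwards [Filter.eventually_ge_atTop m] with n hn
    rw [div_lt_iff₀ hx'] at hm
    have : (m : ℝ) ≤ n := by exact_mod_cast hn
    nlinarith
  have hkcs : ∀ n, HasCompactSupport (k n) := by
    intro n
    refine HasCompactSupport.intro (isCompact_closedBall (0 : EuclideanSpace ℝ (Fin d)) 2)
        fun x hx => hk0 n x ?_
    rw [mem_closedBall_zero_iff, not_le] at hx
    have : (0 : ℝ) ≤ n := n.cast_nonneg
    nlinarith
  have hkodd : ∀ n x, k n (-x) = -k n x := by
    intro n x
    have h1 : ∀ y, fderiv ℝ ψ (-y) = -fderiv ℝ ψ y := by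
      intro y
      have h2 : (fun y => ψ (-y)) = ψ := funext fun y => ψ.neg y
      have h3 := ((hψ1.differentiable one_ne_zero (-y)).hasFDerivAt.comp y
        (hasFDerivAt_id y).neg).fderiv
      have h4 : fderiv ℝ ψ y = -fderiv ℝ ψ (-y) := by
        rw [← h2]
        refine h3.trans ?_
        ext v; simp [h2]
      rw [h4, neg_neg]
    simp only [k, smul_neg, h1]
    simp
  have hint0 : ∀ n, ∫ x, k n x * u x = 0 := by
    intro n
    have h1 := integral_neg_eq_self (fun x => k n x * u x) volume
    simp only [hkodd, heven, neg_mul, integral_neg] at h1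
    linarith
  have hI1 : Integrable fun x => fderiv ℝ φ x e * u x :=
    hu.integrable_smul_left_of_hasCompactSupport hdφ (hφc.fderiv_apply ℝ e)
  have hI2 : Integrable fun x => φ x * G x i :=
    hGi.integrable_smul_left_of_hasCompactSupport hφ.continuous hφc
  have hI3 : ∀ n, Integrable fun x => k n x * u x := fun n =>
    hu.integrable_smul_left_of_hasCompactSupport (hkc n) (hkcs n)
  have hI4 : ∀ n, Integrable fun x => φ x * k n x * u x := fun n =>
    hu.integrable_smul_left_of_hasCompactSupport (hφ.continuous.mul (hkc n)) hφc.mul_right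
  have hI5 : ∀ n, Integrable fun x => χ n x * (fderiv ℝ φ x e * u x) := fun n =>
    hI1.bdd_mul (hχ n).continuous.aestronglyMeasurable
      (Filter.Eventually.of_forall fun x => hχb n x)
  have hident : ∀ n, ∫ x, χ n x * (fderiv ℝ φ x e * u x) =
      (∫ x, (φ x - φ 0) * k n x * u x) - ∫ x, χ n x * (φ x * G x i) := by
    intro n
    have hsupp : tsupport (fun x => χ n x * φ x) ⊆ {0}ᶜ := by
      rw [Set.subset_compl_singleton_iff, notMem_tsupport_iff_eventuallyEq]
      filter_upwards [ball_mem_nhds (0 : EuclideanSpace ℝ (Fin d))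
          (show 0 < (n + 1 : ℝ)⁻¹ by positivity)] with x hx
      rw [mem_ball_zero_iff] at hx
      have : ψ ((n + 1 : ℝ) • x) = 1 := by
        refine ψ.one_of_mem_closedBall ?_
        rw [mem_closedBall_zero_iff, norm_smul, Real.norm_of_nonneg (by positivity)]
        have := mul_le_mul_of_nonneg_left hx.le (show (0 : ℝ) ≤ n + 1 by positivity)
        rwa [mul_inv_cancel₀ (by positivity)] at this
      simp [χ, this]
    have h1 := h.integral_eq (fun x => χ n x * φ x) ((hχ n).mul hφ) hφc.mul_left hsupp i
    have h2 : ∀ x, fderiv ℝ (fun x => χ n x * φ x) x e • u x =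
        χ n x * (fderiv ℝ φ x e * u x) - φ x * k n x * u x := by
      intro x
      have h3 := (hχd n x).mul (hφ1.differentiable one_ne_zero x).hasFDerivAt
      have h4 : fderiv ℝ (fun x => χ n x * φ x) x = _ := h3.fderiv
      rw [h4]
      simp [k]
      ring
    rw [integral_congr_ae (Filter.Eventually.of_forall h2), integral_sub (hI5 n) (hI4 n)] at h1
    have h5 : ∫ x, (φ x - φ 0) * k n x * u x = ∫ x, φ x * k n x * u x := by
      have h6 : ∀ x, (φ x - φ 0) * k n x * u x = φ x * k n x * u x - φ 0 * (k n x * u x) :=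
        fun x => by ring
      rw [integral_congr_ae (Filter.Eventually.of_forall h6),
        integral_sub (hI4 n) ((hI3 n).const_mul _), integral_const_mul, hint0]
      ring
    have h7 : ∀ x, (χ n x * φ x) • G x i = χ n x * (φ x * G x i) := fun x => by
      simp [mul_assoc]
    rw [integral_congr_ae (Filter.Eventually.of_forall h7)] at h1
    rw [h5]
    linarith
  obtain ⟨D, hD⟩ := hφ1.lipschitzWith_of_hasCompactSupport hφc one_ne_zero
  obtain ⟨C, hC⟩ := hψ1.lipschitzWith_of_hasCompactSupport ψ.hasCompactSupport one_ne_zero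
  have hχlim : ∀ w : EuclideanSpace ℝ (Fin d) → ℝ, Integrable w →
      Filter.Tendsto (fun n => ∫ x, χ n x * w x)
      Filter.atTop (nhds (∫ x, w x)) := by
    intro w hw
    refine tendsto_integral_of_dominated_convergence (fun x => ‖w x‖)
      (fun n => (hχ n).continuous.aestronglyMeasurable.mul hw.1) hw.norm
      (fun n => Filter.Eventually.of_forall fun x => ?_) ?_
    · rw [norm_mul]
      exact mul_le_of_le_one_left (norm_nonneg _) (hχb n x)
    · filter_upwards [ae_ne_zero hd] with x hx
      refine tendsto_const_nhds.congr' ((hlim x hx).mono fun n hn => ?_)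
      simp [hlarge n x hn.le]
  have hklim : Filter.Tendsto (fun n => ∫ x, (φ x - φ 0) * k n x * u x) Filter.atTop
      (nhds (∫ _ : EuclideanSpace ℝ (Fin d), (0 : ℝ))) := by
    have hub : Integrable ((closedBall (0 : EuclideanSpace ℝ (Fin d)) 2).indicator u) :=
      (hu.integrableOn_isCompact (isCompact_closedBall 0 2)).integrable_indicator
        measurableSet_closedBall
    -- On the support of `k n` one has `(n + 1) * ‖x‖ ≤ 2`; this gives the constant, and it places
    -- all supports in the closed ball of radius 2.
    refine tendsto_integral_of_dominated_convergence
      (fun x => D * 2 * (C * ‖e‖) * ‖(closedBall (0 : EuclideanSpace ℝ (Fin d)) 2).indicator u x‖)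
      (fun n => ?_) (hub.norm.const_mul _) (fun n => Filter.Eventually.of_forall fun x => ?_) ?_
    · exact ((hφ.continuous.sub continuous_const).mul (hkc n)).aestronglyMeasurable.mul
        hu.aestronglyMeasurable
    · have hn0 : (0 : ℝ) ≤ n := n.cast_nonneg
      rcases lt_or_ge 2 ((n + 1 : ℝ) * ‖x‖) with hx | hx
      · rw [hk0 n x hx]; simp only [mul_zero, zero_mul, norm_zero]; positivity
      · have hxm : x ∈ closedBall (0 : EuclideanSpace ℝ (Fin d)) 2 := by
          rw [mem_closedBall_zero_iff]; nlinarith [norm_nonneg x]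
        rw [Set.indicator_of_mem hxm, norm_mul, norm_mul]
        refine mul_le_mul_of_nonneg_right ?_ (norm_nonneg _)
        have h1 : ‖φ x - φ 0‖ ≤ D * ‖x‖ := by simpa [dist_eq_norm] using hD.dist_le_mul x 0
        have h2 : ‖k n x‖ ≤ (n + 1) * (C * ‖e‖) := by
          simp only [k, norm_mul]
          rw [Real.norm_of_nonneg (by positivity : (0 : ℝ) ≤ n + 1)]
          refine mul_le_mul_of_nonneg_left ?_ (by positivity)
          refine (ContinuousLinearMap.le_opNorm _ _).trans ?_
          gcongr
          exact norm_fderiv_le_of_lipschitz ℝ hC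
        calc ‖φ x - φ 0‖ * ‖k n x‖ ≤ (D * ‖x‖) * ((n + 1) * (C * ‖e‖)) := by gcongr
          _ = D * ((n + 1) * ‖x‖) * (C * ‖e‖) := by ring
          _ ≤ D * 2 * (C * ‖e‖) := by gcongr
    · filter_upwards [ae_ne_zero hd] with x hx
      refine tendsto_const_nhds.congr' ((hlim x hx).mono fun n hn => ?_)
      simp [hk0 n x hn]
  have hfin := tendsto_nhds_unique (hχlim _ hI1)
    ((hklim.sub (hχlim _ hI2)).congr fun n => (hident n).symm)
  simpa using hfin

/-- In polar coordinates the Jacobian cancels the singularity. This is the weight in the pointwise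
bound of the maximal function, and makes it locally integrable at the origin. -/
lemma integrableOn_inv_norm_pow (hd : 1 ≤ d) (b : ℝ) :
    IntegrableOn (fun x : EuclideanSpace ℝ (Fin d) => (‖x‖ ^ (d - 1))⁻¹) (ball 0 b) := by
  have : NeZero d := ⟨by omega⟩
  rw [← integrable_indicator_iff measurableSet_ball]
  have h1 : (ball (0 : EuclideanSpace ℝ (Fin d)) b).indicator (fun x : EuclideanSpace ℝ (Fin d) =>
      (‖x‖ ^ (d - 1))⁻¹) =
      fun x => (Set.Iio b).indicator (fun t : ℝ => (t ^ (d - 1))⁻¹) ‖x‖ := by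
    ext x
    simp [Set.indicator]
  rw [h1, integrable_fun_norm_addHaar, finrank_euclideanSpace_fin]
  have h2 : Set.EqOn (fun y : ℝ => y ^ (d - 1) • (Set.Iio b).indicator
      (fun t : ℝ => (t ^ (d - 1))⁻¹) y) ((Set.Iio b).indicator 1) (Set.Ioi 0) := by
    intro y hy
    have hy0 : y ^ (d - 1) ≠ 0 := pow_ne_zero _ (Set.mem_Ioi.1 hy).ne'
    by_cases hyb : y ∈ Set.Iio b
    · simp [Set.indicator_of_mem hyb, hy0]
    · simp [Set.indicator_of_notMem hyb]
  rw [integrableOn_congr_fun h2 measurableSet_Ioi, integrableOn_indicator_iff measurableSet_Iio]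
  rw [Set.inter_comm, Set.Ioi_inter_Iio]
  exact integrableOn_const (by simp)

variable {𝕜 : Type*} [RCLike 𝕜] {β : ℝ} {f : EuclideanSpace ℝ (Fin d) → 𝕜}
    {g : EuclideanSpace ℝ (Fin d) → EuclideanSpace 𝕜 (Fin d)}

lemma maxFun_neg (hrad : ∃ φ : ℝ → 𝕜, f =ᵐ[volume] fun x => φ ‖x‖) (x : EuclideanSpace ℝ (Fin d)) :
    maxFun β f (-x) = maxFun β f x := by
  have h1 : ∀ r, fracAverage β f (-x) r = fracAverage β f x r := by
    intro r
    have h2 := setLIntegral_ball_isometry hrad (LinearIsometryEquiv.neg ℝ) x r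
    rw [LinearIsometryEquiv.coe_neg] at h2
    rw [fracAverage, fracAverage, setLAverage_eq, setLAverage_eq, h2,
      Measure.addHaar_ball_center, Measure.addHaar_ball_center volume x]
  simp only [maxFun, fracMaximal, h1]

lemma IsRadialW11.locallyIntegrable_maxFun (hd : 1 ≤ d) (hβ0 : 0 < β) (hβd : β < d)
    (h : IsRadialW11 f g) : LocallyIntegrable (maxFun β f) := by
  have hm : AEStronglyMeasurable (maxFun β f) volume := by
    have h1 := (h.hasWeakGradOn_gradient hd hβ0 hβd).locallyIntegrableOn_fun.aestronglyMeasurable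
    rwa [Measure.restrict_eq_self_of_ae_mem] at h1
    exact ae_ne_zero hd
  intro x
  refine ⟨ball 0 (‖x‖ + 1), isOpen_ball.mem_nhds (by simp), ?_⟩
  refine Integrable.mono' ((((integrableOn_inv_norm_pow hd (‖x‖ + 1)).integrable.const_mul
    2).mul_const (∫ y, ‖g y‖)).add
    (integrableOn_const (C := ∫ y, ‖f y‖) measure_ball_lt_top.ne) |>.const_mul (unitVol d)⁻¹)
    hm.restrict (ae_restrict_of_ae ?_)
  filter_upwards [ae_ne_zero hd] with y hy
  rw [Real.norm_of_nonneg (maxFun_nonneg y)]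
  exact h.maxFun_le hd hβ0 hβd hy

end WeakGradient

/-! ### Consequences of the two local bounds. -/

section Bounds

variable {d : ℕ} {𝕜 : Type*} [RCLike 𝕜] {β : ℝ} {f : EuclideanSpace ℝ (Fin d) → 𝕜}
    {g : EuclideanSpace ℝ (Fin d) → EuclideanSpace 𝕜 (Fin d)}

lemma gradient_maxFun_eq_zero (hf : Integrable f) (h0 : ∫ y, ‖f y‖ = 0)
    (x : EuclideanSpace ℝ (Fin d)) :
    gradient (maxFun β f) x = 0 := by
  have : maxFun β f = fun _ => 0 := funext fun x => maxFun_eq_zero hf h0 x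
  rw [this]; simp [gradient]

lemma integral_norm_eq_zero_or_pos (f : EuclideanSpace ℝ (Fin d) → 𝕜) :
    ∫ y, ‖f y‖ = 0 ∨ 0 < ∫ y, ‖f y‖ :=
  (integral_nonneg fun _ => norm_nonneg _).eq_or_lt.imp Eq.symm id

/-- The local bound near the origin implies the global bound. -/
lemma LocalBoundNearZero.exists_lintegral_gradient_le (hd : 1 ≤ d) (hβ0 : 0 < β) (hβd : β < d)
    (hzero : LocalBoundNearZero 𝕜 d β) : ∃ C : ℝ≥0, ∀ (f : EuclideanSpace ℝ (Fin d) → 𝕜)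
      (g : EuclideanSpace ℝ (Fin d) → EuclideanSpace 𝕜 (Fin d)), IsRadialW11 f g →
      ∫⁻ x, ‖gradient (maxFun β f) x‖ₑ ^ ((d : ℝ) / (d - β)) ≤
        C * (∫⁻ x, ‖g x‖ₑ) ^ ((d : ℝ) / (d - β)) := by
  obtain ⟨C, hC⟩ := hzero
  have hq : 0 < (d : ℝ) / (d - β) := div_pos (by linarith) (by linarith)
  refine ⟨C, fun f g h => ?_⟩
  rcases integral_norm_eq_zero_or_pos f with h0 | h0
  · simp [gradient_maxFun_eq_zero h.integrable_fun h0, hq]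
  obtain ⟨ρ, hρ, hm⟩ := exists_ballMass_pos h.integrable_fun h0
  -- On each annulus all best balls lie in some large ball, so the first local bound applies with a
  -- constant independent of `n`; monotone convergence over the annuli gives the global bound.
  let H : ℕ → Set (EuclideanSpace ℝ (Fin d)) := fun n => {x | (n + 1 : ℝ)⁻¹ ≤ ‖x‖ ∧ ‖x‖ ≤ n + 1}
  have hHm : ∀ n, MeasurableSet (H n) := fun n =>
    (measurableSet_le measurable_const measurable_norm).inter
      (measurableSet_le measurable_norm measurable_const)
  have hH : ∀ n, ∫⁻ x in H n, ‖gradient (maxFun β f) x‖ₑ ^ ((d : ℝ) / (d - β)) ≤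
      C * (∫⁻ x, ‖g x‖ₑ) ^ ((d : ℝ) / (d - β)) := by
    intro n
    have hn : (0 : ℝ) < (n + 1 : ℝ)⁻¹ := by positivity
    obtain ⟨r₀, R, hr₀, hR⟩ := exists_best_radius_bounds 𝕜 hd hβ0 hβd
      (max (∫ y, ‖f y‖) (∫ y, ‖g y‖)) hn (show (0 : ℝ) < n + 1 by positivity) hm hρ
    -- A best ball at `x` lies within distance `‖x‖ + r ≤ n + 1 + R` of the origin, which is less
    -- than `n + 2 + |R|`.
    refine (hC f g _ h (h.hasWeakGradOn_gradient hd hβ0 hβd) (n + 2 + |R|) (H n)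
      (by positivity) (hHm n) fun x hx => ?_).trans ?_
    · have hx0 : x ≠ 0 := norm_pos_iff.1 (hn.trans_le hx.1)
      obtain ⟨r, hr, hbest⟩ := h.exists_best hd hβ0 hβd h0 hx0
      refine ⟨_, h.mem_bestBalls hd hβ0 hβd hx0 hr hbest, ?_⟩
      have := (hR f g h (le_max_left _ _) (le_max_right _ _) le_rfl x hx.1 hx.2 r hr hbest).2
      refine closedBall_subset_ball' ?_
      rw [dist_zero_right]
      linarith [hx.2, le_abs_self R]
    · refine mul_le_mul_right (ENNReal.rpow_le_rpow ?_ hq.le) _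
      exact setLIntegral_le_lintegral _ _
  have hU : ⋃ n, H n = {0}ᶜ := by
    ext x
    simp only [Set.mem_iUnion, Set.mem_compl_iff, Set.mem_singleton_iff]
    refine ⟨fun ⟨n, hn⟩ => norm_pos_iff.1 ((by positivity : (0 : ℝ) < (n + 1 : ℝ)⁻¹).trans_le hn.1),
      fun hx => ?_⟩
    have hx' : 0 < ‖x‖ := norm_pos_iff.2 hx
    obtain ⟨n, hn⟩ := exists_nat_gt (max ‖x‖ ‖x‖⁻¹)
    have hn1 := (le_max_left _ _).trans_lt hn
    have hn2 := (le_max_right _ _).trans_lt hn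
    exact ⟨n, inv_le_of_inv_le₀ hx' (by linarith), by linarith⟩
  have hmono : Monotone H := by
    intro m n hmn x hx
    have : (m : ℝ) ≤ n := by exact_mod_cast hmn
    exact ⟨(inv_anti₀ (by positivity) (by linarith)).trans hx.1, hx.2.trans (by linarith)⟩
  calc ∫⁻ x, ‖gradient (maxFun β f) x‖ₑ ^ ((d : ℝ) / (d - β))
      = ∫⁻ x in ⋃ n, H n, ‖gradient (maxFun β f) x‖ₑ ^ ((d : ℝ) / (d - β)) := by
        rw [hU, Measure.restrict_eq_self_of_ae_mem]
        exact ae_ne_zero hd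
    _ ≤ _ := by
        rw [setLIntegral_iUnion_of_directed _ (hmono.directed_le)]
        exact iSup_le hH

/-- Weak gradients on the whole space coincide with the classical gradient. -/
lemma IsRadialW11.ae_eq_gradient (hd : 1 ≤ d) (hβ0 : 0 < β) (hβd : β < d) (h : IsRadialW11 f g)
    {G : EuclideanSpace ℝ (Fin d) → EuclideanSpace ℝ (Fin d)}
    (hG : HasWeakGradFracMaximalOn Set.univ β f G) :
    G =ᵐ[volume] gradient (maxFun β f) := by
  have h1 := HasWeakGradOn.ae_eq isOpen_compl_singleton (HasWeakGradOn.mono hG (Set.subset_univ _))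
    (h.hasWeakGradOn_gradient hd hβ0 hβd)
  filter_upwards [h1, ae_ne_zero hd] with x hx hx0
  exact hx hx0

/-- Membership in `L^q` with `q ≥ 1` supplies the local integrability of the gradient at the origin
that removability requires. -/
lemma IsRadialW11.exists_weakGrad (hd : 1 ≤ d) (hβ0 : 0 < β) (hβd : β < d)
    (hzero : LocalBoundNearZero 𝕜 d β) (h : IsRadialW11 f g) :
    HasWeakGradFracMaximalOn Set.univ β f (gradient (maxFun β f)) ∧
      MemLp (gradient (maxFun β f)) (ENNReal.ofReal ((d : ℝ) / (d - β))) volume := by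
  obtain ⟨C, hC⟩ := hzero.exists_lintegral_gradient_le hd hβ0 hβd
  have hdβ : 0 < (d : ℝ) - β := by linarith
  have hq1 : 1 ≤ (d : ℝ) / (d - β) := by rw [le_div_iff₀ hdβ]; linarith
  have hq : 0 < (d : ℝ) / (d - β) := by linarith
  have hmem : MemLp (gradient (maxFun β f)) (ENNReal.ofReal ((d : ℝ) / (d - β))) volume := by
    refine ⟨(measurable_gradient _).aestronglyMeasurable, ?_⟩
    rw [eLpNorm_lt_top_iff_lintegral_rpow_enorm_lt_top (by simpa using hq) ENNReal.ofReal_ne_top,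
      ENNReal.toReal_ofReal hq.le]
    refine (hC f g h).trans_lt (ENNReal.mul_lt_top ENNReal.coe_lt_top ?_)
    exact ENNReal.rpow_lt_top_of_nonneg hq.le h.integrable_grad.2.ne
  refine ⟨HasWeakGradOn.of_compl_zero hd (h.hasWeakGradOn_gradient hd hβ0 hβd)
    (h.locallyIntegrable_maxFun hd hβ0 hβd)
    (hmem.locallyIntegrable (by rw [← ENNReal.ofReal_one]; exact ENNReal.ofReal_le_ofReal hq1))
    (maxFun_neg h.radial), hmem⟩

/-- Splitting an integral by a pointwise threshold that holds outside of a given set. -/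
lemma setLIntegral_le_add_of_threshold {α : Type*} [MeasurableSpace α] {μ : Measure α}
    {w K : α → ℝ≥0∞} {A H : Set α} {B : ℝ≥0∞} (hA : MeasurableSet A) (hH : MeasurableSet H)
    (hK : ∀ᵐ x ∂μ, x ∈ A → x ∉ H → w x ≤ K x) (hB : ∫⁻ x in H, w x ∂μ ≤ B) :
    ∫⁻ x in A, w x ∂μ ≤ B + ∫⁻ x in A, K x ∂μ := by
  rw [← lintegral_inter_add_sdiff w A hH]
  refine add_le_add ((lintegral_mono_set Set.inter_subset_right).trans hB) ?_
  refine le_trans ?_ (lintegral_mono_set (Set.sdiff_subset (t := H)))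
  refine lintegral_mono_ae ((ae_restrict_iff' (hA.diff hH)).2 ?_)
  filter_upwards [hK] with x hx hx2
  exact hx hx2.1 hx2.2

/-- The gradient bound at points with a best radius at least `s`, as a function of `s`. -/
noncomputable def gradBound (d : ℕ) (β N s : ℝ) : ℝ :=
  (d - β) * (unitVol d)⁻¹ * s ^ (β - d - 1) * N

/-- Contrapositive of the gradient bound: a large gradient forces every best radius to be small,
which localizes the best balls. -/
lemma IsRadialW11.lt_of_gradBound_lt (hd : 1 ≤ d) (hβ0 : 0 < β) (hβd : β < d)
    (h : IsRadialW11 f g) {x : EuclideanSpace ℝ (Fin d)} (hx : x ≠ 0) {r s : ℝ} (hs : 0 < s)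
    (hlt : gradBound d β (∫ y, ‖f y‖) s < ‖gradient (maxFun β f) x‖)
    (hbest : maxFun β f x = fracAvg β f x r) : r < s := by
  by_contra! hle
  rw [norm_gradient] at hlt
  exact absurd (h.norm_fderiv_maxFun_le_rpow hd hβ0 hβd hx hs hle hbest) (not_le.2 hlt)

lemma enorm_rpow_le {x : EuclideanSpace ℝ (Fin d)} {K q : ℝ} (hq : 0 ≤ q) (h : ‖x‖ ≤ K) :
    ‖x‖ₑ ^ q ≤ ENNReal.ofReal K ^ q := by
  rw [← ofReal_norm]
  exact ENNReal.rpow_le_rpow (ENNReal.ofReal_le_ofReal h) hq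

/-- Smallness of the gradient near the origin. -/
lemma LocalBoundNearZero.exists_lintegral_ball_le (hd : 1 ≤ d) (hβ0 : 0 < β) (hβd : β < d)
    (hzero : LocalBoundNearZero 𝕜 d β) : ∃ C : ℝ≥0, ∀ (f : EuclideanSpace ℝ (Fin d) → 𝕜)
      (g : EuclideanSpace ℝ (Fin d) → EuclideanSpace 𝕜 (Fin d)), IsRadialW11 f g → ∀ ρ a : ℝ,
          0 < ρ → a ≤ ρ / 2 →
      ∫⁻ x in ball 0 a, ‖gradient (maxFun β f) x‖ₑ ^ ((d : ℝ) / (d - β)) ≤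
        C * (∫⁻ x in ball 0 (2 * ρ), ‖g x‖ₑ) ^ ((d : ℝ) / (d - β)) +
        ENNReal.ofReal (gradBound d β (∫ y, ‖f y‖) (ρ / 2)) ^ ((d : ℝ) / (d - β)) *
          volume (ball (0 : EuclideanSpace ℝ (Fin d)) a) := by
  obtain ⟨C, hC⟩ := hzero
  have hq : 0 < (d : ℝ) / (d - β) := div_pos (by linarith) (by linarith)
  refine ⟨C, fun f g h ρ a hρ ha => ?_⟩
  rcases integral_norm_eq_zero_or_pos f with h0 | h0
  · simp [gradient_maxFun_eq_zero h.integrable_fun h0, hq]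
  set K := gradBound d β (∫ y, ‖f y‖) (ρ / 2) with hK
  -- Where the gradient exceeds `K` the best radius is below `ρ / 2`, and `‖x‖ < a ≤ ρ / 2`, so the
  -- best ball lies in `ball 0 ρ`. Elsewhere `K` itself is integrated.
  let H : Set (EuclideanSpace ℝ (Fin d)) := ball 0 a ∩ {0}ᶜ ∩ {x | K < ‖gradient (maxFun β f) x‖}
  have hHm : MeasurableSet H := (measurableSet_ball.inter (measurableSet_singleton _).compl).inter
    (measurableSet_lt measurable_const (measurable_gradient _).norm)
  rw [← setLIntegral_const]
  refine setLIntegral_le_add_of_threshold measurableSet_ball hHm ?_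
    (hC f g _ h (h.hasWeakGradOn_gradient hd hβ0 hβd) ρ H hρ hHm fun x hx => ?_)
  · filter_upwards [ae_ne_zero hd] with x hx0 hxa hxH
    refine enorm_rpow_le hq.le ?_
    by_contra! hlt
    exact hxH ⟨⟨hxa, hx0⟩, hlt⟩
  · have hx0 : x ≠ 0 := hx.1.2
    obtain ⟨r, hr, hbest⟩ := h.exists_best hd hβ0 hβd h0 hx0
    refine ⟨_, h.mem_bestBalls hd hβ0 hβd hx0 hr hbest, ?_⟩
    have h1 := h.lt_of_gradBound_lt hd hβ0 hβd hx0 (half_pos hρ) hx.2 hbest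
    have h2 := hx.1.1
    refine closedBall_subset_ball' ?_
    rw [mem_ball] at h2
    linarith

/-- Smallness of the gradient near infinity. -/
lemma LocalBoundNearInfinity.exists_lintegral_compl_ball_le (hd : 1 ≤ d) (hβ0 : 0 < β)
    (hβd : β < d) (hinfty : LocalBoundNearInfinity 𝕜 d β) : ∃ C : ℝ≥0,
        ∀ (f : EuclideanSpace ℝ (Fin d) → 𝕜)
      (g : EuclideanSpace ℝ (Fin d) → EuclideanSpace 𝕜 (Fin d)), IsRadialW11 f g → ∀ b : ℝ, 0 < b →
      ∫⁻ x in (ball 0 b)ᶜ, ‖gradient (maxFun β f) x‖ₑ ^ ((d : ℝ) / (d - β)) ≤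
        C * (∫⁻ x in (ball 0 (b / 4))ᶜ, ‖g x‖ₑ) ^ ((d : ℝ) / (d - β)) +
        ∫⁻ x in (ball (0 : EuclideanSpace ℝ (Fin d)) b)ᶜ,
          ENNReal.ofReal (gradBound d β (∫ y, ‖f y‖) (‖x‖ / 2)) ^ ((d : ℝ) / (d - β)) := by
  obtain ⟨C, hC⟩ := hinfty
  have hq : 0 < (d : ℝ) / (d - β) := div_pos (by linarith) (by linarith)
  refine ⟨C, fun f g h b hb => ?_⟩
  rcases integral_norm_eq_zero_or_pos f with h0 | h0
  · simp [gradient_maxFun_eq_zero h.integrable_fun h0, hq]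
  -- Here the threshold varies with `x`: beyond it the best radius is below `‖x‖ / 2`, so the best
  -- ball avoids `ball 0 (b / 2)`. The second local bound with `ρ = b / 2` then produces `b / 4`.
  let H : Set (EuclideanSpace ℝ (Fin d)) := (ball 0 b)ᶜ ∩
    {x | gradBound d β (∫ y, ‖f y‖) (‖x‖ / 2) < ‖gradient (maxFun β f) x‖}
  have hHm : MeasurableSet H := by
    refine measurableSet_ball.compl.inter
      (measurableSet_lt ?_ (measurable_gradient _).norm)
    exact ((((measurable_norm.div_const 2).pow_const (β - d - 1)).const_mul
      ((d - β) * (unitVol d)⁻¹)).mul_const _)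
  rw [show b / 4 = b / 2 / 2 by ring]
  refine setLIntegral_le_add_of_threshold measurableSet_ball.compl hHm ?_
    (hC f g _ h (h.hasWeakGradOn_gradient hd hβ0 hβd) (b / 2) H (half_pos hb) hHm fun x hx => ?_)
  · refine Filter.Eventually.of_forall fun x hxa hxH => ?_
    refine enorm_rpow_le hq.le ?_
    by_contra! hlt
    exact hxH ⟨hxa, hlt⟩
  · have hxb : b ≤ ‖x‖ := by simpa using hx.1
    have hxpos : 0 < ‖x‖ := hb.trans_le hxb
    have hx0 : x ≠ 0 := norm_pos_iff.1 hxpos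
    obtain ⟨r, hr, hbest⟩ := h.exists_best hd hβ0 hβd h0 hx0
    refine ⟨_, h.mem_bestBalls hd hβ0 hβd hx0 hr hbest, fun y hy => ?_⟩
    have h1 := h.lt_of_gradBound_lt hd hβ0 hβd hx0 (half_pos hxpos) hx.2 hbest
    rw [Set.mem_compl_iff, mem_ball_zero_iff, not_lt]
    rw [mem_closedBall, dist_eq_norm] at hy
    have h2 : ‖x‖ ≤ ‖y‖ + ‖y - x‖ := by
      have := norm_sub_le y (y - x)
      rwa [sub_sub_cancel] at this
    linarith

end Bounds

/-! ### Pointwise convergence of the gradients. -/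

section Convergence

variable {d : ℕ} {𝕜 : Type*} [RCLike 𝕜] {β : ℝ}

lemma abs_setIntegral_sub_setIntegral_le {α : Type*} [MeasurableSpace α] {μ : Measure α}
    {φ : α → ℝ} (hφ : Integrable φ μ) {A B S : Set α} (hA : MeasurableSet A)
    (hB : MeasurableSet B) (hS : A \ B ∪ B \ A ⊆ S) :
    |(∫ x in A, φ x ∂μ) - ∫ x in B, φ x ∂μ| ≤ ∫ x in S, |φ x| ∂μ := by
  have h1 := integral_inter_add_sdiff (s := A) hB hφ.integrableOn
  have h2 := integral_inter_add_sdiff (s := B) hA hφ.integrableOn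
  rw [Set.inter_comm] at h2
  have h3 : (∫ x in A, φ x ∂μ) - ∫ x in B, φ x ∂μ =
      (∫ x in A \ B, φ x ∂μ) - ∫ x in B \ A, φ x ∂μ := by linarith
  have h4 : ∫ x in A \ B ∪ B \ A, |φ x| ∂μ =
      (∫ x in A \ B, |φ x| ∂μ) + ∫ x in B \ A, |φ x| ∂μ :=
    setIntegral_union (Set.disjoint_left.2 fun x hx hx' => hx.2 hx'.1) (hB.diff hA)
      hφ.abs.integrableOn hφ.abs.integrableOn
  have h5 : ∫ x in A \ B ∪ B \ A, |φ x| ∂μ ≤ ∫ x in S, |φ x| ∂μ :=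
    setIntegral_mono_set hφ.abs.integrableOn
      (Filter.Eventually.of_forall fun _ => abs_nonneg _) hS.eventuallyLE
  rw [h3]
  refine (abs_sub _ _).trans ?_
  have h6 : ∀ T : Set α, |∫ x in T, φ x ∂μ| ≤ ∫ x in T, |φ x| ∂μ := fun T =>
    abs_integral_le_integral_abs
  linarith [h6 (A \ B), h6 (B \ A)]

/-- The spherical shell of width `3t` around the sphere of radius `r` centered at `x`. -/
def shell (x : EuclideanSpace ℝ (Fin d)) (r t : ℝ) : Set (EuclideanSpace ℝ (Fin d)) :=
  ball x (r + 3 * t) \ ball x (r - 3 * t)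

/-- If two balls of radius `r` have centres within `t` of `x`, their symmetric difference lies
within `t` of the sphere of radius `r` about `x`. A further `2 * t`, half for translating and half
for mollifying, accounts for the `3 * t` in the shell. -/
lemma mem_shell_of_mem_sdiff {x y y' z z' : EuclideanSpace ℝ (Fin d)} {r t : ℝ} (hy : dist y x ≤ t)
    (hy' : dist y' x ≤ t) (hz : z ∈ ball y r \ ball y' r) (hzz : dist z' z < 2 * t) :
    z' ∈ shell x r t := by
  have h1 : dist z y < r := hz.1
  have h2 : r ≤ dist z y' := not_lt.1 hz.2
  have h3 := dist_triangle z' z x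
  have h4 := dist_triangle z y x
  have h5 := dist_triangle z z' x
  have h6 := dist_triangle z x y'
  rw [dist_comm z z'] at h5
  rw [dist_comm x y'] at h6
  refine ⟨mem_ball.2 (by linarith), fun h => ?_⟩
  have := mem_ball.1 h
  linarith

variable {f : EuclideanSpace ℝ (Fin d) → 𝕜}
    {g : EuclideanSpace ℝ (Fin d) → EuclideanSpace 𝕜 (Fin d)}

lemma ballMass_add_sub (hf : Integrable f) (y w : EuclideanSpace ℝ (Fin d)) (r : ℝ) :
    ballMass f (y + w) r - ballMass f y r = ∫ z in ball y r, (‖f (z + w)‖ - ‖f z‖) := by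
  have h1 : ballMass f (y + w) r = ∫ z in ball y r, ‖f (z + w)‖ := by
    rw [ballMass, ← (measurePreserving_add_right volume w).setIntegral_preimage_emb
      (MeasurableEquiv.addRight w).measurableEmbedding (fun z => ‖f z‖)]
    congr 2
    ext z
    simp [dist_eq_norm]
  rw [h1, ballMass, ← integral_sub (hf.comp_add_right w).norm.integrableOn hf.norm.integrableOn]

/-- First differences of ball integrals vary little under translations of the center. -/
lemma IsRadialW11.abs_ballMass_diff_le (h : IsRadialW11 f g) {x y y' w : EuclideanSpace ℝ (Fin d)}
    {r t : ℝ}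
    (ht : 0 < t) (hy : dist y x ≤ t) (hy' : dist y' x ≤ t) (hw : ‖w‖ ≤ t) :
    |(ballMass f (y + w) r - ballMass f y r) - (ballMass f (y' + w) r - ballMass f y' r)| ≤
      ‖w‖ * ∫ z in shell x r t, ‖g z‖ := by
  have hf := h.integrable_fun
  have hfw : Integrable fun z => f (z + w) := hf.comp_add_right w
  have hsub : Integrable fun z => f (z + w) - f z := hfw.sub hf
  rw [ballMass_add_sub hf, ballMass_add_sub hf]
  refine (abs_setIntegral_sub_setIntegral_le (hfw.norm.sub hf.norm) measurableSet_ball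
    measurableSet_ball subset_rfl).trans ?_
  set A := ball y r \ ball y' r ∪ ball y' r \ ball y r with hAdef
  have hA : MeasurableSet A := (measurableSet_ball.diff measurableSet_ball).union
    (measurableSet_ball.diff measurableSet_ball)
  have h1 : ∫ z in A, |‖f (z + w)‖ - ‖f z‖| ≤ ∫ z in A, ‖f (z + w) - f z‖ :=
    setIntegral_mono_on (hfw.norm.sub hf.norm).abs.integrableOn hsub.norm.integrableOn hA
      fun z _ => abs_norm_sub_norm_le _ _
  refine h1.trans ?_
  have h2 := h.hasWeakGradOn.lintegral_enorm_translate_sub_le hf h.integrable_grad hA w ht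
    (A' := shell x r t) (fun z hz s hs z' hz' => by
      have h3 : dist (z + s • w) z ≤ t := by
        rw [dist_eq_norm, add_sub_cancel_left, norm_smul, Real.norm_of_nonneg hs.1.le]
        exact (mul_le_of_le_one_left (norm_nonneg _) hs.2).trans hw
      have h4 : dist z' z < 2 * t := by
        have := dist_triangle z' (z + s • w) z
        have := mem_ball.1 hz'
        linarith
      rcases hz with hz | hz
      · exact mem_shell_of_mem_sdiff hy hy' hz h4
      · exact mem_shell_of_mem_sdiff hy' hy hz h4)
  rw [← ofReal_integral_norm_eq_lintegral_enorm h.integrable_grad.integrableOn,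
    ← ofReal_integral_norm_eq_lintegral_enorm hsub.integrableOn, ← ofReal_norm,
    ← ENNReal.ofReal_mul (norm_nonneg _), ENNReal.ofReal_le_ofReal_iff] at h2
  · exact h2
  · exact mul_nonneg (norm_nonneg _) (integral_nonneg fun _ => norm_nonneg _)

/-- Cut `v` into `N` steps `w`. Each increment differs from the backward increment at `x` by at most
`‖w‖` times the shell integral, and the sum telescopes. The error depends only on `N * ‖w‖ = ‖v‖`,
so it survives the limit `N → ∞`. -/
lemma IsRadialW11.ballMass_add_ge (h : IsRadialW11 f g) {x v : EuclideanSpace ℝ (Fin d)} {r t : ℝ}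
    (ht : 0 < t)
    (hv : ‖v‖ ≤ t) {N : ℕ} (hN : 0 < N) :
    N * (ballMass f x r - ballMass f (x - (N : ℝ)⁻¹ • v) r) - t * ∫ z in shell x r t, ‖g z‖ ≤
      ballMass f (x + v) r - ballMass f x r := by
  have hN' : (0 : ℝ) < N := by exact_mod_cast hN
  have hN1 : (1 : ℝ) ≤ N := by exact_mod_cast hN
  set w := (N : ℝ)⁻¹ • v with hw
  have hwn : N * ‖w‖ = ‖v‖ := by
    rw [hw, norm_smul, norm_inv, Real.norm_of_nonneg hN'.le, mul_inv_cancel_left₀ hN'.ne']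
  have hwt : ‖w‖ ≤ t := by nlinarith [norm_nonneg w]
  have hQ : 0 ≤ ∫ z in shell x r t, ‖g z‖ := integral_nonneg fun _ => norm_nonneg _
  have hstep : ∀ k ∈ Finset.range N, ballMass f x r - ballMass f (x - w) r -
      ‖w‖ * ∫ z in shell x r t, ‖g z‖ ≤
      ballMass f (x + (k + 1 : ℕ) • w) r - ballMass f (x + k • w) r := by
    intro k hk
    have h1 : dist (x + k • w) x ≤ t := by
      rw [dist_eq_norm, add_sub_cancel_left, ← Nat.cast_smul_eq_nsmul ℝ, norm_smul,
        Real.norm_of_nonneg k.cast_nonneg]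
      have : (k : ℝ) ≤ N := by exact_mod_cast (Finset.mem_range.1 hk).le
      nlinarith [norm_nonneg w]
    have h2 : dist (x - w) x ≤ t := by
      rw [dist_eq_norm]; simpa using hwt
    have h3 := h.abs_ballMass_diff_le (r := r) ht h1 h2 hwt
    rw [sub_add_cancel, add_assoc, ← succ_nsmul] at h3
    linarith [(abs_le.1 h3).1]
  have hsum := Finset.sum_le_sum hstep
  rw [Finset.sum_range_sub (fun k : ℕ => ballMass f (x + k • w) r), Finset.sum_const,
    Finset.card_range, nsmul_eq_mul, zero_smul, add_zero] at hsum
  have h4 : N • w = v := by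
    rw [← Nat.cast_smul_eq_nsmul ℝ, hw, smul_inv_smul₀ hN'.ne']
  rw [h4] at hsum
  have h5 : N * (ballMass f x r - ballMass f (x - w) r - ‖w‖ * ∫ z in shell x r t, ‖g z‖) =
      N * (ballMass f x r - ballMass f (x - w) r) - ‖v‖ * ∫ z in shell x r t, ‖g z‖ := by
    rw [← hwn]; ring
  have h6 := mul_le_mul_of_nonneg_right hv hQ
  linarith

/-- A one-sided differentiability estimate for the maximal function with an explicit error. -/
lemma IsRadialW11.fderiv_maxFun_le (hd : 1 ≤ d) (hβ0 : 0 < β) (hβd : β < d)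
    (h : IsRadialW11 f g) {x v : EuclideanSpace ℝ (Fin d)} (hx : x ≠ 0) (hxv : x + v ≠ 0) {r t : ℝ}
    (hr : 0 < r)
    (ht : 0 < t) (hv : ‖v‖ ≤ t) (hbest : maxFun β f x = fracAvg β f x r)
    (hdiff : DifferentiableAt ℝ (maxFun β f) x) :
    fderiv ℝ (maxFun β f) x v ≤ maxFun β f (x + v) - maxFun β f x +
      (unitVol d)⁻¹ * r ^ (β - d) * (t * ∫ z in shell x r t, ‖g z‖) := by
  have hc : 0 ≤ (unitVol d)⁻¹ * r ^ (β - d) :=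
    mul_nonneg (inv_nonneg.2 unitVol_pos.le) (Real.rpow_nonneg hr.le _)
  -- The negative scalars give backward difference quotients. Fixing the radius `r` at `x - v/N`
  -- bounds `M f` there from below, hence these quotients from above; the same radius at `x + v`
  -- bounds the forward increment from below.
  have hlim := hdiff.hasFDerivAt.lim v (c := fun N : ℕ => -(N : ℝ)) (l := Filter.atTop) (by
    simpa using tendsto_natCast_atTop_atTop (R := ℝ))
  refine le_of_tendsto hlim ?_
  have hx1 : Filter.Tendsto (fun N : ℕ => x - (N : ℝ)⁻¹ • v) Filter.atTop (nhds x) := by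
    have := (tendsto_inv_atTop_zero.comp
      (tendsto_natCast_atTop_atTop (R := ℝ))).smul_const v |>.const_sub x
    simpa using this
  filter_upwards [hx1.eventually (isOpen_ne.mem_nhds hx), Filter.eventually_gt_atTop 0]
    with N hN hN0
  have h1 := mul_le_mul_of_nonneg_left (h.ballMass_add_ge (x := x) (r := r) ht hv hN0) hc
  have h2 : fracAvg β f (x + v) r ≤ _ := h.fracAvg_le_maxFun hd hβ0 hβd hxv hr
  have h3 : fracAvg β f (x - (N : ℝ)⁻¹ • v) r ≤ _ := h.fracAvg_le_maxFun hd hβ0 hβd hN hr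
  have h4 : x + (-(N : ℝ))⁻¹ • v = x - (N : ℝ)⁻¹ • v := by
    rw [inv_neg, neg_smul, sub_eq_add_neg]
  have h5 := mul_le_mul_of_nonneg_left h3 (show (0 : ℝ) ≤ N from N.cast_nonneg)
  rw [h4, smul_eq_mul, hbest]
  have h6 : (unitVol d)⁻¹ * r ^ (β - d) * (N * (ballMass f x r -
      ballMass f (x - (N : ℝ)⁻¹ • v) r) - t * ∫ z in shell x r t, ‖g z‖) =
      N * fracAvg β f x r - N * fracAvg β f (x - (N : ℝ)⁻¹ • v) r -
      (unitVol d)⁻¹ * r ^ (β - d) * (t * ∫ z in shell x r t, ‖g z‖) := by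
    simp only [fracAvg]; ring
  have h7 : (unitVol d)⁻¹ * r ^ (β - d) * (ballMass f (x + v) r - ballMass f x r) =
      fracAvg β f (x + v) r - fracAvg β f x r := by
    simp only [fracAvg]; ring
  rw [h6, h7] at h1
  linarith

lemma setIntegral_shell_eq {F : Type*} [NormedAddCommGroup F] {g : EuclideanSpace ℝ (Fin d) → F}
    (hg : Integrable g)
    (x : EuclideanSpace ℝ (Fin d)) (r : ℝ) {t : ℝ} (ht : 0 < t) :
    ∫ z in shell x r t, ‖g z‖ = ballMass g x (r + 3 * t) - ballMass g x (r - 3 * t) := by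
  have h1 := integral_inter_add_sdiff (s := ball x (r + 3 * t)) (t := ball x (r - 3 * t))
    (μ := volume) (f := fun z => ‖g z‖) measurableSet_ball hg.norm.integrableOn
  rw [Set.inter_eq_self_of_subset_right (ball_subset_ball (by linarith))] at h1
  rw [ballMass, ballMass, shell]
  linarith

/-- A shell integral is a difference of ball masses, and the mass is uniformly continuous in the
radius on compact intervals; this is where two-sided bounds on best radii are needed. -/
lemma eventually_setIntegral_shell_lt {F : Type*} [NormedAddCommGroup F]
    {g : EuclideanSpace ℝ (Fin d) → F}
    (hg : Integrable g) (x : EuclideanSpace ℝ (Fin d)) {r₀ R ε : ℝ} (hr₀ : 0 < r₀) (hε : 0 < ε) :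
    ∃ t₀ > 0, ∀ t, 0 < t → t < t₀ → ∀ r, r₀ ≤ r → r ≤ R → ∫ z in shell x r t, ‖g z‖ < ε := by
  have hc : ContinuousOn (fun r => ballMass g x r) (Set.Icc (r₀ / 2) (R + 1)) := fun r hr =>
    (continuousAt_ballMass_radius hg x (by linarith [hr.1] : 0 < r).ne').continuousWithinAt
  have hu := isCompact_Icc.uniformContinuousOn_of_continuous hc
  obtain ⟨δ, hδ, H⟩ := Metric.uniformContinuousOn_iff.1 hu ε hε
  -- The two radii differ by `6 * t < δ`, and both `r - 3 * t` and `r + 3 * t` stay in `[r₀ / 2, R +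
  -- 1]`.
  refine ⟨min (δ / 6) (min (r₀ / 6) (1 / 3)), by positivity, fun t ht ht' r hr1 hr2 => ?_⟩
  have h1 := ht'.trans_le (min_le_left _ _)
  have h2 := (ht'.trans_le (min_le_right _ _)).trans_le (min_le_left _ _)
  have h3 := (ht'.trans_le (min_le_right _ _)).trans_le (min_le_right _ _)
  have h4 := H (r + 3 * t) ⟨by linarith, by linarith⟩ (r - 3 * t) ⟨by linarith, by linarith⟩ (by
    rw [Real.dist_eq, abs_of_pos (by linarith)]; linarith)
  rw [setIntegral_shell_eq hg x r ht]
  exact (le_abs_self _).trans_lt h4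

lemma setIntegral_norm_le_add {F : Type*} [NormedAddCommGroup F]
    {u v : EuclideanSpace ℝ (Fin d) → F}
    (hu : Integrable u) (hv : Integrable v) (S : Set (EuclideanSpace ℝ (Fin d))) :
    ∫ z in S, ‖u z‖ ≤ (∫ z in S, ‖v z‖) + ∫ z, ‖u z - v z‖ := by
  have huv : Integrable fun z => ‖u z - v z‖ := (hu.sub hv).norm
  have h1 : ∫ z in S, ‖u z‖ ≤ ∫ z in S, (‖v z‖ + ‖u z - v z‖) := by
    refine integral_mono hu.norm.integrableOn (hv.norm.add huv).integrableOn
      fun z => ?_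
    have := norm_add_le (v z) (u z - v z)
    rwa [add_sub_cancel] at this
  rw [integral_add hv.norm.integrableOn huv.integrableOn] at h1
  have h2 : ∫ z in S, ‖u z - v z‖ ≤ ∫ z, ‖u z - v z‖ :=
    setIntegral_le_integral huv (Filter.Eventually.of_forall fun _ => norm_nonneg _)
  linarith

/-- Test the maximal function of `f'` with the best radius of `f`; a lower bound on that radius
bounds the normalizing factor. -/
lemma IsRadialW11.maxFun_le_add (hd : 1 ≤ d) (hβ0 : 0 < β) (hβd : β < d)
    {f' : EuclideanSpace ℝ (Fin d) → 𝕜} {g' : EuclideanSpace ℝ (Fin d) → EuclideanSpace 𝕜 (Fin d)}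
    (h : IsRadialW11 f g)
    (h' : IsRadialW11 f' g') {x : EuclideanSpace ℝ (Fin d)} (hx : x ≠ 0) {r r₀ : ℝ} (hr₀ : 0 < r₀)
    (hr : r₀ ≤ r)
    (hbest : maxFun β f x = fracAvg β f x r) :
    maxFun β f x ≤ maxFun β f' x + (unitVol d)⁻¹ * r₀ ^ (β - d) * ∫ z, ‖f z - f' z‖ := by
  have hr' : 0 < r := hr₀.trans_le hr
  have h1 := h'.fracAvg_le_maxFun hd hβ0 hβd hx hr'
  have h2 := setIntegral_norm_le_add h.integrable_fun h'.integrable_fun (ball x r)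
  have hI : 0 ≤ ∫ z, ‖f z - f' z‖ := integral_nonneg fun _ => norm_nonneg _
  have hκ := unitVol_pos (d := d)
  have h3 : r ^ (β - d) ≤ r₀ ^ (β - d) := Real.rpow_le_rpow_of_nonpos hr₀ hr (by linarith)
  have hc : 0 ≤ (unitVol d)⁻¹ * r ^ (β - d) :=
    mul_nonneg (inv_nonneg.2 hκ.le) (Real.rpow_nonneg hr'.le _)
  have h4 := mul_le_mul_of_nonneg_left h2 hc
  have h5 := mul_le_mul_of_nonneg_right (mul_le_mul_of_nonneg_left h3 (inv_nonneg.2 hκ.le)) hI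
  rw [hbest]
  rw [fracAvg, ballMass] at h1 ⊢
  rw [mul_add] at h4
  linarith

/-- Convergence of radial functions in `W^{1,1}`. -/
structure RadialW11Tendsto (f : EuclideanSpace ℝ (Fin d) → 𝕜)
    (g : EuclideanSpace ℝ (Fin d) → EuclideanSpace 𝕜 (Fin d)) (F : ℕ → EuclideanSpace ℝ (Fin d) → 𝕜)
    (G : ℕ → EuclideanSpace ℝ (Fin d) → EuclideanSpace 𝕜 (Fin d)) : Prop where
  limit : IsRadialW11 f g
  seq : ∀ n, IsRadialW11 (F n) (G n)
  tendsto_fun : Filter.Tendsto (fun n => ∫ z, ‖F n z - f z‖) Filter.atTop (nhds 0)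
  tendsto_grad : Filter.Tendsto (fun n => ∫ z, ‖G n z - g z‖) Filter.atTop (nhds 0)

variable {F : ℕ → EuclideanSpace ℝ (Fin d) → 𝕜}
    {G : ℕ → EuclideanSpace ℝ (Fin d) → EuclideanSpace 𝕜 (Fin d)}

lemma RadialW11Tendsto.exists_bound (H : RadialW11Tendsto f g F G) :
    ∃ N, ∫ z, ‖f z‖ ≤ N ∧ ∫ z, ‖g z‖ ≤ N ∧ ∀ n, ∫ z, ‖F n z‖ ≤ N ∧ ∫ z, ‖G n z‖ ≤ N := by
  obtain ⟨K₁, h₁⟩ := H.tendsto_fun.bddAbove_range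
  obtain ⟨K₂, h₂⟩ := H.tendsto_grad.bddAbove_range
  have h1 : ∀ n, ∫ z, ‖F n z - f z‖ ≤ K₁ := fun n => h₁ ⟨n, rfl⟩
  have h2 : ∀ n, ∫ z, ‖G n z - g z‖ ≤ K₂ := fun n => h₂ ⟨n, rfl⟩
  have hK1 : 0 ≤ K₁ := (integral_nonneg fun _ => norm_nonneg _).trans (h1 0)
  have hK2 : 0 ≤ K₂ := (integral_nonneg fun _ => norm_nonneg _).trans (h2 0)
  have hf0 : 0 ≤ ∫ z, ‖f z‖ := integral_nonneg fun _ => norm_nonneg _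
  have hg0 : 0 ≤ ∫ z, ‖g z‖ := integral_nonneg fun _ => norm_nonneg _
  refine ⟨(∫ z, ‖f z‖) + (∫ z, ‖g z‖) + K₁ + K₂, by linarith, by linarith, fun n => ⟨?_, ?_⟩⟩
  · have h3 := setIntegral_norm_le_add (H.seq n).integrable_fun H.limit.integrable_fun Set.univ
    simp only [Measure.restrict_univ] at h3
    linarith [h1 n]
  · have h3 := setIntegral_norm_le_add (H.seq n).integrable_grad H.limit.integrable_grad Set.univ
    simp only [Measure.restrict_univ] at h3
    linarith [h2 n]

/-- Along a convergent sequence the best radii on an annulus are eventually uniformly bounded. -/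
lemma RadialW11Tendsto.exists_best_radius_bounds (hd : 1 ≤ d) (hβ0 : 0 < β) (hβd : β < d)
    (H : RadialW11Tendsto f g F G) (h0 : 0 < ∫ z, ‖f z‖) {a b : ℝ} (ha : 0 < a) (hb : 0 < b) :
    ∃ r₀ R : ℝ, 0 < r₀ ∧
      (∀ x, a ≤ ‖x‖ → ‖x‖ ≤ b → ∃ r, maxFun β f x = fracAvg β f x r ∧ r₀ ≤ r ∧ r ≤ R) ∧
      ∀ᶠ n in Filter.atTop, ∀ x, a ≤ ‖x‖ → ‖x‖ ≤ b →
        ∃ r, maxFun β (F n) x = fracAvg β (F n) x r ∧ r₀ ≤ r ∧ r ≤ R := by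
  obtain ⟨N, hN1, hN2, hN⟩ := H.exists_bound
  obtain ⟨ρ, hρ, hm⟩ := exists_ballMass_pos H.limit.integrable_fun h0
  -- Half of the mass of `f` in `ball 0 ρ` is kept by every `F n` within the other half in `L¹`, so
  -- the same radii work for `f` and for the tail of the sequence.
  obtain ⟨r₀, R, hr₀, hb⟩ := _root_.exists_best_radius_bounds 𝕜 hd hβ0 hβd N ha hb
    (half_pos hm) hρ
  refine ⟨r₀, R, hr₀, fun x hxa hxb => ?_, ?_⟩
  · obtain ⟨r, hr, hbest⟩ := H.limit.exists_best hd hβ0 hβd h0 (norm_pos_iff.1 (ha.trans_le hxa))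
    exact ⟨r, hbest, hb f g H.limit hN1 hN2 (by linarith) x hxa hxb r hr hbest⟩
  · filter_upwards [H.tendsto_fun.eventually (gt_mem_nhds (half_pos hm))] with n hn x hxa hxb
    have hsub : ∫ z, ‖f z - F n z‖ = ∫ z, ‖F n z - f z‖ := by
      simp only [norm_sub_rev]
    have h1 : ballMass f 0 ρ / 2 ≤ ballMass (F n) 0 ρ := by
      have h2 := setIntegral_norm_le_add H.limit.integrable_fun (H.seq n).integrable_fun (ball 0 ρ)
      change ballMass f 0 ρ ≤ ballMass (F n) 0 ρ + _ at h2
      linarith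
    have h2 : 0 < ∫ z, ‖F n z‖ :=
      (half_pos hm).trans_le (h1.trans (ballMass_le (H.seq n).integrable_fun 0 ρ))
    obtain ⟨r, hr, hbest⟩ := (H.seq n).exists_best hd hβ0 hβd h2
      (norm_pos_iff.1 (ha.trans_le hxa))
    exact ⟨r, hbest, hb (F n) (G n) (H.seq n) (hN n).1 (hN n).2 h1 x hxa hxb r hr hbest⟩

lemma RadialW11Tendsto.tendsto_maxFun (hd : 1 ≤ d) (hβ0 : 0 < β) (hβd : β < d)
    (H : RadialW11Tendsto f g F G) (h0 : 0 < ∫ z, ‖f z‖) {x : EuclideanSpace ℝ (Fin d)}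
    (hx : x ≠ 0) :
    Filter.Tendsto (fun n => maxFun β (F n) x) Filter.atTop (nhds (maxFun β f x)) := by
  have hx' := norm_pos_iff.2 hx
  obtain ⟨r₀, R, hr₀, h1, h2⟩ := H.exists_best_radius_bounds hd hβ0 hβd h0 hx' hx'
  obtain ⟨r, hbest, hr, -⟩ := h1 x le_rfl le_rfl
  rw [tendsto_iff_dist_tendsto_zero]
  have hlim := H.tendsto_fun.const_mul ((unitVol d)⁻¹ * r₀ ^ (β - d))
  rw [mul_zero] at hlim
  refine squeeze_zero' (Filter.Eventually.of_forall fun _ => dist_nonneg) ?_ hlim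
  filter_upwards [h2] with n hn
  obtain ⟨s, hsbest, hs, -⟩ := hn x le_rfl le_rfl
  have h3 := H.limit.maxFun_le_add hd hβ0 hβd (H.seq n) hx hr₀ hr hbest
  have h4 := (H.seq n).maxFun_le_add hd hβ0 hβd H.limit hx hr₀ hs hsbest
  have hsub : ∫ z, ‖f z - F n z‖ = ∫ z, ‖F n z - f z‖ := by
    simp only [norm_sub_rev]
  rw [hsub] at h3
  rw [Real.dist_eq, abs_le]
  constructor <;> linarith

/-- First fix a step `τ` so small that the difference quotient of `M f` is within `ε / 4` of the
derivative and the shell of scale `τ * V` is thin; only then let `n` grow. The convergence of the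
values at `x` and `x + τ • v` and the shell error then cost `τ * ε / 4` each. -/
lemma RadialW11Tendsto.eventually_fderiv_le (hd : 1 ≤ d) (hβ0 : 0 < β) (hβd : β < d)
    (H : RadialW11Tendsto f g F G) (h0 : 0 < ∫ z, ‖f z‖) {x : EuclideanSpace ℝ (Fin d)} (hx : x ≠ 0)
    (hdiff : DifferentiableAt ℝ (maxFun β f) x)
    (hdiffs : ∀ n, DifferentiableAt ℝ (maxFun β (F n)) x) (v : EuclideanSpace ℝ (Fin d)) {ε : ℝ}
    (hε : 0 < ε) :
    ∀ᶠ n in Filter.atTop, fderiv ℝ (maxFun β (F n)) x v ≤ fderiv ℝ (maxFun β f) x v + ε := by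
  have hx' := norm_pos_iff.2 hx
  have hκ := unitVol_pos (d := d)
  obtain ⟨r₀, R, hr₀, -, hrad⟩ := H.exists_best_radius_bounds (β := β) hd hβ0 hβd h0 hx' hx'
  set c := (unitVol d)⁻¹ * r₀ ^ (β - d) with hc
  have hc0 : 0 < c := by positivity
  -- Adding 1 keeps the shell scale `τ * V` positive when `v = 0`.
  set V := ‖v‖ + 1 with hV
  have hV0 : 0 < V := by positivity
  -- The shell integral of `g` and the `L¹` error of `G n` are each below `ε / (8 c V)`; multiplied
  -- by `c * τ * V`, their sum yields `τ * ε / 4`.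
  obtain ⟨t₀, ht₀, hshell⟩ := eventually_setIntegral_shell_lt H.limit.integrable_grad x (R := R)
    hr₀ (show 0 < ε / (8 * (c * V)) by positivity)
  have hslope : ∀ᶠ τ in nhdsWithin (0 : ℝ) (Set.Ioi 0),
      τ⁻¹ * (maxFun β f (x + τ • v) - maxFun β f x) < fderiv ℝ (maxFun β f) x v + ε / 4 := by
    have h1 : HasDerivAt (fun t : ℝ => maxFun β f (x + t • v)) (fderiv ℝ (maxFun β f) x v) 0 := by
      have h2 : HasDerivAt (fun t : ℝ => x + t • v) v 0 := by
        simpa using ((hasDerivAt_id (0 : ℝ)).smul_const v).const_add x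
      exact HasFDerivAt.comp_hasDerivAt (x := (0 : ℝ)) (f := fun t : ℝ => x + t • v)
        (by simpa using hdiff.hasFDerivAt) h2
    have h3 := h1.tendsto_slope_zero_right
    simp only [zero_add, zero_smul, add_zero, smul_eq_mul] at h3
    exact h3.eventually (gt_mem_nhds (by linarith))
  have hne : ∀ᶠ τ in nhdsWithin (0 : ℝ) (Set.Ioi 0), x + τ • v ≠ 0 := by
    have h3 : Filter.Tendsto (fun t : ℝ => x + t • v) (nhds 0) (nhds x) := by
      have : Continuous (fun t : ℝ => x + t • v) := by fun_prop
      simpa using this.tendsto 0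
    exact (h3.mono_left nhdsWithin_le_nhds).eventually (isOpen_ne.mem_nhds hx)
  have hsmall : ∀ᶠ τ in nhdsWithin (0 : ℝ) (Set.Ioi 0), τ < t₀ / V :=
    nhdsWithin_le_nhds (gt_mem_nhds (by positivity))
  obtain ⟨τ, ⟨⟨hτ1, hτ2⟩, hτ3⟩, hτ0⟩ :=
    (((hslope.and hne).and hsmall).and self_mem_nhdsWithin).exists
  have hτ0' : 0 < τ := hτ0
  have hτt : τ * V < t₀ := by rwa [lt_div_iff₀ hV0] at hτ3
  have hτv : ‖τ • v‖ ≤ τ * V := by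
    rw [norm_smul, Real.norm_of_nonneg hτ0'.le]
    exact mul_le_mul_of_nonneg_left (by linarith) hτ0'.le
  have hlim : Filter.Tendsto (fun n => maxFun β (F n) (x + τ • v) - maxFun β (F n) x)
      Filter.atTop (nhds (maxFun β f (x + τ • v) - maxFun β f x)) :=
    (H.tendsto_maxFun hd hβ0 hβd h0 hτ2).sub (H.tendsto_maxFun hd hβ0 hβd h0 hx)
  have hlt : maxFun β f (x + τ • v) - maxFun β f x <
      maxFun β f (x + τ • v) - maxFun β f x + τ * (ε / 4) := lt_add_of_pos_right _ (by positivity)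
  filter_upwards [hrad, hlim.eventually (gt_mem_nhds hlt),
    H.tendsto_grad.eventually (gt_mem_nhds (show 0 < ε / (8 * (c * V)) by positivity))]
    with n hn1 hn2 hn3
  obtain ⟨r, hbest, hr1, hr2⟩ := hn1 x le_rfl le_rfl
  have hr : 0 < r := hr₀.trans_le hr1
  have hτV : 0 < τ * V := by positivity
  have h1 := (H.seq n).fderiv_maxFun_le hd hβ0 hβd hx hτ2 hr hτV hτv hbest (hdiffs n)
  have h2 := setIntegral_norm_le_add (H.seq n).integrable_grad H.limit.integrable_grad
    (shell x r (τ * V))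
  have h3 := hshell _ hτV hτt r hr1 hr2
  have hcr : (unitVol d)⁻¹ * r ^ (β - d) ≤ c :=
    mul_le_mul_of_nonneg_left (Real.rpow_le_rpow_of_nonpos hr₀ hr1 (by linarith))
      (inv_nonneg.2 hκ.le)
  have hQ : 0 ≤ ∫ z in shell x r (τ * V), ‖G n z‖ := integral_nonneg fun _ => norm_nonneg _
  have hQ2 : ∫ z in shell x r (τ * V), ‖G n z‖ ≤ ε / (4 * (c * V)) := by
    have : ε / (4 * (c * V)) = ε / (8 * (c * V)) + ε / (8 * (c * V)) := by
      field_simp; norm_num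
    linarith
  have h4 : (unitVol d)⁻¹ * r ^ (β - d) * (τ * V * ∫ z in shell x r (τ * V), ‖G n z‖) ≤
      c * (τ * V * (ε / (4 * (c * V)))) := by
    refine mul_le_mul hcr (mul_le_mul_of_nonneg_left hQ2 hτV.le)
      (mul_nonneg hτV.le hQ) hc0.le
  have h5 : c * (τ * V * (ε / (4 * (c * V)))) = τ * (ε / 4) := by field_simp
  rw [h5] at h4
  rw [inv_mul_eq_div, div_lt_iff₀ hτ0'] at hτ1
  rw [map_smul, smul_eq_mul] at h1
  have h6 : τ * fderiv ℝ (maxFun β (F n)) x v ≤ τ * (fderiv ℝ (maxFun β f) x v + ε) := by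
    nlinarith
  exact le_of_mul_le_mul_left h6 hτ0'

/-- Pointwise convergence of the gradients of the maximal functions. -/
lemma RadialW11Tendsto.ae_tendsto_gradient (hd : 1 ≤ d) (hβ0 : 0 < β) (hβd : β < d)
    (H : RadialW11Tendsto f g F G) (h0 : 0 < ∫ z, ‖f z‖) :
    ∀ᵐ x, Filter.Tendsto (fun n => gradient (maxFun β (F n)) x) Filter.atTop
      (nhds (gradient (maxFun β f) x)) := by
  filter_upwards [ae_ne_zero hd, H.limit.ae_differentiableAt_maxFun hd hβ0 hβd,
    ae_all_iff.2 fun n => (H.seq n).ae_differentiableAt_maxFun hd hβ0 hβd] with x hx h1 h2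
  have key : ∀ v, Filter.Tendsto (fun n => fderiv ℝ (maxFun β (F n)) x v) Filter.atTop
      (nhds (fderiv ℝ (maxFun β f) x v)) := by
    intro v
    rw [Metric.tendsto_nhds]
    intro ε hε
    -- The upper bound in direction `-v` is the lower bound in direction `v`.
    filter_upwards [H.eventually_fderiv_le hd hβ0 hβd h0 hx h1 h2 v (half_pos hε),
      H.eventually_fderiv_le hd hβ0 hβd h0 hx h1 h2 (-v) (half_pos hε)] with n h3 h4
    rw [map_neg, map_neg] at h4
    rw [Real.dist_eq, abs_lt]
    constructor <;> linarith
  have h3 : Filter.Tendsto (fun n => (gradient (maxFun β (F n)) x).ofLp) Filter.atTop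
      (nhds (gradient (maxFun β f) x).ofLp) := by
    refine tendsto_pi_nhds.2 fun i => ?_
    simp only [gradient_apply]
    exact key _
  exact ((PiLp.continuous_toLp 2 _).tendsto _).comp h3

end Convergence

/-! ### Convergence of the gradients in `L^q`. -/

section Continuity

variable {d : ℕ} {𝕜 : Type*} [RCLike 𝕜] {β : ℝ}

lemma tendsto_setLIntegral_zero_of_eventually_notMem {α : Type*} [MeasurableSpace α]
    {μ : Measure α} {w : α → ℝ≥0∞} {S : ℕ → Set α} (hS : ∀ n, MeasurableSet (S n))
    (hsub : ∀ n, S n ⊆ S 0) (hw : AEMeasurable w μ) (hfin : ∫⁻ x in S 0, w x ∂μ ≠ ⊤)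
    (hev : ∀ᵐ x ∂μ, ∀ᶠ n in Filter.atTop, x ∉ S n) :
    Filter.Tendsto (fun n => ∫⁻ x in S n, w x ∂μ) Filter.atTop (nhds 0) := by
  have h1 : ∀ n, ∫⁻ x in S n, w x ∂μ = ∫⁻ x, (S n).indicator w x ∂μ := fun n =>
    (lintegral_indicator (hS n) w).symm
  simp only [h1]
  have h2 := tendsto_lintegral_of_dominated_convergence' (μ := μ) ((S 0).indicator w)
    (F := fun n => (S n).indicator w) (f := fun _ => 0) (fun n => hw.indicator (hS n))
    (fun n => Filter.Eventually.of_forall fun x =>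
      Set.indicator_le_indicator_of_subset (hsub n) (fun _ => zero_le) x)
    (by rwa [lintegral_indicator (hS 0)])
    (by
      filter_upwards [hev] with x hx
      refine tendsto_const_nhds.congr' (hx.mono fun n hn => ?_)
      beta_reduce
      rw [Set.indicator_of_notMem hn])
  simpa using h2

lemma tendsto_setLIntegral_ball_zero (hd : 1 ≤ d) {w : EuclideanSpace ℝ (Fin d) → ℝ≥0∞}
    (hw : AEMeasurable w)
    (hfin : ∫⁻ x in ball 0 1, w x ≠ ⊤) :
    Filter.Tendsto (fun n : ℕ => ∫⁻ x in ball 0 ((n + 1 : ℝ)⁻¹), w x) Filter.atTop (nhds 0) := by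
  refine tendsto_setLIntegral_zero_of_eventually_notMem (fun _ => measurableSet_ball)
    (fun n => ball_subset_ball (inv_anti₀ (by simp) (by simp))) hw (by simpa using hfin) ?_
  filter_upwards [ae_ne_zero hd] with x hx
  obtain ⟨m, hm⟩ := exists_nat_gt ‖x‖⁻¹
  filter_upwards [Filter.eventually_ge_atTop m] with n hn
  have : (m : ℝ) ≤ n := by exact_mod_cast hn
  rw [mem_ball_zero_iff, not_lt]
  exact inv_le_of_inv_le₀ (norm_pos_iff.2 hx) (by linarith)

lemma tendsto_setLIntegral_compl_ball {w : EuclideanSpace ℝ (Fin d) → ℝ≥0∞} (hw : AEMeasurable w)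
    (hfin : ∫⁻ x in (ball 0 1)ᶜ, w x ≠ ⊤) :
    Filter.Tendsto (fun n : ℕ => ∫⁻ x in (ball 0 (n + 1 : ℝ))ᶜ, w x) Filter.atTop (nhds 0) := by
  refine tendsto_setLIntegral_zero_of_eventually_notMem (fun _ => measurableSet_ball.compl)
    (fun n => Set.compl_subset_compl.2 (ball_subset_ball (by simp))) hw (by simpa using hfin)
    (Filter.Eventually.of_forall fun x => ?_)
  obtain ⟨m, hm⟩ := exists_nat_gt ‖x‖
  filter_upwards [Filter.eventually_ge_atTop m] with n hn
  have : (m : ℝ) ≤ n := by exact_mod_cast hn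
  simp only [Set.mem_compl_iff, mem_ball_zero_iff, not_not]
  linarith

lemma gradBound_mono (hβd : β < d) {N N' s : ℝ} (hs : 0 ≤ s) (h : N ≤ N') :
    gradBound d β N s ≤ gradBound d β N' s := by
  have hdβ : 0 < (d : ℝ) - β := by linarith
  have hκ := unitVol_pos (d := d)
  unfold gradBound
  gcongr

lemma measurable_gradBound (N q : ℝ) : Measurable fun x : EuclideanSpace ℝ (Fin d) =>
    ENNReal.ofReal (gradBound d β N (‖x‖ / 2)) ^ q :=
  (ENNReal.measurable_ofReal.comp ((((measurable_norm.div_const 2).pow_const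
    (β - d - 1)).const_mul ((d - β) * (unitVol d)⁻¹)).mul_const N)).pow_const q

/-- The threshold decays like `‖x‖^(β-d-1)`, and `(d + 1 - β) * q = d + q` exceeds `d`, so its
`q`-th power is integrable at infinity. -/
lemma setLIntegral_gradBound_ne_top (hβd : β < d) {N : ℝ} (hN : 0 ≤ N) :
    ∫⁻ x in (ball (0 : EuclideanSpace ℝ (Fin d)) 1)ᶜ,
      ENNReal.ofReal (gradBound d β N (‖x‖ / 2)) ^ ((d : ℝ) / (d - β)) ≠ ⊤ := by
  have hdβ : 0 < (d : ℝ) - β := by linarith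
  have hκ := unitVol_pos (d := d)
  set q := (d : ℝ) / (d - β) with hq
  have hq0 : 0 ≤ q := by positivity
  rcases Nat.eq_zero_or_pos d with hd | hd
  · have hd' : (d : ℝ) = 0 := by exact_mod_cast hd
    have : q = 0 := by rw [hq, hd', zero_div]
    subst hd
    rw [this]
    simp only [ENNReal.rpow_zero, lintegral_const, one_mul]
    rw [Measure.restrict_apply_univ]
    have : (ball (0 : EuclideanSpace ℝ (Fin 0)) 1)ᶜ = ∅ := by
      ext x; simp [Subsingleton.elim x 0]
    simp [this]
  have hd0 : (0 : ℝ) < d := by exact_mod_cast hd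
  have hqpos : 0 < q := by positivity
  -- The factor `1/4` comes from `‖x‖ / 2 ≥ (1 + ‖x‖) / 4` for `‖x‖ ≥ 1`.
  set c := (d - β) * (unitVol d)⁻¹ * (4 : ℝ)⁻¹ ^ (β - d - 1) * N with hc
  have hc0 : 0 ≤ c := by positivity
  have hpt : ∀ x ∈ (ball (0 : EuclideanSpace ℝ (Fin d)) 1)ᶜ,
      ENNReal.ofReal (gradBound d β N (‖x‖ / 2)) ^ q ≤
      ENNReal.ofReal c ^ q * ENNReal.ofReal ((1 + ‖x‖) ^ (-((d : ℝ) + q))) := by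
    intro x hx
    have hx1 : 1 ≤ ‖x‖ := by simpa using hx
    have h1 : gradBound d β N (‖x‖ / 2) ≤ c * (1 + ‖x‖) ^ (β - d - 1) := by
      have h2 : (‖x‖ / 2) ^ (β - d - 1) ≤ ((4 : ℝ)⁻¹ * (1 + ‖x‖)) ^ (β - d - 1) :=
        Real.rpow_le_rpow_of_nonpos (by positivity) (by linarith) (by linarith)
      rw [Real.mul_rpow (by positivity) (by positivity)] at h2
      rw [hc, gradBound]
      calc (d - β) * (unitVol d)⁻¹ * (‖x‖ / 2) ^ (β - d - 1) * N
          ≤ (d - β) * (unitVol d)⁻¹ * ((4 : ℝ)⁻¹ ^ (β - d - 1) * (1 + ‖x‖) ^ (β - d - 1)) * N := by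
            gcongr
        _ = _ := by ring
    have h3 : ((1 + ‖x‖) ^ (β - d - 1)) ^ q = (1 + ‖x‖) ^ (-((d : ℝ) + q)) := by
      rw [← Real.rpow_mul (by positivity)]
      congr 1
      rw [hq]
      field_simp
      ring
    calc ENNReal.ofReal (gradBound d β N (‖x‖ / 2)) ^ q
        ≤ ENNReal.ofReal (c * (1 + ‖x‖) ^ (β - d - 1)) ^ q :=
          ENNReal.rpow_le_rpow (ENNReal.ofReal_le_ofReal h1) hq0
      _ = _ := by
          rw [ENNReal.ofReal_mul hc0, ENNReal.mul_rpow_of_nonneg _ _ hq0,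
            ENNReal.ofReal_rpow_of_nonneg (by positivity) hq0 (x := (1 + ‖x‖) ^ (β - d - 1)), h3]
  refine ne_top_of_le_ne_top ?_ ((setLIntegral_mono' measurableSet_ball.compl hpt).trans
    (setLIntegral_le_lintegral _ _))
  rw [lintegral_const_mul' _ _ (ENNReal.rpow_ne_top_of_nonneg hq0 ENNReal.ofReal_ne_top)]
  refine ENNReal.mul_ne_top (ENNReal.rpow_ne_top_of_nonneg hq0 ENNReal.ofReal_ne_top) ?_
  refine (finite_integral_one_add_norm ?_).ne
  rw [finrank_euclideanSpace_fin]
  linarith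

/-- The difference of two nonnegative numbers is at most the larger one, so no power of 2 appears.
-/
lemma enorm_norm_sub_norm_rpow_le {q : ℝ} (hq : 0 ≤ q) (a b : EuclideanSpace ℝ (Fin d)) :
    ‖‖a‖ - ‖b‖‖ₑ ^ q ≤ ‖a‖ₑ ^ q + ‖b‖ₑ ^ q := by
  have key : ∀ a b : EuclideanSpace ℝ (Fin d), ‖a‖ ≤ ‖b‖ → ‖‖a‖ - ‖b‖‖ₑ ^ q ≤ ‖b‖ₑ ^ q := by
    intro a b hab
    refine ENNReal.rpow_le_rpow ?_ hq
    rw [← ofReal_norm, ← ofReal_norm]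
    refine ENNReal.ofReal_le_ofReal ?_
    rw [Real.norm_eq_abs, abs_le]
    constructor <;> linarith [norm_nonneg a]
  rcases le_total ‖a‖ ‖b‖ with h | h
  · exact (key a b h).trans le_add_self
  · rw [← enorm_neg, neg_sub]
    exact (key b a h).trans le_self_add

variable {f : EuclideanSpace ℝ (Fin d) → 𝕜}
    {g : EuclideanSpace ℝ (Fin d) → EuclideanSpace 𝕜 (Fin d)}
  {F : ℕ → EuclideanSpace ℝ (Fin d) → 𝕜}
      {G : ℕ → EuclideanSpace ℝ (Fin d) → EuclideanSpace 𝕜 (Fin d)}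

/-- Best radii on the annulus are at least `r₀` for `f` and for all large `n`, so all these
gradients are bounded by one constant, and dominated convergence applies. -/
lemma RadialW11Tendsto.tendsto_lintegral_annulus (hd : 1 ≤ d) (hβ0 : 0 < β) (hβd : β < d)
    (H : RadialW11Tendsto f g F G) (h0 : 0 < ∫ z, ‖f z‖) {a b : ℝ} (ha : 0 < a) (hb : 0 < b) :
    Filter.Tendsto (fun n => ∫⁻ x in (ball (0 : EuclideanSpace ℝ (Fin d)) a)ᶜ ∩ ball 0 b,
      ‖‖gradient (maxFun β (F n)) x‖ - ‖gradient (maxFun β f) x‖‖ₑ ^ ((d : ℝ) / (d - β)))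
      Filter.atTop (nhds 0) := by
  have hdβ : 0 < (d : ℝ) - β := by linarith
  have hd0 : (0 : ℝ) < d := by exact_mod_cast hd
  have hq : 0 < (d : ℝ) / (d - β) := by positivity
  obtain ⟨N, hN1, -, hN⟩ := H.exists_bound
  obtain ⟨r₀, R, hr₀, h1, h2⟩ := H.exists_best_radius_bounds (β := β) hd hβ0 hβd h0 ha hb
  set K := gradBound d β N r₀
  have hbd : ∀ (u : EuclideanSpace ℝ (Fin d) → 𝕜)
      (w : EuclideanSpace ℝ (Fin d) → EuclideanSpace 𝕜 (Fin d)), IsRadialW11 u w →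
      ∫ z, ‖u z‖ ≤ N → ∀ x, a ≤ ‖x‖ →
      (∃ r, maxFun β u x = fracAvg β u x r ∧ r₀ ≤ r ∧ r ≤ R) →
      ‖gradient (maxFun β u) x‖ ≤ K := by
    rintro u w hu huN x hxa ⟨r, hbest, hr, -⟩
    rw [norm_gradient]
    exact (hu.norm_fderiv_maxFun_le_rpow hd hβ0 hβd (norm_pos_iff.1 (ha.trans_le hxa)) hr₀ hr
      hbest).trans (gradBound_mono hβd hr₀.le huN)
  have hm : MeasurableSet ((ball (0 : EuclideanSpace ℝ (Fin d)) a)ᶜ ∩ ball 0 b) :=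
    measurableSet_ball.compl.inter measurableSet_ball
  have hlim := tendsto_lintegral_filter_of_dominated_convergence (l := Filter.atTop)
    (μ := volume.restrict ((ball (0 : EuclideanSpace ℝ (Fin d)) a)ᶜ ∩ ball 0 b))
    (F := fun n x => ‖‖gradient (maxFun β (F n)) x‖ - ‖gradient (maxFun β f) x‖‖ₑ ^
      ((d : ℝ) / (d - β))) (f := fun _ => 0)
    (fun _ => ENNReal.ofReal K ^ ((d : ℝ) / (d - β)) + ENNReal.ofReal K ^ ((d : ℝ) / (d - β)))
    (Filter.Eventually.of_forall fun n =>
      ((measurable_gradient _).norm.sub (measurable_gradient _).norm).enorm.pow_const _) ?_ ?_ ?_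
  · simpa using hlim
  · filter_upwards [h2] with n hn
    filter_upwards [ae_restrict_mem hm] with x hx
    have hxa : a ≤ ‖x‖ := by simpa using hx.1
    have hxb : ‖x‖ ≤ b := by simpa using (mem_ball.1 hx.2).le
    refine (enorm_norm_sub_norm_rpow_le hq.le _ _).trans (add_le_add ?_ ?_)
    · exact enorm_rpow_le hq.le (hbd _ _ (H.seq n) (hN n).1 x hxa (hn x hxa hxb))
    · exact enorm_rpow_le hq.le (hbd _ _ H.limit hN1 x hxa (h1 x hxa hxb))
  · rw [lintegral_const, Measure.restrict_apply_univ]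
    have hK : ENNReal.ofReal K ^ ((d : ℝ) / (d - β)) ≠ ⊤ :=
      ENNReal.rpow_ne_top_of_nonneg hq.le ENNReal.ofReal_ne_top
    refine ENNReal.mul_ne_top (ENNReal.add_ne_top.2 ⟨hK, hK⟩) ?_
    exact ((measure_mono Set.inter_subset_right).trans_lt measure_ball_lt_top).ne
  · refine ae_restrict_of_ae ?_
    filter_upwards [H.ae_tendsto_gradient hd hβ0 hβd h0] with x hx
    have h3 : Filter.Tendsto (fun n => ‖gradient (maxFun β (F n)) x‖ -
        ‖gradient (maxFun β f) x‖) Filter.atTop (nhds 0) := by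
      simpa using hx.norm.sub_const ‖gradient (maxFun β f) x‖
    have h4 := (ENNReal.continuous_rpow_const (y := (d : ℝ) / (d - β))).tendsto _ |>.comp h3.enorm
    simpa [ENNReal.zero_rpow_of_pos hq, Function.comp_def] using h4

lemma exists_const_mul_rpow_le (C : ℝ≥0) {q : ℝ} (hq : 0 < q) {ε : ℝ≥0∞} (hε : 0 < ε) :
    ∃ η > 0, ∀ y ≤ η, C * y ^ q ≤ ε := by
  have h1 : Filter.Tendsto (fun y : ℝ≥0∞ => C * y ^ q) (nhds 0) (nhds 0) := by
    have h2 := (ENNReal.continuous_rpow_const (y := q)).tendsto 0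
    rw [ENNReal.zero_rpow_of_pos hq] at h2
    simpa using ENNReal.Tendsto.const_mul h2 (Or.inr (ENNReal.coe_ne_top (r := C)))
  have h3 := ENNReal.tendsto_nhds_zero.1 h1 ε hε
  obtain ⟨η, hη, h4⟩ := ENNReal.nhds_zero_basis_Iic.eventually_iff.1 h3
  exact ⟨η, hη, fun y hy => h4 hy⟩

lemma RadialW11Tendsto.tendsto_lintegral_enorm_sub (H : RadialW11Tendsto f g F G) :
    Filter.Tendsto (fun n => ∫⁻ z, ‖G n z - g z‖ₑ) Filter.atTop (nhds 0) := by
  have h1 := ENNReal.tendsto_ofReal H.tendsto_grad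
  rw [ENNReal.ofReal_zero] at h1
  refine h1.congr fun n => ?_
  exact ofReal_integral_norm_eq_lintegral_enorm
    ((H.seq n).integrable_grad.sub H.limit.integrable_grad)

lemma setLIntegral_enorm_le_add {E : Type*} [NormedAddCommGroup E]
    {u v : EuclideanSpace ℝ (Fin d) → E}
    (hv : AEStronglyMeasurable v) (S : Set (EuclideanSpace ℝ (Fin d))) :
    ∫⁻ z in S, ‖u z‖ₑ ≤ (∫⁻ z in S, ‖v z‖ₑ) + ∫⁻ z, ‖u z - v z‖ₑ := by
  calc ∫⁻ z in S, ‖u z‖ₑ ≤ ∫⁻ z in S, (‖v z‖ₑ + ‖u z - v z‖ₑ) := by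
        refine lintegral_mono fun z => ?_
        have := enorm_add_le (v z) (u z - v z)
        rwa [add_sub_cancel] at this
    _ = (∫⁻ z in S, ‖v z‖ₑ) + ∫⁻ z in S, ‖u z - v z‖ₑ :=
        lintegral_add_left' hv.enorm.restrict _
    _ ≤ _ := by gcongr; exact Measure.restrict_le_self

lemma IsRadialW11.grad_ae_eq_zero (h : IsRadialW11 f g) (h0 : ∫ y, ‖f y‖ = 0) :
    g =ᵐ[volume] 0 := by
  have hf : f =ᵐ[volume] 0 := by
    have := (integral_eq_zero_iff_of_nonneg (fun _ => norm_nonneg _) h.integrable_fun.norm).1 h0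
    filter_upwards [this] with x hx
    simpa using hx
  have hz : HasWeakGradOn Set.univ f (0 : EuclideanSpace ℝ (Fin d) → EuclideanSpace 𝕜 (Fin d)) := by
    refine ⟨h.hasWeakGradOn.1, locallyIntegrable_zero.locallyIntegrableOn _,
      fun φ _ _ _ i => ?_⟩
    have h1 : ∫ x, fderiv ℝ φ x (EuclideanSpace.single i 1) • f x = 0 := by
      refine integral_eq_zero_of_ae ?_
      filter_upwards [hf] with x hx
      simp [hx]
    rw [h1]
    simp
  filter_upwards [h.hasWeakGradOn.ae_eq isOpen_univ hz] with x hx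
  exact hx (Set.mem_univ _)

/-- Continuity of the gradient of the maximal function along convergent sequences. -/
lemma RadialW11Tendsto.tendsto_lintegral_gradient (hd : 1 ≤ d) (hβ0 : 0 < β) (hβd : β < d)
    (hzero : LocalBoundNearZero 𝕜 d β) (hinfty : LocalBoundNearInfinity 𝕜 d β)
    (H : RadialW11Tendsto f g F G) :
    Filter.Tendsto (fun n => ∫⁻ x,
      ‖‖gradient (maxFun β (F n)) x‖ - ‖gradient (maxFun β f) x‖‖ₑ ^ ((d : ℝ) / (d - β)))
      Filter.atTop (nhds 0) := by
  have hdβ : 0 < (d : ℝ) - β := by linarith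
  have hd0 : (0 : ℝ) < d := by exact_mod_cast hd
  have hq : 0 < (d : ℝ) / (d - β) := by positivity
  have hgi := H.limit.integrable_grad
  rw [ENNReal.tendsto_nhds_zero]
  intro ε hε
  rcases integral_norm_eq_zero_or_pos f with h0 | h0
  -- When `f = 0` also `g = 0` almost everywhere, and the global bound controls the gradient of `M
  -- (F n)` by the `L¹` norm of `G n`, which tends to zero.
  · obtain ⟨C, hC⟩ := hzero.exists_lintegral_gradient_le hd hβ0 hβd
    obtain ⟨η, hη, hηC⟩ := exists_const_mul_rpow_le C hq hε
    filter_upwards [ENNReal.tendsto_nhds_zero.1 H.tendsto_lintegral_enorm_sub η hη] with n hn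
    have h1 : ∫⁻ z, ‖G n z‖ₑ = ∫⁻ z, ‖G n z - g z‖ₑ := by
      refine lintegral_congr_ae ?_
      filter_upwards [H.limit.grad_ae_eq_zero h0] with z hz
      simp [hz]
    simp only [gradient_maxFun_eq_zero H.limit.integrable_fun h0, norm_zero, sub_zero, enorm_norm]
    refine (hC _ _ (H.seq n)).trans (hηC _ ?_)
    rwa [h1]
  obtain ⟨N, hN1, -, hN⟩ := H.exists_bound
  have hN0 : 0 ≤ N := h0.le.trans hN1
  -- Nine shares: four near the origin and four near infinity (two for `f` and two for `F n` in each
  -- region), and one on the annulus.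
  have hε9 : 0 < ε / 9 := ENNReal.div_pos hε.ne' (by simp)
  obtain ⟨C, hC⟩ := hzero.exists_lintegral_ball_le hd hβ0 hβd
  obtain ⟨C', hC'⟩ := hinfty.exists_lintegral_compl_ball_le hd hβ0 hβd
  obtain ⟨η, hη, hηC⟩ := exists_const_mul_rpow_le C hq hε9
  obtain ⟨η', hη', hηC'⟩ := exists_const_mul_rpow_le C' hq hε9
  have hη2 : 0 < η / 2 := ENNReal.half_pos hη.ne'
  have hη2' : 0 < η' / 2 := ENNReal.half_pos hη'.ne'
  have hgfin : ∀ S : Set (EuclideanSpace ℝ (Fin d)), ∫⁻ z in S, ‖g z‖ₑ ≠ ⊤ := fun S =>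
    ((setLIntegral_le_lintegral _ _).trans_lt hgi.2).ne
  -- choice of the small ball
  obtain ⟨m, hm⟩ := (ENNReal.tendsto_nhds_zero.1 (tendsto_setLIntegral_ball_zero hd
    hgi.1.enorm (hgfin _)) _ hη2).exists
  set ρ : ℝ := (m + 1 : ℝ)⁻¹ / 2 with hρ
  have hρ0 : 0 < ρ := by positivity
  have h2ρ : 2 * ρ = (m + 1 : ℝ)⁻¹ := by rw [hρ]; ring
  set K := ENNReal.ofReal (gradBound d β N (ρ / 2)) ^ ((d : ℝ) / (d - β)) with hK
  have hKfin : K ≠ ⊤ := ENNReal.rpow_ne_top_of_nonneg hq.le ENNReal.ofReal_ne_top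
  -- The order of choice matters: `ρ` makes the gradient mass small and thereby fixes `K`; only then
  -- is the inner radius `a` taken so small that integrating `K` costs little.
  have hvol : Filter.Tendsto (fun n : ℕ =>
      K * volume (ball (0 : EuclideanSpace ℝ (Fin d)) ((n + 1 : ℝ)⁻¹)))
      Filter.atTop (nhds 0) := by
    have h1 := tendsto_setLIntegral_ball_zero hd (w := fun _ : EuclideanSpace ℝ (Fin d) => 1)
        aemeasurable_const
      (by simpa using measure_ball_lt_top.ne)
    simp only [lintegral_one, Measure.restrict_apply_univ] at h1
    simpa using ENNReal.Tendsto.const_mul h1 (Or.inr hKfin)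
  have hinv : Filter.Tendsto (fun n : ℕ => (n + 1 : ℝ)⁻¹) Filter.atTop (nhds 0) := by
    simpa using tendsto_one_div_add_atTop_nhds_zero_nat (𝕜 := ℝ)
  obtain ⟨k, hk, hkρ⟩ := ((ENNReal.tendsto_nhds_zero.1 hvol _ hε9).and
    (hinv.eventually (gt_mem_nhds (half_pos hρ0)))).exists
  set a : ℝ := (k + 1 : ℝ)⁻¹ with ha
  have ha0 : 0 < a := by positivity
  -- choice of the large ball
  have htail := tendsto_setLIntegral_compl_ball (measurable_gradBound (d := d) (β := β) N
    ((d : ℝ) / (d - β))).aemeasurable (setLIntegral_gradBound_ne_top hβd hN0)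
  obtain ⟨l, hl1, hl2⟩ := ((ENNReal.tendsto_nhds_zero.1 htail _ hε9).and
    (ENNReal.tendsto_nhds_zero.1 (tendsto_setLIntegral_compl_ball hgi.1.enorm (hgfin _)) _
      hη2')).exists
  -- The estimate near infinity sees the gradient outside `ball 0 (b / 4)`, hence the factor 4.
  set b : ℝ := 4 * (l + 1 : ℝ) with hb
  have hb0 : 0 < b := by positivity
  have hb4 : b / 4 = l + 1 := by rw [hb]; ring
  have hsmall : ∀ (u : EuclideanSpace ℝ (Fin d) → 𝕜)
      (w : EuclideanSpace ℝ (Fin d) → EuclideanSpace 𝕜 (Fin d)), IsRadialW11 u w →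
      ∫ z, ‖u z‖ ≤ N → (∫⁻ z, ‖w z - g z‖ₑ) ≤ min (η / 2) (η' / 2) →
      ∫⁻ x in ball 0 a, ‖gradient (maxFun β u) x‖ₑ ^ ((d : ℝ) / (d - β)) ≤ 2 * (ε / 9) ∧
      ∫⁻ x in (ball 0 b)ᶜ, ‖gradient (maxFun β u) x‖ₑ ^ ((d : ℝ) / (d - β)) ≤ 2 * (ε / 9) := by
    intro u w hu huN hw
    constructor
    · refine (hC u w hu ρ a hρ0 hkρ.le).trans ?_
      rw [two_mul (ε / 9)]
      refine add_le_add (hηC _ ?_) ?_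
      · rw [h2ρ]
        refine (setLIntegral_enorm_le_add hgi.1 _).trans ?_
        rw [← ENNReal.add_halves η]
        exact add_le_add hm (hw.trans (min_le_left _ _))
      · refine le_trans (mul_le_mul_left (ENNReal.rpow_le_rpow (ENNReal.ofReal_le_ofReal
          (gradBound_mono hβd (half_pos hρ0).le huN)) hq.le) _) hk
    · refine (hC' u w hu b hb0).trans ?_
      rw [two_mul (ε / 9)]
      refine add_le_add (hηC' _ ?_) ?_
      · rw [hb4]
        refine (setLIntegral_enorm_le_add hgi.1 _).trans ?_
        rw [← ENNReal.add_halves η']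
        exact add_le_add hl2 (hw.trans (min_le_right _ _))
      · refine le_trans ?_ hl1
        refine le_trans (lintegral_mono fun x => ?_) (lintegral_mono_set
          (Set.compl_subset_compl.2 (ball_subset_ball (show (l + 1 : ℝ) ≤ b by
            rw [hb]; linarith [l.cast_nonneg (α := ℝ)]))))
        exact ENNReal.rpow_le_rpow (ENNReal.ofReal_le_ofReal
          (gradBound_mono hβd (by positivity) huN)) hq.le
  have hf := hsmall f g H.limit hN1 (by simp)
  filter_upwards [ENNReal.tendsto_nhds_zero.1 H.tendsto_lintegral_enorm_sub _ (lt_min hη2 hη2'),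
    ENNReal.tendsto_nhds_zero.1 (H.tendsto_lintegral_annulus hd hβ0 hβd h0 ha0 hb0) _ hε9]
    with n hn1 hn2
  have hF := hsmall (F n) (G n) (H.seq n) (hN n).1 hn1
  have hsum : ∀ S : Set (EuclideanSpace ℝ (Fin d)),
      ∫⁻ x in S, ‖gradient (maxFun β (F n)) x‖ₑ ^ ((d : ℝ) / (d - β)) ≤ 2 * (ε / 9) →
      ∫⁻ x in S, ‖gradient (maxFun β f) x‖ₑ ^ ((d : ℝ) / (d - β)) ≤ 2 * (ε / 9) →
      ∫⁻ x in S, ‖‖gradient (maxFun β (F n)) x‖ - ‖gradient (maxFun β f) x‖‖ₑ ^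
        ((d : ℝ) / (d - β)) ≤ 2 * (ε / 9) + 2 * (ε / 9) := by
    intro S h1 h2
    refine (lintegral_mono fun x => enorm_norm_sub_norm_rpow_le hq.le _ _).trans ?_
    rw [lintegral_add_left ((measurable_gradient _).enorm.pow_const _)]
    exact add_le_add h1 h2
  have hcover : (Set.univ : Set (EuclideanSpace ℝ (Fin d))) =
      ball 0 a ∪ ((ball (0 : EuclideanSpace ℝ (Fin d)) a)ᶜ ∩ ball 0 b ∪ (ball 0 b)ᶜ) := by
    ext x
    simp only [Set.mem_univ, Set.mem_union, Set.mem_inter_iff, Set.mem_compl_iff, true_iff]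
    tauto
  rw [← setLIntegral_univ, hcover]
  refine (lintegral_union_le _ _ _).trans ?_
  refine (add_le_add (hsum _ hF.1 hf.1) ((lintegral_union_le _ _ _).trans
    (add_le_add hn2 (hsum _ hF.2 hf.2)))).trans_eq ?_
  have h9 : 9 * (ε / 9) = ε := ENNReal.mul_div_cancel (by simp) (by simp)
  generalize ε / 9 = e at h9
  rw [← h9]
  ring

end Continuity

/-! ### From sequences to the continuity statement. -/

section Sequences

lemma tendsto_integral_norm_of_eLpNorm_lt {α E : Type*} [MeasurableSpace α] {μ : Measure α}
    [NormedAddCommGroup E] {u : ℕ → α → E} (hu : ∀ n, Integrable (u n) μ)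
    (h : ∀ n : ℕ, eLpNorm (u n) 1 μ ≤ ENNReal.ofReal (1 / (n + 1 : ℝ))) :
    Filter.Tendsto (fun n => ∫ z, ‖u n z‖ ∂μ) Filter.atTop (nhds 0) := by
  refine squeeze_zero (fun n => integral_nonneg fun _ => norm_nonneg _) (fun n => ?_)
    tendsto_one_div_add_atTop_nhds_zero_nat
  have h1 := h n
  rwa [eLpNorm_one_eq_lintegral_enorm, ← ofReal_integral_norm_eq_lintegral_enorm (hu n),
    ENNReal.ofReal_le_ofReal_iff (by positivity)] at h1

end Sequences

theorem mainTheorem6 {𝕜 : Type*} [RCLike 𝕜] (d : ℕ) (hd : 1 ≤ d) (β : ℝ) (hβ0 : 0 < β)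
    (hβ1 : β < 1) (hzero : LocalBoundNearZero 𝕜 d β) (hinfty : LocalBoundNearInfinity 𝕜 d β) :
    -- `|∇M_β f|` is a well-defined element of `L^q(ℝᵈ)` for every `f ∈ W^{1,1}_rad(ℝᵈ)`
    (∀ (f : EuclideanSpace ℝ (Fin d) → 𝕜)
        (g : EuclideanSpace ℝ (Fin d) → EuclideanSpace 𝕜 (Fin d)), IsRadialW11 f g →
        ∃ G : EuclideanSpace ℝ (Fin d) → EuclideanSpace ℝ (Fin d),
          HasWeakGradFracMaximalOn Set.univ β f G ∧
          MemLp G (ENNReal.ofReal ((d : ℝ) / (d - β))) volume) ∧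
    -- the map `f ↦ |∇M_β f|` is continuous at every `f`
    (∀ (f : EuclideanSpace ℝ (Fin d) → 𝕜)
    (g : EuclideanSpace ℝ (Fin d) → EuclideanSpace 𝕜 (Fin d))
        (G : EuclideanSpace ℝ (Fin d) → EuclideanSpace ℝ (Fin d)),
        IsRadialW11 f g → HasWeakGradFracMaximalOn Set.univ β f G →
        ∀ ε : ℝ, 0 < ε → ∃ δ : ℝ, 0 < δ ∧
          ∀ (f' : EuclideanSpace ℝ (Fin d) → 𝕜)
            (g' : EuclideanSpace ℝ (Fin d) → EuclideanSpace 𝕜 (Fin d))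
            (G' : EuclideanSpace ℝ (Fin d) → EuclideanSpace ℝ (Fin d)),
            IsRadialW11 f' g' → HasWeakGradFracMaximalOn Set.univ β f' G' →
            eLpNorm (fun x => f' x - f x) 1 volume + eLpNorm (fun x => g' x - g x) 1 volume
              < ENNReal.ofReal δ →
            eLpNorm (fun x => ‖G' x‖ - ‖G x‖) (ENNReal.ofReal ((d : ℝ) / (d - β))) volume
              < ENNReal.ofReal ε) := by

  have hβd : β < d := hβ1.trans_le (by exact_mod_cast hd)
  have hdβ : 0 < (d : ℝ) - β := by linarith
  have hq : 0 < (d : ℝ) / (d - β) := div_pos (by linarith) hdβ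
  refine ⟨fun f g h => ⟨_, h.exists_weakGrad hd hβ0 hβd hzero⟩, fun f g G h hG ε hε => ?_⟩
  -- Failure of continuity at `f` yields a sequence converging to `f` with distances below `1 / (n +
  -- 1)`. The given weak gradients may be replaced by classical ones, with which they agree almost
  -- everywhere.
  by_contra! hcon
  choose F Gs G' hF hG' hlt hge using fun n : ℕ => hcon (1 / (n + 1 : ℝ)) (by positivity)
  have H : RadialW11Tendsto f g F Gs :=
    { limit := h
      seq := hF
      tendsto_fun := tendsto_integral_norm_of_eLpNorm_lt
        (fun n => (hF n).integrable_fun.sub h.integrable_fun)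
        fun n => le_self_add.trans (hlt n).le
      tendsto_grad := tendsto_integral_norm_of_eLpNorm_lt
        (fun n => (hF n).integrable_grad.sub h.integrable_grad)
        fun n => le_add_self.trans (hlt n).le }
  have h1 := H.tendsto_lintegral_gradient hd hβ0 hβd hzero hinfty
  have h2 : Filter.Tendsto (fun n => (∫⁻ x, ‖‖gradient (maxFun β (F n)) x‖ -
      ‖gradient (maxFun β f) x‖‖ₑ ^ ((d : ℝ) / (d - β))) ^ (1 / ((d : ℝ) / (d - β))))
      Filter.atTop (nhds 0) := by
    have h3 := (ENNReal.continuous_rpow_const (y := 1 / ((d : ℝ) / (d - β)))).tendsto 0 |>.comp h1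
    rw [ENNReal.zero_rpow_of_pos (by positivity)] at h3
    exact h3
  obtain ⟨n, hn⟩ := (h2.eventually_lt_const (ENNReal.ofReal_pos.2 hε)).exists
  refine absurd hn (not_lt.2 ((hge n).trans_eq ?_))
  rw [← ENNReal.toReal_ofReal hq.le, ← eLpNorm_eq_lintegral_rpow_enorm_toReal (by simpa using hq)
    ENNReal.ofReal_ne_top, ENNReal.toReal_ofReal hq.le]
  refine eLpNorm_congr_ae ?_
  filter_upwards [h.ae_eq_gradient hd hβ0 hβd hG,
    (hF n).ae_eq_gradient hd hβ0 hβd (hG' n)] with x hx hx'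
  rw [hx, hx']
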